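/- **Setting.** Let $d\ge 1$ be an integer, $(\mathcal X,d_{\mathcal X})$ a metric space with its Borel $\sigma$-algebra, $\mu$ a measure on $\mathcal X$ and $B_r(x)=\{x':d_{\mathcal X}(x,x')\le r\}$. Assume: 1. $x_1,x_2,\dots$ are i.i.d. with density $p$ with respect to $\mu$, and there are constants with $0<p_{\min}<p(x)<p_{\max}$ for all $x\in\mathcal X$; 2. there are $r_0,c_{1},c_{2}>0$ with $c_{1}r^d\le\mu(B_r(x))\le c_{2}r^d$ for all $x\in\mathcal X$ and $0<r<r_0$; 3. there are a homeomorphism $h:\mathcal X\to[0,1]^d$ and constants $L_{\min},L_{\max}>0$ with $L_{\min}d_{\mathcal X}(x,x')\le\|h(x)-h(x')\|_2\le L_{\max}d_{\mathcal X}(x,x')$ for all $x,x'\in\mathcal X$. For $A\subset\mathbb R^d$ write $B_\epsilon(A)=\{z:\exists a\in A,\ \|z-a\|_2\le\epsilon\}$, and $\Omega_\epsilon=[0,1]^d\setminus B_\epsilon(\partial[0,1]^d)$. A function $g:[0,1]^d\to\mathbb R$ is *piecewise Lipschitz* (with respect to $\mu,h$) if there are a Lebesgue-null set $\mathcal S\subset(0,1)^d$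 and constants $C_{\mathcal S},\epsilon_0,L_0>0$ such that for all $0<\epsilon<\epsilon_0$: (i) $\mu\big(h^{-1}(B_\epsilon(\mathcal S)\cup([0,1]^d\setminus\Omega_\epsilon))\big)\le C_{\mathcal S}\,\epsilon$; (ii) $|g(z)-g(z')|\le L_0\|z-z'\|_2$ whenever $z,z'$ lie in the same connected component of $\Omega_\epsilon\setminus B_\epsilon(\mathcal S)$. Let $\mathcal F$ be the class of measurable $f_0:\mathcal X\to\mathbb R$ which are essentially bounded with respect to $\mu$ and for which $g_0=f_0\circ h^{-1}$ is piecewise Lipschitz. For a sample of size $n$ and $K=K_n\in\mathbb N$, let $\mathcal N(x)$ be a set of $K$ nearest neighbours of $x$ among $x_1,\dots,x_n$ (all the points if $K>n$; ties broken arbitrarily), and $$\mathrm{AErr}=\int\Big(f_0(x)-\frac1K\sum_{i\in\mathcal N(x)}f_0(x_i)\Big)^2p(x)\,\mu(dx).$$ $Z_n=O_{\mathbb P}(a_n)$ means: for every $\delta>0$ there is $M>0$ with $\mathbb P(Z_n>Ma_n)\le\delta$ for all large $n$. **Theorem.** (a) If $f_0\in\mathcal F$ and $K/\log n\to\infty$,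 then $$\mathrm{AErr}=O_{\mathbb P}\Big(\frac{K^{1/d}}{n^{1/d}}\Big).$$ (b) Let $d\ge2$ and $y_i=f_0(x_i)+\varepsilon_i$, where the $\varepsilon_i$ are i.i.d., independent of $(x_i)$, with $\mathbb E\varepsilon_i=0$ and $\mathbb P(|\varepsilon_i|>t)\le C\exp(-t^2/(2\sigma^2))$ for all $t>0$, for some $C,\sigma>0$. Let $r>0$ and $K\asymp\log^{1+2r}n$. Let $G_K$ be the $K$-nearest-neighbour graph on $\{1,\dots,n\}$: $i\ne j$ are joined iff $x_i$ is among the $K$ nearest neighbours of $x_j$ (among the observations other than $x_j$; ties broken arbitrarily), or vice versa. With $\nabla_{G_K}$ an oriented incidence matrix of $G_K$, let $$\hat\theta=\arg\min_{\theta\in\mathbb R^n}\Big\{\tfrac12\|y-\theta\|_2^2+\lambda_n\|\nabla_{G_K}\theta\|_1\Big\},\qquad \hat f(x)=\frac1{|\mathcal N(x)|}\sum_{i\in\mathcal N(x)}\hat\theta_i .$$ Then there is a deterministic choice of $\lambda_n>0$, not depending on $f_0$, such that for every $f_0\in\mathcal F$ $$\mathbb E_{X\sim p}\big|f_0(X)-\hat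 f(X)\big|^2=O_{\mathbb P}\Big(\frac{\log^{2.5+3r+(1+2r)/d}n}{n^{1/d}}\Big),$$ where the expectation is over a new point $X$ with density $p$, the training data being held fixed. -/

import Mathlib

open MeasureTheory ProbabilityTheory Filter Topology
open scoped ENNReal Matrix

namespace KNNFL

noncomputable section

/-- The unit cube `[0,1]^d` in Euclidean space. -/
def unitCube (d : ℕ) : Set (EuclideanSpace ℝ (Fin d)) :=
  {z | ∀ i, 0 ≤ z i ∧ z i ≤ 1}

/-- The closed enlargement `B_ε(A)`: points within distance `ε` of some point of `A`. -/
def enlarge {E : Type*} [MetricSpace E] (ε : ℝ) (A : Set E) : Set E :=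
  {a | ∃ b ∈ A, dist a b ≤ ε}

/-- The set `Ω_ε`: the unit cube with the `ε`-enlargement of its boundary removed. -/
def innerCube (d : ℕ) (ε : ℝ) : Set (EuclideanSpace ℝ (Fin d)) :=
  unitCube d \ enlarge ε (frontier (unitCube d))

/-! ### Conditions on the covariates -/

/-- The density is measurable and strictly between two positive constants. -/
def BoundedDensity {𝒳 : Type*} [MeasurableSpace 𝒳] (p : 𝒳 → ℝ) : Prop :=
  Measurable p ∧ ∃ pmin pmax : ℝ, 0 < pmin ∧ ∀ x, pmin < p x ∧ p x < pmax

/-- Balls of small radius `r` have `μ`-measure of the order of `r ^ d`, uniformly in the centre. -/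
def VolumeGrowth {𝒳 : Type*} [MetricSpace 𝒳] [MeasurableSpace 𝒳] (μ : Measure 𝒳) (d : ℕ) :
    Prop :=
  ∃ r₀ c₁ c₂ : ℝ, 0 < r₀ ∧ 0 < c₁ ∧ 0 < c₂ ∧ ∀ x : 𝒳, ∀ r : ℝ, 0 < r → r < r₀ →
    ENNReal.ofReal (r ^ d * c₁) ≤ μ (Metric.closedBall x r) ∧
      μ (Metric.closedBall x r) ≤ ENNReal.ofReal (c₂ * r ^ d)

/-- The homeomorphism `h` onto the unit cube distorts distances by bounded factors only. -/
def BoundedDistortion {𝒳 : Type*} [MetricSpace 𝒳] {d : ℕ} (h : 𝒳 ≃ₜ unitCube d) : Prop :=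
  ∃ Lmin Lmax : ℝ, 0 < Lmin ∧ 0 < Lmax ∧ ∀ x x' : 𝒳,
    Lmin * dist x x' ≤ dist (h x) (h x') ∧ dist (h x) (h x') ≤ Lmax * dist x x'

/-- The law on `𝒳` with density `p` with respect to `μ`. -/
def covariateLaw {𝒳 : Type*} [MeasurableSpace 𝒳] (μ : Measure 𝒳) (p : 𝒳 → ℝ) : Measure 𝒳 :=
  μ.withDensity (fun x => ENNReal.ofReal (p x))

/-- `X 0, X 1, …` are i.i.d. with density `p` with respect to `μ`. -/
structure IsIIDSample {𝒳 Ω : Type*} [MeasurableSpace 𝒳] [MeasurableSpace Ω]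
    (P : Measure Ω) (μ : Measure 𝒳) (p : 𝒳 → ℝ) (X : ℕ → Ω → 𝒳) : Prop where
  measurable : ∀ i, Measurable (X i)
  indep : iIndepFun X P
  law : ∀ i, P.map (X i) = covariateLaw μ p

/-- I.i.d. mean-zero sub-Gaussian errors `ε 0, ε 1, …`, independent of the covariates `X`. -/
structure IsSubGaussianNoise {𝒳 Ω : Type*} [MeasurableSpace 𝒳] [MeasurableSpace Ω]
    (P : Measure Ω) (X : ℕ → Ω → 𝒳) (C σ : ℝ) (ε : ℕ → Ω → ℝ) : Prop where
  measurable : ∀ i, Measurable (ε i)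
  indep : iIndepFun ε P
  identDistrib : ∀ i, IdentDistrib (ε i) (ε 0) P P
  mean_zero : ∀ i, ∫ ω, ε i ω ∂P = 0
  const_pos : 0 < C
  scale_pos : 0 < σ
  tail : ∀ i, ∀ t : ℝ, 0 < t →
    P {ω | t < |ε i ω|} ≤ ENNReal.ofReal (C * Real.exp (-t ^ 2 / (2 * σ ^ 2)))
  indep_covariates : IndepFun (fun ω i => ε i ω) (fun ω i => X i ω) P

/-! ### Piecewise Lipschitz functions -/

/-- A function `g` on the unit cube is piecewise Lipschitz (relative to `μ` and `h`) if there is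
a Lebesgue null set `S` in the open cube whose `ε`-enlargement, together with the `ε`-margin of the
cube, has `μ ∘ h⁻¹`-measure at most `C ε`, and such that `g` is `L₀`-Lipschitz on each connected
component of `Ω_ε \ B_ε(S)`. -/
def PiecewiseLipschitz {𝒳 : Type*} [MetricSpace 𝒳] [MeasurableSpace 𝒳] (μ : Measure 𝒳) {d : ℕ}
    (h : 𝒳 ≃ₜ unitCube d) (g : unitCube d → ℝ) : Prop :=
  ∃ S : Set (EuclideanSpace ℝ (Fin d)), S ⊆ {z | ∀ i, 0 < z i ∧ z i < 1} ∧
    volume S = 0 ∧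
    ∃ C ε₀ L₀ : ℝ, 0 < C ∧ 0 < ε₀ ∧ 0 < L₀ ∧ ∀ ε : ℝ, 0 < ε → ε < ε₀ →
      μ {x | (h x : EuclideanSpace ℝ (Fin d)) ∈
          enlarge ε S ∪ (unitCube d \ innerCube d ε)} ≤ ENNReal.ofReal (C * ε) ∧
      ∀ z z' : unitCube d,
        (z' : EuclideanSpace ℝ (Fin d)) ∈
            connectedComponentIn (innerCube d ε \ enlarge ε S) (z : EuclideanSpace ℝ (Fin d)) →
          |g z - g z'| ≤ L₀ * dist z z'

/-- The class of regression functions: `f₀` is measurable, essentially bounded, and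
`f₀ ∘ h⁻¹` is piecewise Lipschitz. -/
structure IsRegressionFunction {𝒳 : Type*} [MetricSpace 𝒳] [MeasurableSpace 𝒳] (μ : Measure 𝒳)
    {d : ℕ} (h : 𝒳 ≃ₜ unitCube d) (f₀ : 𝒳 → ℝ) : Prop where
  measurable : Measurable f₀
  essBounded : ∃ B : ℝ, ∀ᵐ x ∂μ, |f₀ x| ≤ B
  piecewiseLipschitz : PiecewiseLipschitz μ h (f₀ ∘ h.symm)

/-! ### Nearest neighbours -/

/-- `S` is a set of `K` nearest neighbours of `x` among the points `x_i`, `i ∈ A`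
(all of them if there are fewer than `K`). Ties may be broken in any way. -/
def IsNearest {𝒳 ι : Type*} [MetricSpace 𝒳] (K : ℕ) (A : Finset ι) (pts : ι → 𝒳) (x : 𝒳)
    (S : Finset ι) : Prop :=
  S ⊆ A ∧ S.card = min K A.card ∧
    ∀ i ∈ S, ∀ j ∈ A, j ∉ S → dist (pts i) x ≤ dist (pts j) x

/-- The `K`-NN graph: `i` and `j` are joined iff one of them is among the chosen nearest
neighbours `nb` of the other. -/
def knnGraph {n : ℕ} (nb : Fin n → Finset (Fin n)) : SimpleGraph (Fin n) :=
  SimpleGraph.fromRel (fun i j => i ∈ nb j)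

/-! ### The fused lasso on a graph -/

/-- Edges of `G`, each oriented from its smaller to its larger endpoint. -/
abbrev OrientedEdge {n : ℕ} (G : SimpleGraph (Fin n)) : Type :=
  {e : Fin n × Fin n // e.1 < e.2 ∧ G.Adj e.1 e.2}

/-- The oriented incidence matrix `∇_G`. -/
def incidence {n : ℕ} (G : SimpleGraph (Fin n)) : Matrix (OrientedEdge G) (Fin n) ℝ :=
  Matrix.of fun e l => if l = e.1.1 then 1 else if l = e.1.2 then -1 else 0

open Classical in
/-- The penalty `‖∇_G θ‖₁`. -/
def penalty {n : ℕ} (G : SimpleGraph (Fin n)) (θ : Fin n → ℝ) : ℝ :=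
  ∑ e : OrientedEdge G, |(incidence G *ᵥ θ) e|

/-- The fused lasso objective `½ ‖y - θ‖² + lam ‖∇_G θ‖₁`. -/
def flObjective {n : ℕ} (G : SimpleGraph (Fin n)) (lam : ℝ) (y θ : Fin n → ℝ) : ℝ :=
  1 / 2 * ∑ i, (y i - θ i) ^ 2 + lam * penalty G θ

/-- `θ` is the fused lasso estimator over `G` with tuning parameter `lam` and data `y`. -/
def IsFusedLasso {n : ℕ} (G : SimpleGraph (Fin n)) (lam : ℝ) (y θ : Fin n → ℝ) : Prop :=
  ∀ θ' : Fin n → ℝ, flObjective G lam y θ ≤ flObjective G lam y θ'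

/-! ### Prediction and errors -/

/-- The prediction at a point whose set of nearest neighbours is `S`: the kernel average of the
fitted values `θ i` with kernel weight `1` if `i ∈ S` and `0` otherwise. -/
def predict {n : ℕ} (θ : Fin n → ℝ) (S : Finset (Fin n)) : ℝ :=
  (∑ j, if j ∈ S then (1 : ℝ) else 0)⁻¹ * ∑ i, θ i * (if i ∈ S then (1 : ℝ) else 0)

/-- The approximation error
`∫ (f₀(x) - K⁻¹ ∑_{i ∈ N(x)} f₀(x_i))² p(x) μ(dx)`, with values in `[0, ∞]`. -/
def aErr {𝒳 : Type*} [MeasurableSpace 𝒳] (μ : Measure 𝒳) (p f₀ : 𝒳 → ℝ) (K : ℕ) {n : ℕ}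
    (pts : Fin n → 𝒳) (N : 𝒳 → Finset (Fin n)) : ℝ≥0∞ :=
  ∫⁻ x, ENNReal.ofReal ((f₀ x - (K : ℝ)⁻¹ * ∑ i ∈ N x, f₀ (pts i)) ^ 2 * p x) ∂μ

/-- The mean integrated squared error `E_{X ∼ p} |f₀(X) - f̂(X)|²` of a prediction function,
conditionally on the training data, with values in `[0, ∞]`. -/
def mise {𝒳 : Type*} [MeasurableSpace 𝒳] (μ : Measure 𝒳) (p f₀ fhat : 𝒳 → ℝ) : ℝ≥0∞ :=
  ∫⁻ x, ENNReal.ofReal (|f₀ x - fhat x| ^ 2) ∂(covariateLaw μ p)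

/-- `Z n = O_P(a n)`: for each `δ > 0` there is `M` with `P (Z n > M a n) ≤ δ` for all large `n`. -/
def IsBigOP {Ω : Type*} [MeasurableSpace Ω] (P : Measure Ω) (Z : ℕ → Ω → ℝ≥0∞) (a : ℕ → ℝ) :
    Prop :=
  ∀ δ : ℝ, 0 < δ → ∃ M : ℝ, 0 < M ∧ ∀ᶠ n in atTop,
    P {ω | ENNReal.ofReal (M * a n) < Z n ω} ≤ ENNReal.ofReal δ

end

end KNNFL

/-! Everything happens at the scale R of order (K/n)^(1/d). Since a ball of radius r has mass of
order r^d, Chernoff bounds over a finite grid show that with high probability every ball of radius R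
holds more than K sample points, so all nearest neighbours lie within R (`exists_radius_count`). Off
a set A of mass O(R), namely the points near the jump set or the boundary of the cube, f₀ varies by
at most a multiple of R over such a ball (`PiecewiseLipschitz.exists_close`). The squared
approximation error is therefore O(R²) off A and bounded on A, and integrates to O(R). This is part
(a).

For part (b), the basic inequality of the fused lasso reduces the fit at the sample points to two
estimates. The first is that f₀ has penalty O(nKR): an edge costs O(R) unless it starts at one of
the O(nR) sample points in A. The second is a bound, uniform in Δ, of the inner product of the noise
with Δ by λ times the penalty of Δ plus a small multiple of the Euclidean norm of Δ.

The second estimate comes from a dyadic grid with about n/K cells (`exists_dyadic_grid`). Each cell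
holds at least κK points, and points in equal or adjacent cells are joined in the graph. So Δ may be
replaced by its cell means, whose grid total variation is controlled by the penalty. On the grid,
repeated averaging over blocks of side two writes the inner product as a telescoping sum over scales
(`abs_sum_mul_le_gridTV`). At scale 2^l the total variation has shrunk by 2^(l(1-d)), while the
noise sums over blocks have grown only by 2^(ld/2). For d ≥ 2 the product does not grow, so the J =
O(log n) scales contribute equally at worst. With noise sums of order sqrt(log n) this costs a
constant times log^1.5 n, and λ = log^(1.5+r) n absorbs every constant, which is why λ need not know
f₀ or the noise level.

Finally, a sample point influences predictions only within distance R, on a set of mass O(K/n).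
Averaging over K neighbours thus turns the sum of squared errors at the sample points into 1/n of
it, up to a constant (`mise_le`). The leading term λK(K/n)^(1/d) has exactly the stated logarithmic
exponent. -/

namespace KNNFL

noncomputable section

/-! ### Total variation on grids -/

/-- The grid points with coordinates `0, …, N - 1`. -/
def box (d N : ℕ) : Finset (Fin d → ℕ) := Fintype.piFinset fun _ => Finset.range N

/-- The total variation of a function along the edges of the grid `box d N`. -/
def gridTV {d : ℕ} (N : ℕ) (a : (Fin d → ℕ) → ℝ) : ℝ :=
  ∑ k, ∑ x ∈ box d N, if x k + 1 < N then |a x - a (x + Pi.single k 1)| else 0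

/-- Averages over the blocks of side two. -/
def coarse {d : ℕ} (a : (Fin d → ℕ) → ℝ) (x : Fin d → ℕ) : ℝ :=
  ((2 : ℝ) ^ d)⁻¹ * ∑ b ∈ box d 2, a (2 • x + b)

theorem mem_box {d N : ℕ} {x : Fin d → ℕ} : x ∈ box d N ↔ ∀ i, x i < N := by
  simp [box]

theorem card_box (d N : ℕ) : (box d N).card = N ^ d := by
  simp [box]

theorem gridTV_nonneg {d : ℕ} (N : ℕ) (a : (Fin d → ℕ) → ℝ) : 0 ≤ gridTV N a :=
  Finset.sum_nonneg fun k _ => Finset.sum_nonneg fun x _ => by split_ifs <;> positivity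

theorem sum_box_two_mul {d : ℕ} (N : ℕ) (F : (Fin d → ℕ) → ℝ) :
    ∑ x ∈ box d N, ∑ b ∈ box d 2, F (2 • x + b) = ∑ y ∈ box d (2 * N), F y := by
  rw [← Finset.sum_product']
  refine Finset.sum_nbij' (fun p => 2 • p.1 + p.2) (fun y => (fun i => y i / 2, fun i => y i % 2))
    ?_ ?_ ?_ ?_ ?_
  · rintro ⟨x, b⟩ hxb
    simp only [Finset.mem_product, mem_box] at hxb ⊢
    intro i
    have h1 := hxb.1 i
    have h2 := hxb.2 i
    simp only [Pi.add_apply, Pi.smul_apply, smul_eq_mul]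
    omega
  · intro y hy
    simp only [Finset.mem_product, mem_box] at hy ⊢
    refine ⟨fun i => ?_, fun i => Nat.mod_lt _ (by norm_num)⟩
    have := hy i
    omega
  · rintro ⟨x, b⟩ hxb
    simp only [Finset.mem_product, mem_box] at hxb
    ext i
    · have h2 := hxb.2 i
      simp only [Pi.add_apply, Pi.smul_apply, smul_eq_mul]
      omega
    · have h2 := hxb.2 i
      simp only [Pi.add_apply, Pi.smul_apply, smul_eq_mul]
      omega
  · intro y _
    ext i
    simp only [Pi.add_apply, Pi.smul_apply, smul_eq_mul]
    omega
  · simp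

/-- Neighbouring block means differ by the average of 2^d differences between points two steps
apart. Each such difference splits into two unit edges, and a fine edge occurs at most once as a
first step and at most once as a second step: hence the factor 2 over 2^d. -/
theorem gridTV_coarse_le {d : ℕ} (N : ℕ) (a : (Fin d → ℕ) → ℝ) :
    gridTV N (coarse a) ≤ 2 / 2 ^ d * gridTV (2 * N) a := by
  unfold gridTV
  rw [Finset.mul_sum]
  refine Finset.sum_le_sum fun k _ => ?_
  set e : Fin d → ℕ := Pi.single k 1 with he
  have hek : e k = 1 := by simp [he]
  set G : (Fin d → ℕ) → ℝ := fun z => if z k + 1 < 2 * N then |a z - a (z + e)| else 0 with hG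
  have hG0 : ∀ z, 0 ≤ G z := fun z => by simp only [hG]; split_ifs <;> positivity
  have hpt : ∀ x ∈ box d N, (if x k + 1 < N then |coarse a x - coarse a (x + e)| else 0) ≤
      ((2 : ℝ) ^ d)⁻¹ * (∑ b ∈ box d 2, G (2 • x + b) +
        ∑ b ∈ box d 2, if (2 • x + b) k + 1 < 2 * N then G (2 • x + b + e) else 0) := by
    intro x _
    split_ifs with hx
    · unfold coarse
      rw [← mul_sub, abs_mul, abs_of_nonneg (by positivity : (0 : ℝ) ≤ ((2 : ℝ) ^ d)⁻¹)]
      refine mul_le_mul_of_nonneg_left ?_ (by positivity)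
      rw [← Finset.sum_sub_distrib, ← Finset.sum_add_distrib]
      refine (Finset.abs_sum_le_sum_abs _ _).trans (Finset.sum_le_sum fun b hb => ?_)
      have hbk := mem_box.1 hb k
      have h1 : (2 • x + b) k + 1 < 2 * N := by simp; omega
      have h2 : (2 • x + b + e) k + 1 < 2 * N := by simp [hek]; omega
      have h3 : 2 • (x + e) + b = 2 • x + b + e + e := by
        ext i; simp; ring
      simp only [hG, h1, h2, if_true, h3]
      exact abs_sub_le _ _ _
    · refine mul_nonneg (by positivity) (add_nonneg (Finset.sum_nonneg fun _ _ => hG0 _)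
        (Finset.sum_nonneg fun _ _ => ?_))
      split_ifs
      exacts [hG0 _, le_rfl]
  refine (Finset.sum_le_sum hpt).trans ?_
  rw [← Finset.mul_sum, Finset.sum_add_distrib, sum_box_two_mul N G,
    sum_box_two_mul N (fun y => if y k + 1 < 2 * N then G (y + e) else 0)]
  -- The second steps, as a shifted family, are again distinct edges of the fine grid.
  have hshift : ∑ y ∈ box d (2 * N), (if y k + 1 < 2 * N then G (y + e) else 0) ≤
      ∑ z ∈ box d (2 * N), G z := by
    rw [← Finset.sum_filter, ← Finset.sum_image (f := G) (g := fun y => y + e)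
      (fun y _ z _ h => add_right_cancel h)]
    refine Finset.sum_le_sum_of_subset_of_nonneg ?_ fun z _ _ => hG0 z
    intro z hz
    obtain ⟨y, hy, rfl⟩ := Finset.mem_image.1 hz
    rw [Finset.mem_filter, mem_box] at hy
    rw [mem_box]
    intro i
    by_cases hi : i = k
    · subst hi; simpa [hek] using hy.2
    · simpa [he, hi] using hy.1 i
  calc _ ≤ ((2 : ℝ) ^ d)⁻¹ * (∑ z ∈ box d (2 * N), G z + ∑ z ∈ box d (2 * N), G z) := by gcongr
    _ = _ := by ring

theorem abs_sub_update_le {d : ℕ} (g : (Fin d → ℕ) → ℝ) {c : Fin d → ℕ} (hc : c ∈ box d 2)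
    (k : Fin d) {v : ℕ} (hv : v < 2) :
    |g c - g (Function.update c k v)| ≤
      ∑ x ∈ box d 2, if x k + 1 < 2 then |g x - g (x + Pi.single k 1)| else 0 := by
  have hnn : ∀ x ∈ box d 2,
      0 ≤ (if x k + 1 < 2 then |g x - g (x + Pi.single k 1)| else 0) := by
    intro x _; split_ifs <;> positivity
  have hck := mem_box.1 hc k
  have hu : Function.update c k v ∈ box d 2 := by
    rw [mem_box]; intro i
    by_cases hi : i = k
    · subst hi; simpa using hv
    · simpa [hi] using mem_box.1 hc i
  rcases lt_trichotomy (c k) v with h | h | h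
  · have : Function.update c k v = c + Pi.single k 1 := by
      ext i
      by_cases hi : i = k
      · subst hi; simp; omega
      · simp [hi]
    refine le_trans ?_ (Finset.single_le_sum hnn hc)
    rw [if_pos (by omega), this]
  · subst h
    simpa using Finset.sum_nonneg hnn
  · have : c = Function.update c k v + Pi.single k 1 := by
      ext i
      by_cases hi : i = k
      · subst hi; simp; omega
      · simp [hi]
    refine le_trans ?_ (Finset.single_le_sum hnn hu)
    rw [if_pos (by simp; omega), ← this, abs_sub_comm]

/-- Changing the coordinates one at a time leads from b to b' along at most one edge in each
direction. -/
theorem abs_sub_le_gridTV_two {d : ℕ} (g : (Fin d → ℕ) → ℝ) {b b' : Fin d → ℕ}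
    (hb : b ∈ box d 2) (hb' : b' ∈ box d 2) : |g b - g b'| ≤ gridTV 2 g := by
  classical
  have key : ∀ s : Finset (Fin d), |g b - g (s.piecewise b' b)| ≤
      ∑ k ∈ s, ∑ x ∈ box d 2, if x k + 1 < 2 then |g x - g (x + Pi.single k 1)| else 0 := by
    intro s
    induction s using Finset.induction_on with
    | empty => simp
    | insert k s hk ih =>
      rw [Finset.piecewise_insert, Finset.sum_insert hk, add_comm]
      refine (abs_sub_le _ (g (s.piecewise b' b)) _).trans (add_le_add ih ?_)
      refine abs_sub_update_le g ?_ k (mem_box.1 hb' k)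
      rw [mem_box]; intro i
      by_cases hi : i ∈ s
      · simpa [hi] using mem_box.1 hb' i
      · simpa [hi] using mem_box.1 hb i
  simpa [gridTV] using key Finset.univ

/-- Inside a block each value differs from the mean by at most the total variation of the block.
There are 2^d values per block, and the edge sets of different blocks are disjoint. -/
theorem sum_abs_sub_coarse_le {d : ℕ} (N : ℕ) (a : (Fin d → ℕ) → ℝ) :
    ∑ x ∈ box d N, ∑ b ∈ box d 2, |a (2 • x + b) - coarse a x| ≤ 2 ^ d * gridTV (2 * N) a := by
  have h1 : ∀ x ∈ box d N, ∑ b ∈ box d 2, |a (2 • x + b) - coarse a x| ≤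
      2 ^ d * gridTV 2 (fun b => a (2 • x + b)) := by
    intro x _
    have : ∀ b ∈ box d 2, |a (2 • x + b) - coarse a x| ≤ gridTV 2 (fun b => a (2 • x + b)) := by
      intro b hb
      have h2 : a (2 • x + b) - coarse a x =
          ((2 : ℝ) ^ d)⁻¹ * ∑ b' ∈ box d 2, (a (2 • x + b) - a (2 • x + b')) := by
        rw [Finset.sum_sub_distrib, Finset.sum_const, card_box, coarse]
        simp only [nsmul_eq_mul, Nat.cast_pow, Nat.cast_ofNat]
        field_simp
      rw [h2, abs_mul, abs_of_nonneg (by positivity : (0 : ℝ) ≤ ((2 : ℝ) ^ d)⁻¹)]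
      calc _ ≤ ((2 : ℝ) ^ d)⁻¹ * ∑ b' ∈ box d 2, gridTV 2 (fun b => a (2 • x + b)) := by
            gcongr
            exact (Finset.abs_sum_le_sum_abs _ _).trans (Finset.sum_le_sum fun b' hb' =>
              abs_sub_le_gridTV_two (fun b => a (2 • x + b)) hb hb')
        _ = _ := by
            rw [Finset.sum_const, card_box]
            simp only [nsmul_eq_mul, Nat.cast_pow, Nat.cast_ofNat]
            field_simp
    refine (Finset.sum_le_sum this).trans (le_of_eq ?_)
    rw [Finset.sum_const, card_box]; simp
  refine (Finset.sum_le_sum h1).trans ?_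
  rw [← Finset.mul_sum]
  refine mul_le_mul_of_nonneg_left ?_ (by positivity)
  unfold gridTV
  rw [Finset.sum_comm]
  refine Finset.sum_le_sum fun k _ => ?_
  refine le_trans ?_ (sum_box_two_mul N _).le
  refine Finset.sum_le_sum fun x hx => Finset.sum_le_sum fun b _ => ?_
  have hxk := mem_box.1 hx k
  beta_reduce
  rw [← add_assoc]
  split_ifs with hb h3
  · exact le_rfl
  · exact absurd (by simp; omega) h3
  · positivity
  · exact le_rfl

/-- Dyadic chaining: the inner product of `s` and `a` on a dyadic grid is controlled by the total
variation of `a` and the sums of `s` over dyadic blocks. -/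
theorem abs_sum_mul_le_gridTV {d : ℕ} : ∀ (J : ℕ) (a s : (Fin d → ℕ) → ℝ) (B : ℕ → ℝ),
    (∀ l ≤ J, ∀ x, |∑ y ∈ box d (2 ^ J) with (fun i => y i / 2 ^ l) = x, s y| ≤ B l) →
    |∑ y ∈ box d (2 ^ J), s y * a y| ≤
      (∑ l ∈ Finset.range J, B l * (2 / 2 ^ d) ^ l) * 2 ^ d * gridTV (2 ^ J) a +
        |∑ y ∈ box d (2 ^ J), s y| * ((((2 : ℝ) ^ J) ^ d)⁻¹ * |∑ y ∈ box d (2 ^ J), a y|) := by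
  intro J
  induction J with
  | zero =>
    intro a s B _
    have : box d 1 = {0} := by
      ext x
      simp only [mem_box, Finset.mem_singleton, Nat.lt_one_iff]
      exact ⟨fun h => funext h, fun h => by simp [h]⟩
    simp [this, abs_mul]
  | succ J ih =>
    intro a s B hB
    have e2 : 2 ^ (J + 1) = 2 * 2 ^ J := by ring
    rw [e2] at hB ⊢
    set s' : (Fin d → ℕ) → ℝ := fun x => ∑ b ∈ box d 2, s (2 • x + b) with hs'
    -- Blocks of level l in the coarse grid are blocks of level l + 1 in the fine one, so the
    -- hypothesis passes to the block sums with `B` shifted by one.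
    have hB' : ∀ l ≤ J, ∀ x,
        |∑ y ∈ box d (2 ^ J) with (fun i => y i / 2 ^ l) = x, s' y| ≤ B (l + 1) := by
      intro l hl x
      convert hB (l + 1) (by omega) x using 2
      rw [Finset.sum_filter, Finset.sum_filter, ← sum_box_two_mul]
      refine Finset.sum_congr rfl fun y _ => ?_
      rw [← Finset.sum_filter_add_sum_filter_not (box d 2) (fun _ => (fun i => y i / 2 ^ l) = x)]
      split_ifs with hy
      · simp only [hy, Finset.filter_true, not_true_eq_false, Finset.filter_false,
          Finset.sum_empty, add_zero, hs']
        refine Finset.sum_congr rfl fun b hb => (if_pos ?_).symm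
        rw [← hy]
        ext i
        have := mem_box.1 hb i
        simp only [Pi.add_apply, Pi.smul_apply, smul_eq_mul]
        rw [pow_succ', ← Nat.div_div_eq_div_mul]
        congr 1
        omega
      · simp only [hy, Finset.filter_true, not_false_eq_true, Finset.filter_false,
          Finset.sum_empty, zero_add]
        refine (Finset.sum_eq_zero fun b hb => if_neg ?_).symm
        rintro h2
        refine hy ?_
        rw [← h2]
        ext i
        have := mem_box.1 hb i
        simp only [Pi.add_apply, Pi.smul_apply, smul_eq_mul]
        rw [pow_succ', ← Nat.div_div_eq_div_mul]
        congr 1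
        omega
    have hB0 : ∀ y ∈ box d (2 * 2 ^ J), |s y| ≤ B 0 := by
      intro y hy
      have := hB 0 (by omega) y
      simpa [Finset.sum_filter, hy] using this
    have IH := ih (coarse a) s' (fun l => B (l + 1)) hB'
    have hsum_s : ∑ x ∈ box d (2 ^ J), s' x = ∑ y ∈ box d (2 * 2 ^ J), s y := sum_box_two_mul _ s
    have hsum_a : ∑ x ∈ box d (2 ^ J), coarse a x =
        ((2 : ℝ) ^ d)⁻¹ * ∑ y ∈ box d (2 * 2 ^ J), a y := by
      rw [← sum_box_two_mul, Finset.mul_sum]; rfl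
    have hB_nn : ∀ l ≤ J + 1, 0 ≤ B l := fun l hl => (abs_nonneg _).trans (hB l hl 0)
    -- Within a block `a` is its mean plus a fluctuation. The fluctuations are paid for at this
    -- scale by `B 0`; the means go to the induction hypothesis.
    have hsplit : ∑ y ∈ box d (2 * 2 ^ J), s y * a y =
        ∑ x ∈ box d (2 ^ J), ∑ b ∈ box d 2, s (2 • x + b) * (a (2 • x + b) - coarse a x) +
          ∑ x ∈ box d (2 ^ J), s' x * coarse a x := by
      rw [← sum_box_two_mul _ (fun y => s y * a y), ← Finset.sum_add_distrib]
      refine Finset.sum_congr rfl fun x _ => ?_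
      rw [hs', Finset.sum_mul, ← Finset.sum_add_distrib]
      exact Finset.sum_congr rfl fun b _ => by ring
    have hfirst : |∑ x ∈ box d (2 ^ J), ∑ b ∈ box d 2,
        s (2 • x + b) * (a (2 • x + b) - coarse a x)| ≤
          B 0 * (2 ^ d * gridTV (2 * 2 ^ J) a) := by
      refine le_trans ?_ (mul_le_mul_of_nonneg_left (sum_abs_sub_coarse_le (2 ^ J) a) (hB_nn 0 (by omega)))
      rw [Finset.mul_sum]
      refine (Finset.abs_sum_le_sum_abs _ _).trans (Finset.sum_le_sum fun x hx => ?_)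
      rw [Finset.mul_sum]
      refine (Finset.abs_sum_le_sum_abs _ _).trans (Finset.sum_le_sum fun b hb => ?_)
      rw [abs_mul]
      refine mul_le_mul_of_nonneg_right (hB0 _ ?_) (abs_nonneg _)
      rw [mem_box]; intro i
      have h1 := mem_box.1 hx i
      have h2 := mem_box.1 hb i
      simp only [Pi.add_apply, Pi.smul_apply, smul_eq_mul]
      omega
    rw [hsplit]
    refine (abs_add_le _ _).trans ((add_le_add hfirst IH).trans ?_)
    rw [hsum_s, hsum_a, Finset.sum_range_succ']
    have hq : (∑ l ∈ Finset.range J, B (l + 1) * (2 / 2 ^ d) ^ l) * 2 ^ d *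
        gridTV (2 ^ J) (coarse a) ≤
        (∑ l ∈ Finset.range J, B (l + 1) * (2 / 2 ^ d) ^ (l + 1)) * 2 ^ d *
          gridTV (2 * 2 ^ J) a := by
      calc _ ≤ (∑ l ∈ Finset.range J, B (l + 1) * (2 / 2 ^ d) ^ l) * 2 ^ d *
            (2 / 2 ^ d * gridTV (2 * 2 ^ J) a) := by
            refine mul_le_mul_of_nonneg_left (gridTV_coarse_le _ a) ?_
            exact mul_nonneg (Finset.sum_nonneg fun l hl => mul_nonneg
              (hB_nn _ (by have := Finset.mem_range.1 hl; omega)) (by positivity))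
              (by positivity)
        _ = _ := by
            have : ∀ l, B (l + 1) * ((2 : ℝ) / 2 ^ d) ^ (l + 1) =
              (2 / 2 ^ d) * (B (l + 1) * (2 / 2 ^ d) ^ l) := fun l => by ring
            simp_rw [this]
            rw [← Finset.mul_sum]; ring
    have hm : (((2 : ℝ) ^ J) ^ d)⁻¹ * |((2 : ℝ) ^ d)⁻¹ * ∑ y ∈ box d (2 * 2 ^ J), a y| =
        (((2 : ℝ) ^ (J + 1)) ^ d)⁻¹ * |∑ y ∈ box d (2 * 2 ^ J), a y| := by
      rw [abs_mul, abs_of_nonneg (by positivity : (0 : ℝ) ≤ ((2 : ℝ) ^ d)⁻¹), ← mul_assoc,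
        ← mul_inv, ← mul_pow, ← pow_succ]
    rw [hm]
    simp only [pow_zero, mul_one]
    linarith

/-! ### The fused lasso penalty -/

open Classical in
/-- The sum of the absolute differences over all ordered pairs of adjacent vertices. -/
def pairSum {n : ℕ} (G : SimpleGraph (Fin n)) (θ : Fin n → ℝ) : ℝ :=
  ∑ i, ∑ j, if G.Adj i j then |θ i - θ j| else 0

theorem incidence_mulVec {n : ℕ} (G : SimpleGraph (Fin n)) (θ : Fin n → ℝ) (e : OrientedEdge G) :
    (incidence G *ᵥ θ) e = θ e.1.1 - θ e.1.2 := by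
  have hne : e.1.1 ≠ e.1.2 := e.2.1.ne
  have : ∀ l, (incidence G) e l * θ l =
      (if l = e.1.1 then θ l else 0) - (if l = e.1.2 then θ l else 0) := by
    intro l
    simp only [incidence, Matrix.of_apply]
    by_cases h1 : l = e.1.1
    · have : l ≠ e.1.2 := h1 ▸ hne
      simp [h1, hne]
    · by_cases h2 : l = e.1.2
      · simp [h2, hne.symm]
      · simp [h1, h2]
  rw [Matrix.mulVec, dotProduct]
  simp_rw [this]
  rw [Finset.sum_sub_distrib]
  simp

theorem pairSum_eq {n : ℕ} (G : SimpleGraph (Fin n)) (θ : Fin n → ℝ) :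
    pairSum G θ = 2 * penalty G θ := by
  classical
  have h1 : penalty G θ = ∑ e : Fin n × Fin n with e.1 < e.2 ∧ G.Adj e.1 e.2,
      |θ e.1 - θ e.2| := by
    unfold penalty
    simp_rw [incidence_mulVec]
    rw [Finset.sum_subtype (p := fun e : Fin n × Fin n => e.1 < e.2 ∧ G.Adj e.1 e.2)
      _ (by simp) (fun e => |θ e.1 - θ e.2|)]
  have h2 : penalty G θ = ∑ e : Fin n × Fin n with e.2 < e.1 ∧ G.Adj e.1 e.2,
      |θ e.1 - θ e.2| := by
    rw [h1]
    refine Finset.sum_nbij' Prod.swap Prod.swap ?_ ?_ ?_ ?_ ?_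
    · rintro ⟨i, j⟩ h; simpa [G.adj_comm] using h
    · rintro ⟨i, j⟩ h; simpa [G.adj_comm] using h
    · simp
    · simp
    · rintro ⟨i, j⟩ _; exact abs_sub_comm _ _
  rw [two_mul]
  nth_rewrite 1 [h1]
  rw [h2, pairSum, ← Fintype.sum_prod_type'
    (f := fun i j => if G.Adj i j then |θ i - θ j| else 0), Finset.sum_filter, Finset.sum_filter,
    ← Finset.sum_add_distrib]
  refine Finset.sum_congr rfl ?_
  rintro ⟨i, j⟩ _
  by_cases h : G.Adj i j
  · rcases lt_or_gt_of_ne h.ne with hij | hij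
    · simp [h, hij, hij.not_gt]
    · simp [h, hij, hij.not_gt]
  · simp [h]

theorem penalty_nonneg {n : ℕ} (G : SimpleGraph (Fin n)) (θ : Fin n → ℝ) : 0 ≤ penalty G θ :=
  Finset.sum_nonneg fun _ _ => abs_nonneg _

theorem penalty_sub_le {n : ℕ} (G : SimpleGraph (Fin n)) (θ θ' : Fin n → ℝ) :
    penalty G (θ - θ') ≤ penalty G θ + penalty G θ' := by
  unfold penalty
  rw [← Finset.sum_add_distrib]
  refine Finset.sum_le_sum fun e _ => ?_
  rw [Matrix.mulVec_sub, Pi.sub_apply]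
  exact abs_sub _ _

/-- Every edge comes from at least one neighbour list, so the lists count it at least once.
Comparing sums over ordered pairs avoids a choice of orientation. -/
theorem penalty_knnGraph_le {n : ℕ} (nb : Fin n → Finset (Fin n)) (θ : Fin n → ℝ) :
    penalty (knnGraph nb) θ ≤ ∑ i, ∑ j ∈ nb i, |θ i - θ j| := by
  classical
  have h2 : pairSum (knnGraph nb) θ ≤ 2 * ∑ i, ∑ j ∈ nb i, |θ i - θ j| := by
    have h3 : ∑ i, ∑ j ∈ nb i, |θ i - θ j| = ∑ i, ∑ j, if i ∈ nb j then |θ i - θ j| else 0 := by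
      rw [Finset.sum_comm]
      refine Finset.sum_congr rfl fun i _ => ?_
      rw [← Finset.sum_filter]
      refine Finset.sum_congr (by ext; simp) fun j _ => abs_sub_comm _ _
    have h4 : ∑ i, ∑ j ∈ nb i, |θ i - θ j| = ∑ i, ∑ j, if j ∈ nb i then |θ i - θ j| else 0 := by
      refine Finset.sum_congr rfl fun i _ => ?_
      rw [← Finset.sum_filter]
      exact Finset.sum_congr (by ext; simp) fun j _ => rfl
    rw [two_mul]
    nth_rewrite 1 [h3]
    rw [h4, ← Finset.sum_add_distrib]
    refine Finset.sum_le_sum fun i _ => ?_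
    rw [← Finset.sum_add_distrib]
    refine Finset.sum_le_sum fun j _ => ?_
    have := abs_nonneg (θ i - θ j)
    by_cases h : (knnGraph nb).Adj i j
    · rw [if_pos h]
      rw [knnGraph, SimpleGraph.fromRel_adj] at h
      rcases h.2 with h | h
      · rw [if_pos h]; split_ifs <;> linarith
      · rw [if_pos h]; split_ifs <;> linarith
    · rw [if_neg h]; split_ifs <;> linarith
  rw [pairSum_eq] at h2
  linarith

/-- The basic inequality for the fused lasso. -/
theorem IsFusedLasso.sum_sq_le {n : ℕ} {G : SimpleGraph (Fin n)} {lam τ : ℝ} (hlam : 0 ≤ lam)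
    {f e θ : Fin n → ℝ} (hθ : IsFusedLasso G lam (fun i => f i + e i) θ)
    (hnoise : |∑ i, e i * (θ i - f i)| ≤
      lam * penalty G (θ - f) + τ * Real.sqrt (∑ i, (θ i - f i) ^ 2)) :
    ∑ i, (θ i - f i) ^ 2 ≤ 8 * lam * penalty G f + 4 * τ ^ 2 := by
  have h := hθ f
  unfold flObjective at h
  have h1 : ∑ i, (f i + e i - θ i) ^ 2 =
      ∑ i, e i ^ 2 - 2 * ∑ i, e i * (θ i - f i) + ∑ i, (θ i - f i) ^ 2 := by
    rw [Finset.mul_sum, ← Finset.sum_sub_distrib, ← Finset.sum_add_distrib]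
    exact Finset.sum_congr rfl fun i _ => by ring
  have h2 : ∑ i, (f i + e i - f i) ^ 2 = ∑ i, e i ^ 2 :=
    Finset.sum_congr rfl fun i _ => by ring
  rw [h1, h2] at h
  have h3 := mul_le_mul_of_nonneg_left (penalty_sub_le G θ f) hlam
  have h4 := le_abs_self (∑ i, e i * (θ i - f i))
  have h5 := Real.sq_sqrt (Finset.sum_nonneg fun i (_ : i ∈ Finset.univ) => sq_nonneg (θ i - f i))
  set u := Real.sqrt (∑ i, (θ i - f i) ^ 2)
  -- The penalty of θ cancels, leaving u²/2 ≤ 2·lam·penalty f + τu; then τu ≤ u²/4 + τ².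
  nlinarith [sq_nonneg (u - 2 * τ)]

/-! ### Noise against a function on a graph with a grid of cells -/

/-- Split Δ into its cell means and the rest. The rest is paid for by edges within a cell, averaged
over at least m points, whence E/m. The means vary along the grid by averages over at least m² edges
between adjacent cells, once for each of the d directions, and chaining applies to them. The last
term is the overall mean, which the penalty cannot see. -/
theorem abs_sum_mul_le_penalty {n d J : ℕ} (G : SimpleGraph (Fin n)) (c : Fin n → Fin d → ℕ)
    (hc : ∀ i, c i ∈ box d (2 ^ J))
    (hsame : ∀ i j, i ≠ j → c i = c j → G.Adj i j)
    (hadj : ∀ i j k, c j = c i + Pi.single k 1 → G.Adj i j)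
    {m : ℝ} (hm : 0 < m) (hcount : ∀ y ∈ box d (2 ^ J), m ≤ (Finset.univ.filter (c · = y)).card)
    (e : Fin n → ℝ) {E β : ℝ} {B : ℕ → ℝ} (hE : ∀ i, |e i| ≤ E)
    (hB : ∀ l ≤ J, ∀ x, |∑ i with (fun k => c i k / 2 ^ l) = x, e i| ≤ B l)
    (hβ : ∀ l ≤ J, B l * (2 / 2 ^ d) ^ l ≤ β) (Δ : Fin n → ℝ) :
    |∑ i, e i * Δ i| ≤ (E * m⁻¹ + J * β * 2 ^ d * (d * (m⁻¹ * m⁻¹))) * (2 * penalty G Δ) +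
      |∑ i, e i| * ((((2 : ℝ) ^ J) ^ d)⁻¹ * (m⁻¹ * ∑ i, |Δ i|)) := by
  classical
  rw [← pairSum_eq]
  set F : (Fin d → ℕ) → Finset (Fin n) := fun y => Finset.univ.filter (c · = y) with hF
  set a : (Fin d → ℕ) → ℝ := fun y => ((F y).card : ℝ)⁻¹ * ∑ i ∈ F y, Δ i with ha
  set s : (Fin d → ℕ) → ℝ := fun y => ∑ i ∈ F y, e i with hs
  set q : Fin n → ℝ := fun i => ∑ j, if G.Adj i j then |Δ i - Δ j| else 0 with hq
  have hpair : pairSum G Δ = ∑ i, q i := rfl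
  have hfib : ∀ g : Fin n → ℝ, ∑ y ∈ box d (2 ^ J), ∑ i ∈ F y, g i = ∑ i, g i := fun g =>
    Finset.sum_fiberwise_of_maps_to (fun i _ => hc i) g
  have hcard : ∀ y ∈ box d (2 ^ J), ((F y).card : ℝ)⁻¹ ≤ m⁻¹ := fun y hy =>
    inv_anti₀ hm (hcount y hy)
  have hcard0 : ∀ y ∈ box d (2 ^ J), ((F y).card : ℝ) ≠ 0 := fun y hy =>
    (hm.trans_le (hcount y hy)).ne'
  have hq0 : ∀ i, 0 ≤ q i := fun i => Finset.sum_nonneg fun j _ => by split_ifs <;> positivity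
  have hsub : ∀ i y, (∀ j ∈ F y, i ≠ j → G.Adj i j) → ∑ j ∈ F y, |Δ i - Δ j| ≤ q i := by
    intro i y hy
    calc ∑ j ∈ F y, |Δ i - Δ j| ≤ ∑ j ∈ F y, if G.Adj i j then |Δ i - Δ j| else 0 := by
          refine Finset.sum_le_sum fun j hj => ?_
          by_cases hij : i = j
          · subst hij; simp
          · rw [if_pos (hy j hj hij)]
      _ ≤ q i := Finset.sum_le_univ_sum_of_nonneg fun j => by split_ifs <;> positivity
  have hosc : ∀ i, |Δ i - a (c i)| ≤ m⁻¹ * q i := by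
    intro i
    have h1 : Δ i - a (c i) = ((F (c i)).card : ℝ)⁻¹ * ∑ j ∈ F (c i), (Δ i - Δ j) := by
      have := hcard0 _ (hc i)
      rw [Finset.sum_sub_distrib, Finset.sum_const, nsmul_eq_mul, mul_sub, ha,
        inv_mul_cancel_left₀ this]
    rw [h1, abs_mul, abs_of_nonneg (by positivity : (0 : ℝ) ≤ ((F (c i)).card : ℝ)⁻¹)]
    refine mul_le_mul (hcard _ (hc i)) ((Finset.abs_sum_le_sum_abs _ _).trans (hsub i _ ?_))
      (abs_nonneg _) (by positivity)
    intro j hj hij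
    exact hsame i j hij (Finset.mem_filter.1 hj).2.symm
  have hTV : gridTV (2 ^ J) a ≤ d * (m⁻¹ * m⁻¹) * pairSum G Δ := by
    have hk : ∀ k : Fin d, ∑ x ∈ box d (2 ^ J), (if x k + 1 < 2 ^ J then
        |a x - a (x + Pi.single k 1)| else 0) ≤ m⁻¹ * m⁻¹ * pairSum G Δ := by
      intro k
      rw [hpair, ← hfib q, Finset.mul_sum]
      refine Finset.sum_le_sum fun y hy => ?_
      have hnn : 0 ≤ ∑ i ∈ F y, q i := Finset.sum_nonneg fun i _ => hq0 i
      split_ifs with hyk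
      · set y' := y + Pi.single k 1 with hy'
        have hy'b : y' ∈ box d (2 ^ J) := by
          rw [mem_box]; intro i
          by_cases hi : i = k
          · subst hi; simpa [hy'] using hyk
          · simpa [hy', hi] using mem_box.1 hy i
        have h0 := hcard0 y hy
        have h0' := hcard0 y' hy'b
        -- The difference of two cell means is the mean of Δ i - Δ j over all pairs, and every such
        -- pair is an edge.
        have h1 : a y - a y' = ((F y).card : ℝ)⁻¹ * ((F y').card : ℝ)⁻¹ *
            ∑ i ∈ F y, ∑ j ∈ F y', (Δ i - Δ j) := by
          simp only [Finset.sum_sub_distrib, Finset.sum_const, nsmul_eq_mul, ← Finset.mul_sum, ha]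
          field_simp
        rw [h1, abs_mul, abs_of_nonneg
          (by positivity : (0 : ℝ) ≤ ((F y).card : ℝ)⁻¹ * ((F y').card : ℝ)⁻¹)]
        refine mul_le_mul (mul_le_mul (hcard y hy) (hcard y' hy'b) (by positivity) (by positivity))
          ?_ (abs_nonneg _) (by positivity)
        refine (Finset.abs_sum_le_sum_abs _ _).trans (Finset.sum_le_sum fun i hi =>
          (Finset.abs_sum_le_sum_abs _ _).trans (hsub i y' fun j hj _ => hadj i j k ?_))
        rw [(Finset.mem_filter.1 hi).2, (Finset.mem_filter.1 hj).2]
      · positivity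
    calc gridTV (2 ^ J) a ≤ ∑ _k : Fin d, m⁻¹ * m⁻¹ * pairSum G Δ :=
          Finset.sum_le_sum fun k _ => hk k
      _ = _ := by rw [Finset.sum_const, Finset.card_univ, Fintype.card_fin, nsmul_eq_mul]; ring
  have hsB : ∀ l ≤ J, ∀ x,
      |∑ y ∈ box d (2 ^ J) with (fun i => y i / 2 ^ l) = x, s y| ≤ B l := by
    intro l hl x
    convert hB l hl x using 2
    rw [Finset.sum_filter, Finset.sum_filter,
      ← hfib (fun i => if (fun k => c i k / 2 ^ l) = x then e i else 0)]
    refine Finset.sum_congr rfl fun y _ => ?_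
    split_ifs with h
    · refine Finset.sum_congr rfl fun i hi => ?_
      rw [(Finset.mem_filter.1 hi).2, if_pos h]
    · refine (Finset.sum_eq_zero fun i hi => ?_).symm
      rw [(Finset.mem_filter.1 hi).2, if_neg h]
  have hchain := abs_sum_mul_le_gridTV J a s B hsB
  have hsplit : ∑ i, e i * Δ i =
      ∑ i, e i * (Δ i - a (c i)) + ∑ y ∈ box d (2 ^ J), s y * a y := by
    have : ∑ y ∈ box d (2 ^ J), s y * a y = ∑ i, e i * a (c i) := by
      rw [← hfib]
      refine Finset.sum_congr rfl fun y _ => ?_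
      rw [hs, Finset.sum_mul]
      exact Finset.sum_congr rfl fun i hi => by rw [(Finset.mem_filter.1 hi).2]
    rw [this, ← Finset.sum_add_distrib]
    exact Finset.sum_congr rfl fun i _ => by ring
  have hfirst : |∑ i, e i * (Δ i - a (c i))| ≤ E * m⁻¹ * pairSum G Δ := by
    rw [hpair, Finset.mul_sum]
    refine (Finset.abs_sum_le_sum_abs _ _).trans (Finset.sum_le_sum fun i _ => ?_)
    rw [abs_mul, mul_assoc]
    exact mul_le_mul (hE i) (hosc i) (abs_nonneg _) ((abs_nonneg _).trans (hE i))
  have hsums : ∑ y ∈ box d (2 ^ J), s y = ∑ i, e i := hfib e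
  have hsuma : |∑ y ∈ box d (2 ^ J), a y| ≤ m⁻¹ * ∑ i, |Δ i| := by
    rw [← hfib, Finset.mul_sum]
    refine (Finset.abs_sum_le_sum_abs _ _).trans (Finset.sum_le_sum fun y hy => ?_)
    rw [ha, abs_mul, abs_of_nonneg (by positivity : (0 : ℝ) ≤ ((F y).card : ℝ)⁻¹)]
    exact mul_le_mul (hcard y hy) (Finset.abs_sum_le_sum_abs _ _) (abs_nonneg _) (by positivity)
  have hsumβ : ∑ l ∈ Finset.range J, B l * (2 / 2 ^ d) ^ l ≤ J * β := by
    refine (Finset.sum_le_sum fun l hl => hβ l (Finset.mem_range.1 hl).le).trans (le_of_eq ?_)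
    simp
  have hβ0 : 0 ≤ β := by
    have := (abs_nonneg _).trans (hB 0 (by omega) 0)
    have := hβ 0 (by omega)
    simp at this
    linarith
  rw [hsplit]
  refine (abs_add_le _ _).trans ?_
  rw [hsums] at hchain
  have h1 : (∑ l ∈ Finset.range J, B l * (2 / 2 ^ d) ^ l) * 2 ^ d * gridTV (2 ^ J) a ≤
      J * β * 2 ^ d * (d * (m⁻¹ * m⁻¹) * pairSum G Δ) := by
    refine mul_le_mul (mul_le_mul_of_nonneg_right hsumβ (by positivity)) hTV (gridTV_nonneg _ _)
      (by positivity)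
  have h2 : |∑ i, e i| * ((((2 : ℝ) ^ J) ^ d)⁻¹ * |∑ y ∈ box d (2 ^ J), a y|) ≤
      |∑ i, e i| * ((((2 : ℝ) ^ J) ^ d)⁻¹ * (m⁻¹ * ∑ i, |Δ i|)) := by gcongr
  calc _ ≤ E * m⁻¹ * pairSum G Δ + (J * β * 2 ^ d * (d * (m⁻¹ * m⁻¹) * pairSum G Δ) +
        |∑ i, e i| * ((((2 : ℝ) ^ J) ^ d)⁻¹ * (m⁻¹ * ∑ i, |Δ i|))) :=
        add_le_add hfirst (hchain.trans (add_le_add h1 h2))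
    _ = _ := by ring

/-! ### Counts of sample points -/

section Counts

variable {𝒳 Ω : Type*} [MeasurableSpace 𝒳] [MeasurableSpace Ω] {P : Measure Ω}
  [IsProbabilityMeasure P] {μ : Measure 𝒳} {p : 𝒳 → ℝ} {X : ℕ → Ω → 𝒳}

theorem IsIIDSample.isProbabilityMeasure (hX : IsIIDSample P μ p X) :
    IsProbabilityMeasure (covariateLaw μ p) := by
  rw [← hX.law 0]
  exact Measure.isProbabilityMeasure_map (hX.measurable 0).aemeasurable

open Classical in
/-- The number of the first `n` sample points in `A`. -/
def count {n : ℕ} (pts : Fin n → 𝒳) (A : Set 𝒳) : ℕ := (Finset.univ.filter (pts · ∈ A)).card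

theorem mgf_indicator (hX : IsIIDSample P μ p X) {A : Set 𝒳} (hA : MeasurableSet A) (i : ℕ)
    (t : ℝ) : mgf (fun ω => A.indicator (fun _ => (1 : ℝ)) (X i ω)) P t =
      1 + (Real.exp t - 1) * (covariateLaw μ p).real A := by
  have h1 : (fun ω => Real.exp (t * A.indicator (fun _ => (1 : ℝ)) (X i ω))) =
      fun ω => 1 + (X i ⁻¹' A).indicator (fun _ => Real.exp t - 1) ω := by
    ext ω
    by_cases h : X i ω ∈ A
    · simp [h]
    · simp [h]
  have hm : MeasurableSet (X i ⁻¹' A) := hX.measurable i hA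
  rw [mgf, h1, integral_add (integrable_const _) ((integrable_const _).indicator hm),
    integral_indicator_const _ hm, ← hX.law i,
    map_measureReal_apply (hX.measurable i) hA]
  simp [mul_comm]

theorem mgf_count_le (hX : IsIIDSample P μ p X) {A : Set 𝒳} (hA : MeasurableSet A) (n : ℕ)
    (t : ℝ) : mgf (fun ω => (count (fun i : Fin n => X i ω) A : ℝ)) P t ≤
      Real.exp (n * ((Real.exp t - 1) * (covariateLaw μ p).real A)) := by
  classical
  set Y : Fin n → Ω → ℝ := fun i ω => A.indicator (fun _ => (1 : ℝ)) (X i ω) with hY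
  have hmeas : Measurable (A.indicator (fun _ => (1 : ℝ))) := measurable_const.indicator hA
  have hYm : ∀ i, Measurable (Y i) := fun i => hmeas.comp (hX.measurable i)
  have hYi : iIndepFun Y P :=
    (hX.indep.precomp Fin.val_injective).comp (fun _ => A.indicator fun _ => (1 : ℝ))
      (fun _ => hmeas)
  have hsum : (fun ω => (count (fun i : Fin n => X i ω) A : ℝ)) = ∑ i, Y i := by
    ext ω
    simp [count, hY, Finset.sum_apply, Set.indicator_apply]
  rw [hsum, hYi.mgf_sum hYm]
  simp_rw [hY, mgf_indicator hX hA]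
  rw [Finset.prod_const, Finset.card_univ, Fintype.card_fin, Real.exp_nat_mul]
  refine pow_le_pow_left₀ ?_ ?_ n
  · have h1 : (covariateLaw μ p).real A ≤ 1 := by
      have := hX.isProbabilityMeasure
      exact measureReal_le_one
    have h0 : 0 ≤ (covariateLaw μ p).real A := measureReal_nonneg
    have := Real.exp_pos t
    nlinarith
  · linarith [Real.add_one_le_exp ((Real.exp t - 1) * (covariateLaw μ p).real A)]

omit [IsProbabilityMeasure P] in
theorem measurable_count (hX : IsIIDSample P μ p X) {A : Set 𝒳} (hA : MeasurableSet A) (n : ℕ) :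
    Measurable fun ω => (count (fun i : Fin n => X i ω) A : ℝ) := by
  classical
  have : (fun ω => (count (fun i : Fin n => X i ω) A : ℝ)) =
      fun ω => ∑ i : Fin n, A.indicator (fun _ => (1 : ℝ)) (X i ω) := by
    ext ω
    simp [count, Set.indicator_apply]
  rw [this]
  exact Finset.measurable_sum _ fun i _ =>
    (measurable_const.indicator hA).comp (hX.measurable i)

theorem integrable_exp_count (hX : IsIIDSample P μ p X) {A : Set 𝒳} (hA : MeasurableSet A) (n : ℕ)
    (t : ℝ) : Integrable (fun ω => Real.exp (t * (count (fun i : Fin n => X i ω) A : ℝ))) P := by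
  refine Integrable.of_bound
    ((measurable_count hX hA n).const_mul t).exp.aestronglyMeasurable (Real.exp (|t| * n)) ?_
  refine ae_of_all _ fun ω => ?_
  rw [Real.norm_eq_abs, abs_of_pos (Real.exp_pos _), Real.exp_le_exp]
  have h1 : (count (fun i : Fin n => X i ω) A : ℝ) ≤ n := by
    unfold count
    exact_mod_cast (Finset.card_le_univ _).trans (by simp)
  exact mul_le_mul (le_abs_self t) h1 (by positivity) (abs_nonneg _)

/-- Chernoff's bound at the fixed parameter t = -1, where exp(-1) - 1 ≤ -1/2. A constant factor
below the mean is all that is needed, so t is not optimised. -/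
theorem measure_count_le (hX : IsIIDSample P μ p X) {A : Set 𝒳} (hA : MeasurableSet A) (n : ℕ)
    {q : ℝ} (hq : ENNReal.ofReal q ≤ covariateLaw μ p A) (m : ℝ) :
    P {ω | (count (fun i : Fin n => X i ω) A : ℝ) ≤ m} ≤
      ENNReal.ofReal (Real.exp (m - n * q / 2)) := by
  have := hX.isProbabilityMeasure
  rw [← ENNReal.ofReal_toReal (measure_ne_top P _)]
  refine ENNReal.ofReal_le_ofReal ?_
  have h1 := measure_le_le_exp_mul_mgf (μ := P) (t := -1) m (by norm_num)
    (integrable_exp_count hX hA n (-1))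
  refine h1.trans ?_
  refine (mul_le_mul_of_nonneg_left (mgf_count_le hX hA n (-1)) (Real.exp_pos _).le).trans ?_
  rw [← Real.exp_add, Real.exp_le_exp]
  have hq' : q ≤ (covariateLaw μ p).real A := by
    rw [Measure.real]
    exact (ENNReal.ofReal_le_iff_le_toReal (measure_ne_top _ _)).1 hq
  have he : Real.exp (-1) ≤ 1 / 2 := by
    rw [Real.exp_neg, one_div]
    exact inv_anti₀ (by norm_num) (by linarith [Real.add_one_le_exp 1])
  have h0 : 0 ≤ (covariateLaw μ p).real A := measureReal_nonneg
  have hn : (0 : ℝ) ≤ n := by positivity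
  have : (n : ℝ) * ((Real.exp (-1) - 1) * (covariateLaw μ p).real A) ≤ n * (-(1 / 2) * q) :=
    mul_le_mul_of_nonneg_left (by nlinarith) hn
  linarith

/-- Chernoff's bound at t = 1, where e - 1 ≤ 2. -/
theorem measure_le_count (hX : IsIIDSample P μ p X) {A : Set 𝒳} (hA : MeasurableSet A) (n : ℕ)
    {q : ℝ} (hq0 : 0 ≤ q) (hq : covariateLaw μ p A ≤ ENNReal.ofReal q) (m : ℝ) :
    P {ω | m ≤ (count (fun i : Fin n => X i ω) A : ℝ)} ≤
      ENNReal.ofReal (Real.exp (2 * (n * q) - m)) := by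
  have := hX.isProbabilityMeasure
  rw [← ENNReal.ofReal_toReal (measure_ne_top P _)]
  refine ENNReal.ofReal_le_ofReal ?_
  have h1 := measure_ge_le_exp_mul_mgf (μ := P) (t := 1) m (by norm_num)
    (integrable_exp_count hX hA n 1)
  refine h1.trans ?_
  refine (mul_le_mul_of_nonneg_left (mgf_count_le hX hA n 1) (Real.exp_pos _).le).trans ?_
  rw [← Real.exp_add, Real.exp_le_exp]
  have hq' : (covariateLaw μ p).real A ≤ q := by
    rw [Measure.real]
    exact ENNReal.toReal_le_of_le_ofReal hq0 hq
  have he : Real.exp 1 - 1 ≤ 2 := by linarith [Real.exp_one_lt_d9]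
  have he' : 0 ≤ Real.exp 1 - 1 := by linarith [Real.add_one_le_exp 1]
  have h0 : 0 ≤ (covariateLaw μ p).real A := measureReal_nonneg
  have hn : (0 : ℝ) ≤ n := by positivity
  have : (n : ℝ) * ((Real.exp 1 - 1) * (covariateLaw μ p).real A) ≤ n * (2 * q) :=
    mul_le_mul_of_nonneg_left (by nlinarith) hn
  linarith

end Counts

/-! ### Sub-Gaussian noise -/

/-- Keeping the linear term exact lets it vanish in expectation for centred variables. -/
theorem exp_le_add_exp_sq (x : ℝ) : Real.exp x ≤ x + Real.exp (x ^ 2) := by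
  have h2 := Real.add_one_le_exp (x ^ 2)
  rcases le_or_gt |x| 1 with h | h
  · have := (abs_le.1 (Real.abs_exp_sub_one_sub_id_le h)).2
    linarith
  · rcases lt_abs.1 h with h | h
    · have : Real.exp x ≤ Real.exp (x ^ 2) := Real.exp_le_exp.2 (by nlinarith)
      linarith
    · have : Real.exp x ≤ 1 := Real.exp_le_one_iff.2 (by linarith)
      nlinarith

/-- Layer-cake formula: the variable exceeds t > 1 only if |Z| > 2σ·sqrt(log t), which has
probability at most C/t². The denominator 4σ² is what makes this power integrable. -/
theorem integrable_exp_sq_of_tail {Ω : Type*} [MeasurableSpace Ω] {P : Measure Ω}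
    [IsProbabilityMeasure P] {Z : Ω → ℝ} (hZ : Measurable Z) {C σ : ℝ} (hσ : 0 < σ)
    (htail : ∀ t : ℝ, 0 < t →
      P {ω | t < |Z ω|} ≤ ENNReal.ofReal (C * Real.exp (-t ^ 2 / (2 * σ ^ 2)))) :
    Integrable (fun ω => Real.exp (Z ω ^ 2 / (4 * σ ^ 2))) P := by
  have hm : Measurable fun ω => Real.exp (Z ω ^ 2 / (4 * σ ^ 2)) := by fun_prop
  refine ⟨hm.aestronglyMeasurable, ?_⟩
  rw [hasFiniteIntegral_iff_ofReal (ae_of_all _ fun ω => (Real.exp_pos _).le),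
    lintegral_eq_lintegral_meas_lt P (ae_of_all _ fun ω => (Real.exp_pos _).le) hm.aemeasurable,
    ← Set.Ioc_union_Ioi_eq_Ioi (zero_le_one' ℝ)]
  refine (lintegral_union_le _ _ _).trans_lt (ENNReal.add_lt_top.2 ⟨?_, ?_⟩)
  · calc _ ≤ ∫⁻ _t in Set.Ioc (0 : ℝ) 1, 1 := lintegral_mono fun t => prob_le_one
      _ < ⊤ := by simp
  · have hint : IntegrableOn (fun t : ℝ => C * t ^ (-2 : ℝ)) (Set.Ioi 1) :=
      (integrableOn_Ioi_rpow_of_lt (by norm_num) one_pos).const_mul C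
    refine lt_of_le_of_lt ?_ hint.lintegral_lt_top
    refine setLIntegral_mono' measurableSet_Ioi fun t ht => ?_
    have ht1 : (1 : ℝ) < t := ht
    have hlog : 0 < Real.log t := Real.log_pos ht1
    have h1 := htail (2 * σ * Real.sqrt (Real.log t)) (by positivity)
    refine (measure_mono ?_).trans (h1.trans (le_of_eq ?_))
    · intro ω hω
      simp only [Set.mem_ofPred_eq] at hω ⊢
      rw [← Real.log_lt_iff_lt_exp (by linarith), lt_div_iff₀ (by positivity)] at hω
      refine lt_of_pow_lt_pow_left₀ 2 (abs_nonneg _) ?_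
      rw [mul_pow, mul_pow, Real.sq_sqrt hlog.le, sq_abs]
      linarith
    · congr 2
      rw [mul_pow, mul_pow, Real.sq_sqrt hlog.le, Real.rpow_def_of_pos (by linarith)]
      congr 1
      field_simp

/-- With W = exp(Z²/(4σ²)) and s = 4σ²t², small and large t are treated apart. Centring matters only
for small t, where the moment generating function must be 1 + O(t²). -/
theorem exists_hasSubgaussianMGF_of_tail {Ω : Type*} [MeasurableSpace Ω] {P : Measure Ω}
    [IsProbabilityMeasure P] {Z : Ω → ℝ} (hZ : Measurable Z) (hmean : ∫ ω, Z ω ∂P = 0) {C σ : ℝ}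
    (hσ : 0 < σ) (htail : ∀ t : ℝ, 0 < t →
      P {ω | t < |Z ω|} ≤ ENNReal.ofReal (C * Real.exp (-t ^ 2 / (2 * σ ^ 2)))) :
    ∃ v : NNReal, 0 < v ∧ HasSubgaussianMGF Z v P := by
  set W : Ω → ℝ := fun ω => Real.exp (Z ω ^ 2 / (4 * σ ^ 2)) with hW
  have hWi : Integrable W P := integrable_exp_sq_of_tail hZ hσ htail
  set A : ℝ := ∫ ω, W ω ∂P with hA
  have hA0 : 0 ≤ A := integral_nonneg fun ω => (Real.exp_pos _).le
  have hle : ∀ t z : ℝ, t * z ≤ σ ^ 2 * t ^ 2 + z ^ 2 / (4 * σ ^ 2) := by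
    intro t z
    have h : σ ^ 2 * t ^ 2 + z ^ 2 / (4 * σ ^ 2) - t * z = (σ * t - z / (2 * σ)) ^ 2 := by
      field_simp; ring
    linarith [sq_nonneg (σ * t - z / (2 * σ))]
  have hle' : ∀ t ω, Real.exp (t * Z ω) ≤ Real.exp (σ ^ 2 * t ^ 2) * W ω := by
    intro t ω
    rw [hW, ← Real.exp_add, Real.exp_le_exp]
    exact hle t (Z ω)
  have hexp : ∀ t, Integrable (fun ω => Real.exp (t * Z ω)) P := by
    intro t
    refine (hWi.const_mul (Real.exp (σ ^ 2 * t ^ 2))).mono'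
      (hZ.const_mul t).exp.aestronglyMeasurable (ae_of_all _ fun ω => ?_)
    rw [Real.norm_eq_abs, abs_of_pos (Real.exp_pos _)]
    exact hle' t ω
  have hZi : Integrable Z P := by
    refine ((hexp 1).add (hexp (-1))).mono' hZ.aestronglyMeasurable (ae_of_all _ fun ω => ?_)
    simp only [Real.norm_eq_abs, Pi.add_apply, one_mul, neg_mul]
    have h1 := Real.add_one_le_exp (Z ω)
    have h2 := Real.add_one_le_exp (-Z ω)
    have h3 := Real.exp_pos (Z ω)
    have h4 := Real.exp_pos (-Z ω)
    exact abs_le.2 ⟨by linarith, by linarith⟩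
  refine ⟨(2 * (σ ^ 2 + 4 * σ ^ 2 * A)).toNNReal, Real.toNNReal_pos.2 (by positivity), hexp,
    fun t => ?_⟩
  have hgoal : ((2 * (σ ^ 2 + 4 * σ ^ 2 * A)).toNNReal : ℝ) * t ^ 2 / 2 =
      σ ^ 2 * t ^ 2 + 4 * σ ^ 2 * t ^ 2 * A := by
    rw [Real.coe_toNNReal _ (by positivity)]; ring
  rw [hgoal, mgf]
  set s : ℝ := 4 * σ ^ 2 * t ^ 2 with hs
  have hs0 : 0 ≤ s := by positivity
  rcases le_or_gt s 1 with h | h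
  -- Since exp((tZ)²) = W^s with s ≤ 1, Bernoulli's inequality makes it linear in W, and the term tZ
  -- has mean zero.
  · have hpt : ∀ ω, Real.exp (t * Z ω) ≤ t * Z ω + (1 + s * (W ω - 1)) := by
      intro ω
      refine (exp_le_add_exp_sq _).trans (add_le_add le_rfl ?_)
      have h1 : Real.exp ((t * Z ω) ^ 2) = (1 + (W ω - 1)) ^ s := by
        rw [hW, add_sub_cancel, ← Real.exp_mul]
        congr 1
        rw [hs]; field_simp
      rw [h1]
      refine rpow_one_add_le_one_add_mul_self ?_ hs0 h
      linarith [Real.exp_pos (Z ω ^ 2 / (4 * σ ^ 2))]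
    have hI' : Integrable (fun ω => s * (W ω - 1)) P := (hWi.sub (integrable_const 1)).const_mul s
    have hI : Integrable (fun ω => 1 + s * (W ω - 1)) P := (integrable_const 1).add hI'
    calc ∫ ω, Real.exp (t * Z ω) ∂P ≤ ∫ ω, (t * Z ω + (1 + s * (W ω - 1))) ∂P := by
          exact integral_mono (hexp t) ((hZi.const_mul t).add hI) hpt
      _ = 1 + s * (A - 1) := by
          rw [integral_add (hZi.const_mul t) hI, integral_const_mul, hmean,
            integral_add (integrable_const _) hI', integral_const_mul,
            integral_sub hWi (integrable_const _)]
          simp [hA]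
      _ ≤ σ ^ 2 * t ^ 2 + s * A + 1 := by nlinarith [sq_nonneg (σ * t)]
      _ ≤ _ := Real.add_one_le_exp _
  -- Young's inequality gives exp(tZ) ≤ exp(σ²t²)·W. The factor A = E W is at most exp(sA) because s
  -- > 1.
  · calc ∫ ω, Real.exp (t * Z ω) ∂P ≤ ∫ ω, Real.exp (σ ^ 2 * t ^ 2) * W ω ∂P :=
          integral_mono (hexp t) (hWi.const_mul _) (hle' t)
      _ = Real.exp (σ ^ 2 * t ^ 2) * A := integral_const_mul _ _
      _ ≤ Real.exp (σ ^ 2 * t ^ 2) * Real.exp (s * A) := by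
          gcongr
          nlinarith [Real.add_one_le_exp (s * A)]
      _ = _ := by rw [← Real.exp_add]

section Noise

variable {𝒳 Ω : Type*} [MeasurableSpace 𝒳] [MeasurableSpace Ω] {P : Measure Ω}
  [IsProbabilityMeasure P] {X : ℕ → Ω → 𝒳} {C σ : ℝ} {ε : ℕ → Ω → ℝ}

theorem IsSubGaussianNoise.exists_hasSubgaussianMGF (hε : IsSubGaussianNoise P X C σ ε) :
    ∃ v : NNReal, 0 < v ∧ ∀ i, HasSubgaussianMGF (ε i) v P := by
  obtain ⟨v, hv, h⟩ := exists_hasSubgaussianMGF_of_tail (hε.measurable 0) (hε.mean_zero 0)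
    hε.scale_pos (hε.tail 0)
  refine ⟨v, hv, fun i => ⟨fun t => ?_, fun t => ?_⟩⟩
  · have := (hε.identDistrib i).comp (u := fun x => Real.exp (t * x)) (by fun_prop)
    exact this.integrable_iff.2 (h.integrable_exp_mul t)
  · rw [mgf_congr_of_identDistrib _ _ (hε.identDistrib i)]
    exact h.mgf_le t

/-- Sums of the noise over a set of indices that depends on the covariates only. -/
theorem IsSubGaussianNoise.measure_sum_le (hε : IsSubGaussianNoise P X C σ ε) {v : NNReal}
    (hv : 0 < v) (hsub : ∀ i, HasSubgaussianMGF (ε i) v P) (hX : ∀ i, Measurable (X i)) {n : ℕ}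
    (A : (ℕ → 𝒳) → Finset (Fin n)) (hA : ∀ B, MeasurableSet {x | A x = B}) {u : ℝ} (hu : 0 ≤ u) :
    P {ω | Real.sqrt (2 * v * u * (A fun i => X i ω).card) <
      |∑ i ∈ A fun i => X i ω, ε i ω|} ≤ ENNReal.ofReal (2 * Real.exp (-u)) := by
  have hXm : Measurable fun ω i => X i ω := measurable_pi_iff.2 hX
  set T : Finset (Fin n) → Set (ℕ → ℝ) := fun B =>
    {e | Real.sqrt (2 * v * u * B.card) < |∑ i ∈ B, e i|} with hT
  have hTm : ∀ B, MeasurableSet (T B) := fun B => by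
    refine measurableSet_lt measurable_const ?_
    fun_prop
  have htail : ∀ B, P {ω | (fun i => ε i ω) ∈ T B} ≤ ENNReal.ofReal (2 * Real.exp (-u)) := by
    intro B
    -- For empty `B` both sides are 0, and the strict inequality makes the event empty.
    rcases B.eq_empty_or_nonempty with rfl | hB
    · simp [hT]
    have hcard : (0 : ℝ) < B.card := by exact_mod_cast hB.card_pos
    have hind : iIndepFun (fun i : Fin n => ε i) P := hε.indep.precomp Fin.val_injective
    have hind' : iIndepFun (fun i : Fin n => -ε i) P :=
      hind.comp (fun _ x => -x) (fun _ => measurable_neg)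
    have hr := Real.sqrt_nonneg (2 * v * u * B.card)
    have h1 := HasSubgaussianMGF.measure_sum_ge_le_of_iIndepFun hind (c := fun _ => v) (s := B)
      (fun i _ => hsub i) hr
    have h2 := HasSubgaussianMGF.measure_sum_ge_le_of_iIndepFun hind' (c := fun _ => v) (s := B)
      (fun i _ => (hsub i).neg) hr
    have hexp : Real.exp (-(Real.sqrt (2 * v * u * B.card)) ^ 2 / (2 * ∑ i ∈ B, v)) =
        Real.exp (-u) := by
      rw [Real.sq_sqrt (by positivity)]
      congr 1
      have : (v : ℝ) ≠ 0 := by exact_mod_cast hv.ne'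
      simp only [Finset.sum_const, nsmul_eq_mul, NNReal.coe_mul, NNReal.coe_natCast]
      field_simp
    rw [hexp] at h1 h2
    have hsubset : {ω | (fun i => ε i ω) ∈ T B} ⊆
        {ω | Real.sqrt (2 * v * u * B.card) ≤ ∑ i ∈ B, ε i ω} ∪
          {ω | Real.sqrt (2 * v * u * B.card) ≤ ∑ i ∈ B, (-ε i) ω} := by
      intro ω hω
      simp only [hT, Set.mem_ofPred_eq] at hω
      simp only [Pi.neg_apply, Finset.sum_neg_distrib]
      rcases lt_abs.1 hω with h | h
      · exact Or.inl h.le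
      · exact Or.inr h.le
    rw [← ENNReal.ofReal_toReal (measure_ne_top P _)]
    refine ENNReal.ofReal_le_ofReal ?_
    calc P.real {ω | (fun i => ε i ω) ∈ T B} ≤ _ := measureReal_mono hsubset
      _ ≤ _ := measureReal_union_le _ _
      _ ≤ _ := add_le_add h1 h2
      _ = _ := by ring
  have hsub : {ω | Real.sqrt (2 * v * u * (A fun i => X i ω).card) <
      |∑ i ∈ A fun i => X i ω, ε i ω|} ⊆
      ⋃ B ∈ (Finset.univ : Finset (Finset (Fin n))),
        ((fun ω i => ε i ω) ⁻¹' T B ∩ (fun ω i => X i ω) ⁻¹' {x | A x = B}) := by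
    intro ω hω
    simp only [Set.mem_iUnion]
    exact ⟨A fun i => X i ω, Finset.mem_univ _, hω, rfl⟩
  refine (measure_mono hsub).trans ((measure_biUnion_finset_le _ _).trans ?_)
  -- Conditioning on the covariates reduces to a finite sum over the possible index sets, by
  -- independence of noise and covariates.
  calc ∑ B, P ((fun ω i => ε i ω) ⁻¹' T B ∩ (fun ω i => X i ω) ⁻¹' {x | A x = B})
      = ∑ B, P ((fun ω i => ε i ω) ⁻¹' T B) * P ((fun ω i => X i ω) ⁻¹' {x | A x = B}) :=
        Finset.sum_congr rfl fun B _ =>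
          hε.indep_covariates.measure_inter_preimage_eq_mul _ _ (hTm B) (hA B)
    _ ≤ ∑ B, ENNReal.ofReal (2 * Real.exp (-u)) * P ((fun ω i => X i ω) ⁻¹' {x | A x = B}) :=
        Finset.sum_le_sum fun B _ => mul_le_mul_left (htail B) _
    _ = ENNReal.ofReal (2 * Real.exp (-u)) * ∑ B, P ((fun ω i => X i ω) ⁻¹' {x | A x = B}) :=
        (Finset.mul_sum _ _ _).symm
    _ = ENNReal.ofReal (2 * Real.exp (-u)) *
          P (⋃ B ∈ (Finset.univ : Finset (Finset (Fin n))),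
            (fun ω i => X i ω) ⁻¹' {x | A x = B}) := by
        rw [measure_biUnion_finset]
        · intro B _ B' _ hBB'
          refine Set.disjoint_left.2 fun ω h1 h2 => hBB' ?_
          exact h1.symm.trans h2
        · exact fun B _ => hXm (hA B)
    _ ≤ ENNReal.ofReal (2 * Real.exp (-u)) * 1 := by gcongr; exact prob_le_one
    _ = _ := mul_one _

end Noise

/-! ### Nearest neighbours and ball counts -/

section Nearest

variable {𝒳 ι : Type*} [MetricSpace 𝒳] {K : ℕ} {A : Finset ι} {pts : ι → 𝒳} {x : 𝒳} {S : Finset ι}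

/-- A neighbour outside the ball would force all K points of the ball into `S` as well, giving K + 1
elements. -/
theorem IsNearest.dist_le (hS : IsNearest K A pts x S) {R : ℝ}
    (hR : K ≤ (A.filter fun j => dist (pts j) x ≤ R).card) {i : ι} (hi : i ∈ S) :
    dist (pts i) x ≤ R := by
  classical
  obtain ⟨hSA, hcard, hnear⟩ := hS
  by_contra! hlt
  have hsub : insert i (A.filter fun j => dist (pts j) x ≤ R) ⊆ S := by
    intro j hj
    rcases Finset.mem_insert.1 hj with rfl | hj
    · exact hi
    · rw [Finset.mem_filter] at hj
      by_contra hjS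
      linarith [hnear i hi j hj.1 hjS, hj.2]
  have h1 := Finset.card_le_card hsub
  rw [Finset.card_insert_of_notMem (by simp [hlt])] at h1
  have := min_le_left K A.card
  omega

/-- If j were left out, all of `S` would be as close as j, so the ball would hold |S| + 1 ≤ K
points. Then |S| < K, which happens only when `S` is all of `A`. -/
theorem IsNearest.mem (hS : IsNearest K A pts x S) {ρ : ℝ}
    (hρ : (A.filter fun j => dist (pts j) x ≤ ρ).card ≤ K) {j : ι} (hj : j ∈ A)
    (hjx : dist (pts j) x ≤ ρ) : j ∈ S := by
  classical
  obtain ⟨hSA, hcard, hnear⟩ := hS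
  by_contra hjS
  have hsub : insert j S ⊆ A.filter fun j => dist (pts j) x ≤ ρ := by
    intro l hl
    rcases Finset.mem_insert.1 hl with rfl | hl
    · exact Finset.mem_filter.2 ⟨hj, hjx⟩
    · exact Finset.mem_filter.2 ⟨hSA hl, (hnear l hl j hj hjS).trans hjx⟩
  have h1 := Finset.card_le_card hsub
  rw [Finset.card_insert_of_notMem hjS] at h1
  have h2 : S = A := Finset.eq_of_subset_of_card_le hSA (by omega)
  exact hjS (h2 ▸ hj)

theorem count_closedBall {n : ℕ} (pts : Fin n → 𝒳) (x : 𝒳) (R : ℝ) :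
    count pts (Metric.closedBall x R) =
      (Finset.univ.filter fun j => dist (pts j) x ≤ R).card := by
  classical
  unfold count
  congr 1

omit [MetricSpace 𝒳] in
theorem count_mono {n : ℕ} (pts : Fin n → 𝒳) {A B : Set 𝒳} (h : A ⊆ B) :
    count pts A ≤ count pts B := by
  classical
  exact Finset.card_le_card (Finset.monotone_filter_right _ fun i _ hi => h hi)

end Nearest

/-! ### Grid cells -/

section Cells

variable {𝒳 : Type*} [MetricSpace 𝒳] {d : ℕ}

/-- The cell, in the grid with `N ^ d` cells, of the image of a point in the unit cube. -/
def cell (h : 𝒳 ≃ₜ unitCube d) (N : ℕ) (x : 𝒳) : Fin d → ℕ := fun k =>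
  -- The minimum puts the faces where a coordinate equals 1 into the last cells.
  min ⌊(N : ℝ) * (h x : EuclideanSpace ℝ (Fin d)) k⌋₊ (N - 1)

theorem cell_mem_box (h : 𝒳 ≃ₜ unitCube d) {N : ℕ} (hN : 0 < N) (x : 𝒳) :
    cell h N x ∈ box d N := by
  rw [mem_box]
  intro k
  unfold cell
  omega

theorem measurable_cell [MeasurableSpace 𝒳] [BorelSpace 𝒳] (h : 𝒳 ≃ₜ unitCube d) (N : ℕ) :
    Measurable (cell h N) := by
  refine measurable_pi_iff.2 fun k => ?_
  have h1 : Continuous fun x => (h x : EuclideanSpace ℝ (Fin d)) k := by fun_prop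
  exact (Nat.measurable_floor.comp (h1.measurable.const_mul (N : ℝ))).min measurable_const

theorem cell_bounds (h : 𝒳 ≃ₜ unitCube d) {N : ℕ} (hN : 0 < N) (x : 𝒳) (k : Fin d) :
    (cell h N x k : ℝ) ≤ N * (h x : EuclideanSpace ℝ (Fin d)) k ∧
      N * (h x : EuclideanSpace ℝ (Fin d)) k ≤ cell h N x k + 1 := by
  obtain ⟨h0, h1⟩ := (h x).2 k
  have hN' : (0 : ℝ) < N := by exact_mod_cast hN
  have hnn : 0 ≤ (N : ℝ) * (h x : EuclideanSpace ℝ (Fin d)) k := by positivity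
  constructor
  · refine le_trans ?_ (Nat.floor_le hnn)
    exact_mod_cast min_le_left _ _
  · unfold cell
    rcases min_choice ⌊(N : ℝ) * (h x : EuclideanSpace ℝ (Fin d)) k⌋₊ (N - 1) with e | e
    · rw [e]; exact (Nat.lt_floor_add_one _).le
    · rw [e, Nat.cast_sub hN]
      push_cast
      nlinarith

/-- The hypothesis allows equal and adjacent cells, diagonals included; each coordinate then differs
by at most 2/N. -/
theorem dist_le_of_cell (h : 𝒳 ≃ₜ unitCube d) {Lmin : ℝ} (hL : 0 < Lmin)
    (hdist : ∀ x x' : 𝒳, Lmin * dist x x' ≤ dist (h x) (h x')) {N : ℕ} (hN : 0 < N) {x x' : 𝒳}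
    (hc : ∀ k, cell h N x k ≤ cell h N x' k + 1 ∧ cell h N x' k ≤ cell h N x k + 1) :
    dist x x' ≤ 2 * Real.sqrt d / (N * Lmin) := by
  have hN' : (0 : ℝ) < N := by exact_mod_cast hN
  have h1 : dist (h x) (h x') ≤ 2 * Real.sqrt d / N := by
    rw [Subtype.dist_eq, EuclideanSpace.dist_eq]
    have : ∀ k, dist ((h x : EuclideanSpace ℝ (Fin d)) k) ((h x' : EuclideanSpace ℝ (Fin d)) k) ^ 2
        ≤ (2 / N) ^ 2 := by
      intro k
      obtain ⟨a1, a2⟩ := cell_bounds h hN x k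
      obtain ⟨b1, b2⟩ := cell_bounds h hN x' k
      have c1 : (cell h N x k : ℝ) ≤ cell h N x' k + 1 := by exact_mod_cast (hc k).1
      have c2 : (cell h N x' k : ℝ) ≤ cell h N x k + 1 := by exact_mod_cast (hc k).2
      refine pow_le_pow_left₀ dist_nonneg ?_ 2
      rw [Real.dist_eq, abs_le]
      constructor
      · rw [neg_le, le_div_iff₀ hN']; linarith
      · rw [le_div_iff₀ hN']; linarith
    calc _ ≤ Real.sqrt (∑ _k : Fin d, (2 / (N : ℝ)) ^ 2) :=
          Real.sqrt_le_sqrt (Finset.sum_le_sum fun k _ => this k)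
      _ = _ := by
          rw [Finset.sum_const, Finset.card_univ, Fintype.card_fin, nsmul_eq_mul,
            Real.sqrt_mul (by positivity), Real.sqrt_sq (by positivity)]
          ring
  have h2 := (hdist x x').trans h1
  rw [le_div_iff₀ hN'] at h2
  rw [le_div_iff₀ (by positivity)]
  linarith

/-- Take the preimage of the midpoint of the cell. A perturbation of a quarter of the side length
does not change the floors. -/
theorem exists_center (h : 𝒳 ≃ₜ unitCube d) {Lmax : ℝ}
    (hdist : ∀ x x' : 𝒳, dist (h x) (h x') ≤ Lmax * dist x x') {N : ℕ} (hN : 0 < N)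
    {y : Fin d → ℕ} (hy : y ∈ box d N) :
    ∃ x : 𝒳, ∀ x', Lmax * dist x' x ≤ 1 / (4 * N) → cell h N x' = y := by
  have hN' : (0 : ℝ) < N := by exact_mod_cast hN
  have hyN : ∀ k, (y k : ℝ) + 1 ≤ N := fun k => by exact_mod_cast mem_box.1 hy k
  set z : EuclideanSpace ℝ (Fin d) := WithLp.toLp 2 fun k => ((y k : ℝ) + 1 / 2) / N with hz
  have hzc : z ∈ unitCube d := fun k => by
    have := hyN k
    refine ⟨by simp only [hz]; positivity, ?_⟩
    simp only [hz]
    rw [div_le_one hN']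
    linarith
  refine ⟨h.symm ⟨z, hzc⟩, fun x' hx' => ?_⟩
  have h1 : dist (h x' : EuclideanSpace ℝ (Fin d)) z ≤ 1 / (4 * N) := by
    have := hdist x' (h.symm ⟨z, hzc⟩)
    rw [Homeomorph.apply_symm_apply, Subtype.dist_eq] at this
    exact this.trans hx'
  ext k
  have h2 : |(h x' : EuclideanSpace ℝ (Fin d)) k - z k| ≤ 1 / (4 * N) := by
    rw [dist_eq_norm] at h1
    exact (PiLp.norm_apply_le ((h x' : EuclideanSpace ℝ (Fin d)) - z) k).trans h1
  have h3 : |N * (h x' : EuclideanSpace ℝ (Fin d)) k - ((y k : ℝ) + 1 / 2)| ≤ 1 / 4 := by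
    have e : N * (h x' : EuclideanSpace ℝ (Fin d)) k - ((y k : ℝ) + 1 / 2) =
        N * ((h x' : EuclideanSpace ℝ (Fin d)) k - z k) := by
      simp only [hz]; field_simp
    rw [e, abs_mul, abs_of_pos hN']
    calc _ ≤ (N : ℝ) * (1 / (4 * N)) := by gcongr
      _ = _ := by field_simp
  obtain ⟨h4, h5⟩ := abs_le.1 h3
  have h6 : ⌊(N : ℝ) * (h x' : EuclideanSpace ℝ (Fin d)) k⌋₊ = y k := by
    rw [Nat.floor_eq_iff (by have : (0 : ℝ) ≤ y k := by positivity
                             linarith)]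
    constructor <;> linarith
  have := mem_box.1 hy k
  unfold cell
  rw [h6]
  omega

end Cells

/-! ### The law of the covariates on balls -/

section Law

variable {𝒳 : Type*} [MeasurableSpace 𝒳] {μ : Measure 𝒳} {p : 𝒳 → ℝ}

theorem covariateLaw_le {pmax : ℝ} (hp : ∀ x, p x ≤ pmax) {A : Set 𝒳} (hA : MeasurableSet A) :
    covariateLaw μ p A ≤ ENNReal.ofReal pmax * μ A := by
  rw [covariateLaw, withDensity_apply _ hA, ← setLIntegral_const]
  exact lintegral_mono fun x => ENNReal.ofReal_le_ofReal (hp x)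

theorem le_covariateLaw {pmin : ℝ} (hp : ∀ x, pmin ≤ p x) {A : Set 𝒳} (hA : MeasurableSet A) :
    ENNReal.ofReal pmin * μ A ≤ covariateLaw μ p A := by
  rw [covariateLaw, withDensity_apply _ hA, ← setLIntegral_const]
  exact lintegral_mono fun x => ENNReal.ofReal_le_ofReal (hp x)

/-- Ball masses comparable with `r ^ d`: from below for small radii, from above for all. -/
def BallMass [MetricSpace 𝒳] (ν : Measure 𝒳) (d : ℕ) (r₀ a₁ a₂ : ℝ) : Prop :=
  0 < r₀ ∧ 0 < a₁ ∧ 0 < a₂ ∧ ∀ (x : 𝒳) (r : ℝ), 0 < r →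
    (r < r₀ → ENNReal.ofReal (a₁ * r ^ d) ≤ ν (Metric.closedBall x r)) ∧
      ν (Metric.closedBall x r) ≤ ENNReal.ofReal (a₂ * r ^ d)

theorem exists_ballMass [MetricSpace 𝒳] [BorelSpace 𝒳] {d : ℕ} (hp : BoundedDensity p)
    (hμ : VolumeGrowth μ d) [IsProbabilityMeasure (covariateLaw μ p)] :
    ∃ r₀ a₁ a₂ : ℝ, BallMass (covariateLaw μ p) d r₀ a₁ a₂ := by
  obtain ⟨-, pmin, pmax, hpmin, hpb⟩ := hp
  obtain ⟨r₀, c₁, c₂, hr₀, hc₁, hc₂, hball⟩ := hμ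
  have hne : Nonempty 𝒳 := nonempty_of_isProbabilityMeasure (covariateLaw μ p)
  have hpmax : 0 < pmax := by
    obtain ⟨x⟩ := hne
    linarith [(hpb x).1, (hpb x).2]
  refine ⟨r₀, pmin * c₁, max (pmax * c₂) (1 / r₀ ^ d), hr₀, by positivity,
    lt_max_of_lt_left (by positivity), fun x r hr => ⟨fun hrr => ?_, ?_⟩⟩
  · refine le_trans ?_ (le_covariateLaw (fun x => (hpb x).1.le) Metric.isClosed_closedBall.measurableSet)
    rw [mul_assoc, ENNReal.ofReal_mul hpmin.le, mul_comm c₁]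
    gcongr
    exact (hball x r hr hrr).1
  · rcases lt_or_ge r r₀ with hrr | hrr
    · refine (covariateLaw_le (fun x => (hpb x).2.le)
        Metric.isClosed_closedBall.measurableSet).trans ?_
      calc _ ≤ ENNReal.ofReal pmax * ENNReal.ofReal (c₂ * r ^ d) := by
            gcongr; exact (hball x r hr hrr).2
        _ = ENNReal.ofReal (pmax * c₂ * r ^ d) := by
            rw [← ENNReal.ofReal_mul hpmax.le, mul_assoc]
        _ ≤ _ := by
            refine ENNReal.ofReal_le_ofReal ?_
            gcongr
            exact le_max_left _ _
    -- Beyond r₀ the trivial bound 1 ≤ (r/r₀)^d replaces volume growth.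
    · refine prob_le_one.trans ?_
      rw [← ENNReal.ofReal_one]
      refine ENNReal.ofReal_le_ofReal ?_
      calc (1 : ℝ) = 1 / r₀ ^ d * r₀ ^ d := by field_simp
        _ ≤ _ := by
            gcongr
            exact le_max_right _ _

end Law

/-! ### Uniform counts on a grid -/

section Grid

variable {𝒳 Ω : Type*} [MetricSpace 𝒳] [MeasurableSpace 𝒳] [BorelSpace 𝒳] [MeasurableSpace Ω]
  {P : Measure Ω} [IsProbabilityMeasure P] {μ : Measure 𝒳} {p : 𝒳 → ℝ} {X : ℕ → Ω → 𝒳} {d : ℕ}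
  {r₀ a₁ a₂ : ℝ} {h : 𝒳 ≃ₜ unitCube d} {Lmin Lmax : ℝ}

theorem measurableSet_cell_eq (h : 𝒳 ≃ₜ unitCube d) (N : ℕ) (y : Fin d → ℕ) :
    MeasurableSet {x | cell h N x = y} :=
  measurable_cell h N (measurableSet_singleton y)

/-- Every cell contains a ball of radius 1/(4·N·Lmax), which bounds its mass from below; then a
union bound over the N^d cells. -/
theorem measure_exists_count_cell_le (hX : IsIIDSample P μ p X)
    (hB : BallMass (covariateLaw μ p) d r₀ a₁ a₂) (hLmax : 0 < Lmax)
    (hdist : ∀ x x' : 𝒳, dist (h x) (h x') ≤ Lmax * dist x x') {N : ℕ} (hN : 0 < N)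
    (hNr : 1 / (4 * N * Lmax) < r₀) (n : ℕ) (m : ℝ) :
    P {ω | ∃ y ∈ box d N, (count (fun i : Fin n => X i ω) {x | cell h N x = y} : ℝ) ≤ m} ≤
      ENNReal.ofReal ((N : ℝ) ^ d *
        Real.exp (m - n * (a₁ / (4 * Lmax) ^ d / (N : ℝ) ^ d) / 2)) := by
  have hN' : (0 : ℝ) < N := by exact_mod_cast hN
  have hset : {ω | ∃ y ∈ box d N, (count (fun i : Fin n => X i ω) {x | cell h N x = y} : ℝ) ≤ m} =
      ⋃ y ∈ box d N, {ω | (count (fun i : Fin n => X i ω) {x | cell h N x = y} : ℝ) ≤ m} := by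
    ext ω; simp
  have hmass : ∀ y ∈ box d N, ENNReal.ofReal (a₁ / (4 * Lmax) ^ d / (N : ℝ) ^ d) ≤
      covariateLaw μ p {x | cell h N x = y} := by
    intro y hy
    obtain ⟨c, hc⟩ := exists_center h hdist hN hy
    have h1 := (hB.2.2.2 c (1 / (4 * N * Lmax)) (by positivity)).1 hNr
    have h2 : a₁ * (1 / (4 * N * Lmax)) ^ d = a₁ / (4 * Lmax) ^ d / (N : ℝ) ^ d := by
      rw [div_pow, one_pow, div_div, ← mul_pow]
      ring
    rw [h2] at h1
    refine h1.trans (measure_mono fun x hx => hc x ?_)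
    rw [Metric.mem_closedBall] at hx
    calc Lmax * dist x c ≤ Lmax * (1 / (4 * N * Lmax)) := by gcongr
      _ = _ := by field_simp
  rw [hset]
  refine (measure_biUnion_finset_le _ _).trans ?_
  calc _ ≤ ∑ _y ∈ box d N, ENNReal.ofReal
        (Real.exp (m - n * (a₁ / (4 * Lmax) ^ d / (N : ℝ) ^ d) / 2)) :=
        Finset.sum_le_sum fun y hy =>
          measure_count_le hX (measurableSet_cell_eq h N y) n (hmass y hy) m
    _ = _ := by
        rw [Finset.sum_const, card_box, nsmul_eq_mul, ENNReal.ofReal_mul (by positivity)]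
        congr 1
        rw [← Nat.cast_pow, ENNReal.ofReal_natCast]

theorem measure_exists_le_count_ball (hX : IsIIDSample P μ p X)
    (hB : BallMass (covariateLaw μ p) d r₀ a₁ a₂) {N : ℕ} (ctr : (Fin d → ℕ) → 𝒳) {r : ℝ}
    (hr : 0 < r) (n : ℕ) (m : ℝ) :
    P {ω | ∃ y ∈ box d N, m ≤ (count (fun i : Fin n => X i ω) (Metric.closedBall (ctr y) r) : ℝ)} ≤
      ENNReal.ofReal ((N : ℝ) ^ d * Real.exp (2 * (n * (a₂ * r ^ d)) - m)) := by
  have ha₂ := hB.2.2.1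
  have hset : {ω | ∃ y ∈ box d N,
      m ≤ (count (fun i : Fin n => X i ω) (Metric.closedBall (ctr y) r) : ℝ)} =
      ⋃ y ∈ box d N,
        {ω | m ≤ (count (fun i : Fin n => X i ω) (Metric.closedBall (ctr y) r) : ℝ)} := by
    ext ω; simp
  rw [hset]
  refine (measure_biUnion_finset_le _ _).trans ?_
  calc _ ≤ ∑ _y ∈ box d N, ENNReal.ofReal (Real.exp (2 * (n * (a₂ * r ^ d)) - m)) :=
        Finset.sum_le_sum fun y _ =>
          measure_le_count hX Metric.isClosed_closedBall.measurableSet n (by positivity)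
            (hB.2.2.2 (ctr y) r hr).2 m
    _ = _ := by
        rw [Finset.sum_const, card_box, nsmul_eq_mul, ENNReal.ofReal_mul (by positivity)]
        congr 1
        rw [← Nat.cast_pow, ENNReal.ofReal_natCast]

/-- With high probability every ball of radius of the order `(K / n) ^ (1 / d)` has more than `K`
sample points. -/
theorem exists_radius_count (hd : 1 ≤ d) (hX : IsIIDSample P μ p X)
    (hB : BallMass (covariateLaw μ p) d r₀ a₁ a₂) (hLmin : 0 < Lmin) (hLmax : 0 < Lmax)
    (hdist : ∀ x x' : 𝒳, Lmin * dist x x' ≤ dist (h x) (h x') ∧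
      dist (h x) (h x') ≤ Lmax * dist x x') :
    ∃ CR t₀ C₀ : ℝ, 0 < CR ∧ 0 < t₀ ∧ 0 < C₀ ∧ ∀ n K : ℕ, 1 ≤ K → (K : ℝ) ≤ t₀ * n →
      P {ω | ∃ x, count (fun i : Fin n => X i ω)
        (Metric.closedBall x (CR * ((K : ℝ) / n) ^ (1 / (d : ℝ)))) ≤ K} ≤
          ENNReal.ofReal (C₀ * n * Real.exp (-K)) := by
  have hd0 : (d : ℝ) ≠ 0 := by positivity
  obtain ⟨hr₀, ha₁, ha₂, hball⟩ := hB
  set b₁ : ℝ := a₁ / (4 * Lmax) ^ d with hb₁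
  have hb₁0 : 0 < b₁ := by positivity
  -- The threshold t₀ is chosen so that q ≤ w below. This gives N ≥ 1 and keeps the balls inside the
  -- cells below the radius r₀.
  set q : ℝ := 1 + 1 / (Lmax * r₀) with hq
  have hq1 : 1 ≤ q := by
    have : 0 < 1 / (Lmax * r₀) := by positivity
    linarith
  refine ⟨4 * Real.sqrt d / Lmin * (4 / b₁) ^ (1 / (d : ℝ)), b₁ / (4 * q ^ d), b₁,
    by positivity, by positivity, hb₁0, fun n K hK hKn => ?_⟩
  have hK' : (1 : ℝ) ≤ K := by exact_mod_cast hK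
  have hn : (0 : ℝ) < n := by
    by_contra hn
    have : (n : ℝ) = 0 := le_antisymm (not_lt.1 hn) (by positivity)
    rw [this] at hKn
    linarith
  -- With N = ⌊w⌋ a cell has at least 4K expected points, so the Chernoff exponent is at most K - 2K
  -- = -K.
  set w : ℝ := (b₁ * n / (4 * K)) ^ (1 / (d : ℝ)) with hw
  have hwd : w ^ d = b₁ * n / (4 * K) := by
    rw [hw, one_div, Real.rpow_inv_natCast_pow (by positivity) (by omega)]
  have hqw : q ≤ w := by
    refine le_of_pow_le_pow_left₀ (n := d) (by omega) (by positivity) ?_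
    rw [hwd, le_div_iff₀ (by positivity)]
    rw [div_mul_eq_mul_div, le_div_iff₀ (by positivity)] at hKn
    linarith
  have hw0 : 0 < w := by linarith
  set N : ℕ := ⌊w⌋₊ with hNdef
  have hN : 0 < N := Nat.floor_pos.2 (hq1.trans hqw)
  have hN' : (0 : ℝ) < N := by exact_mod_cast hN
  have hNw : (N : ℝ) ≤ w := Nat.floor_le hw0.le
  have hwN : w ≤ 2 * N := by
    have h1 := Nat.lt_floor_add_one w
    have h2 : (1 : ℝ) ≤ N := by exact_mod_cast hN
    linarith
  have hNr : 1 / (4 * N * Lmax) < r₀ := by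
    rw [div_lt_iff₀ (by positivity)]
    have h1 : 1 / (Lmax * r₀) < 2 * N := by linarith
    rw [div_lt_iff₀ (by positivity)] at h1
    have : 0 < r₀ * N * Lmax := by positivity
    nlinarith
  refine (measure_mono ?_).trans ((measure_exists_count_cell_le hX ⟨hr₀, ha₁, ha₂, hball⟩ hLmax
    (fun x x' => (hdist x x').2) hN hNr n K).trans (ENNReal.ofReal_le_ofReal ?_))
  -- The ball about x contains the whole cell of x. So a deficient ball anywhere gives a deficient
  -- cell, and finitely many events suffice.
  · rintro ω ⟨x, hx⟩
    refine ⟨cell h N x, cell_mem_box h hN x, ?_⟩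
    norm_cast
    refine le_trans (count_mono _ fun x' hx' => ?_) hx
    rw [Metric.mem_closedBall]
    have hx'' : cell h N x' = cell h N x := hx'
    refine (dist_le_of_cell h hLmin (fun x x' => (hdist x x').1) hN
      (fun k => by rw [hx'']; omega)).trans ?_
    have h1 : w * ((4 / b₁) ^ (1 / (d : ℝ)) * ((K : ℝ) / n) ^ (1 / (d : ℝ))) = 1 := by
      rw [← Real.mul_rpow (by positivity) (by positivity), hw,
        ← Real.mul_rpow (by positivity) (by positivity)]
      have : b₁ * n / (4 * K) * (4 / b₁ * (K / n)) = 1 := by field_simp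
      rw [this, Real.one_rpow]
    set v := (4 / b₁) ^ (1 / (d : ℝ)) * ((K : ℝ) / n) ^ (1 / (d : ℝ)) with hv
    have hv0 : 0 ≤ v := by positivity
    have h2 : 4 * Real.sqrt d / Lmin * (4 / b₁) ^ (1 / (d : ℝ)) * ((K : ℝ) / n) ^ (1 / (d : ℝ)) =
        4 * Real.sqrt d / Lmin * v := by rw [hv]; ring
    rw [h2, div_mul_eq_mul_div, div_le_div_iff₀ (by positivity) hLmin]
    have h3 : 1 ≤ 2 * N * v := by rw [← h1]; gcongr
    have h4 : 0 ≤ 2 * Real.sqrt d * Lmin := by positivity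
    nlinarith
  · have h1 : (N : ℝ) ^ d ≤ b₁ * n / (4 * K) := hwd ▸ pow_le_pow_left₀ hN'.le hNw d
    have h2 : 2 * (K : ℝ) ≤ n * (b₁ / (N : ℝ) ^ d) / 2 := by
      rw [le_div_iff₀ (by positivity)] at h1
      rw [le_div_iff₀ (by norm_num), mul_div_assoc', le_div_iff₀ (by positivity)]
      linarith
    have h3 : b₁ * n / (4 * K) ≤ b₁ * n := by
      rw [div_le_iff₀ (by positivity)]
      have : 0 < b₁ * n := by positivity
      nlinarith
    calc _ ≤ (b₁ * n) * Real.exp (-K) := by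
          refine mul_le_mul (h1.trans h3) (Real.exp_le_exp.2 (by linarith)) (by positivity)
            (by positivity)
      _ = _ := by ring

/-- A dyadic grid whose cells have of the order of `K` points each, while the balls that contain
the neighbouring cells have at most `K` points. -/
theorem exists_dyadic_grid (hd : 1 ≤ d) (hX : IsIIDSample P μ p X)
    (hB : BallMass (covariateLaw μ p) d r₀ a₁ a₂) (hLmin : 0 < Lmin) (hLmax : 0 < Lmax)
    (hdist : ∀ x x' : 𝒳, Lmin * dist x x' ≤ dist (h x) (h x') ∧
      dist (h x) (h x') ≤ Lmax * dist x x') :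
    ∃ κ t₀ K₀ c₃ : ℝ, 0 < κ ∧ 0 < t₀ ∧ 0 < c₃ ∧
      ∀ n K : ℕ, 1 ≤ K → K₀ ≤ K → (K : ℝ) ≤ t₀ * n → ∃ J : ℕ,
        ((2 : ℝ) ^ J) ^ d ≤ n ∧ c₃ * n ≤ ((2 : ℝ) ^ J) ^ d * (κ * K) ∧
        P {ω | ∃ y ∈ box d (2 ^ J),
          (count (fun i : Fin n => X i ω) {x | cell h (2 ^ J) x = y} : ℝ) ≤ κ * K} ≤
            ENNReal.ofReal (n * Real.exp (-(κ * K))) ∧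
        P {ω | ∃ i : Fin n, K + 1 ≤ count (fun i : Fin n => X i ω)
          (Metric.closedBall (X i ω) (2 * Real.sqrt d / ((2 ^ J : ℕ) * Lmin)))} ≤
            ENNReal.ofReal (n * Real.exp (-(K / 2))) := by
  have hd0 : (d : ℝ) ≠ 0 := by positivity
  have hBall := hB
  obtain ⟨hr₀, ha₁, ha₂, hball⟩ := hB
  set b₁ : ℝ := a₁ / (4 * Lmax) ^ d with hb₁
  have hb₁0 : 0 < b₁ := by positivity
  set b₂ : ℝ := a₂ * (4 * Real.sqrt d / Lmin) ^ d with hb₂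
  have hsd : 0 < Real.sqrt d := Real.sqrt_pos.2 (by positivity)
  have hb₂0 : 0 < b₂ := by positivity
  set q : ℝ := 1 + 1 / (Lmax * r₀) with hq
  have hq1 : 1 ≤ q := by
    have : 0 < 1 / (Lmax * r₀) := by positivity
    linarith
  -- Chosen so that a cell has at least 4κK expected points on the grid below, which is at most
  -- twice as fine as w demands.
  set κ : ℝ := b₁ / (4 * 2 ^ d * (4 * b₂)) with hκ
  have hκ0 : 0 < κ := by positivity
  refine ⟨κ, 4 * b₂ / q ^ d, 2 ^ d * (4 * b₂), 4 * b₂ * κ, hκ0, by positivity, by positivity,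
    fun n K hK hKK hKn => ?_⟩
  have hK' : (1 : ℝ) ≤ K := by exact_mod_cast hK
  have hn : (0 : ℝ) < n := by
    by_contra hn
    have : (n : ℝ) = 0 := le_antisymm (not_lt.1 hn) (by positivity)
    rw [this] at hKn
    linarith
  -- A grid at least this fine makes the expected count of a ball of radius 2ρ at most K/4, with ρ
  -- the bound on distances between points of adjacent cells.
  set w : ℝ := (4 * b₂ * n / K) ^ (1 / (d : ℝ)) with hw
  have hwd : w ^ d = 4 * b₂ * n / K := by
    rw [hw, one_div, Real.rpow_inv_natCast_pow (by positivity) (by omega)]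
  have hqw : q ≤ w := by
    refine le_of_pow_le_pow_left₀ (n := d) (by omega) (by positivity) ?_
    rw [hwd, le_div_iff₀ (by positivity)]
    rw [div_mul_eq_mul_div, le_div_iff₀ (by positivity)] at hKn
    linarith
  have hw0 : 0 < w := by linarith
  obtain ⟨k, hk1, hk2⟩ := exists_nat_pow_near (hq1.trans hqw) (one_lt_two : (1 : ℝ) < 2)
  set J := k + 1 with hJ
  have hNw : w ≤ (2 : ℝ) ^ J := hk2.le
  have hNw' : (2 : ℝ) ^ J ≤ 2 * w := by rw [hJ, pow_succ]; linarith
  have hN : 0 < 2 ^ J := by positivity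
  have hNcast : ((2 ^ J : ℕ) : ℝ) = (2 : ℝ) ^ J := by push_cast; rfl
  set M : ℝ := (2 : ℝ) ^ J with hM
  have hM0 : 0 < M := by positivity
  have hMlow : 4 * b₂ * n / K ≤ M ^ d := hwd ▸ pow_le_pow_left₀ hw0.le hNw d
  have hMup : M ^ d ≤ 2 ^ d * (4 * b₂ * n / K) := by
    rw [← hwd, ← mul_pow]; exact pow_le_pow_left₀ hM0.le hNw' d
  have hMd : 0 < M ^ d := by positivity
  have hMn : M ^ d ≤ n := by
    refine hMup.trans ?_
    rw [mul_div_assoc', div_le_iff₀ (by positivity)]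
    nlinarith
  have hNr : 1 / (4 * ((2 ^ J : ℕ) : ℝ) * Lmax) < r₀ := by
    rw [hNcast, div_lt_iff₀ (by positivity)]
    have h1 : 1 / (Lmax * r₀) < M := by linarith
    rw [div_lt_iff₀ (by positivity)] at h1
    have : 0 < r₀ * M * Lmax := by positivity
    nlinarith
  rw [div_le_iff₀ (by positivity)] at hMlow
  refine ⟨J, hMn, by nlinarith, ?_, ?_⟩
  · refine (measure_exists_count_cell_le hX hBall hLmax
      (fun x x' => (hdist x x').2) hN hNr n (κ * K)).trans (ENNReal.ofReal_le_ofReal ?_)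
    rw [hNcast]
    refine mul_le_mul hMn (Real.exp_le_exp.2 ?_) (by positivity) (by positivity)
    have h2 : 2 * (κ * K) ≤ n * (b₁ / M ^ d) / 2 := by
      rw [mul_div_assoc', le_div_iff₀ (by positivity)] at hMup
      rw [le_div_iff₀ (by norm_num), mul_div_assoc', le_div_iff₀ (by positivity), hκ]
      have : 2 * (b₁ / (4 * 2 ^ d * (4 * b₂)) * K) * 2 * M ^ d =
        b₁ / (2 ^ d * (4 * b₂)) * (M ^ d * K) := by field_simp; norm_num
      rw [this]
      calc _ ≤ b₁ / (2 ^ d * (4 * b₂)) * (2 ^ d * (4 * b₂ * n)) := by gcongr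
        _ = _ := by field_simp
    linarith
  -- Balls about the random points X i are enclosed in balls of twice the radius about one fixed
  -- point per cell, which permits a union bound. Outside the box the chosen point is irrelevant.
  · have hctr : ∀ y : Fin d → ℕ, ∃ x : 𝒳, y ∈ box d (2 ^ J) → cell h (2 ^ J) x = y := by
      intro y
      by_cases hy : y ∈ box d (2 ^ J)
      · obtain ⟨x, hx⟩ := exists_center h (fun x x' => (hdist x x').2) hN hy
        exact ⟨x, fun _ => hx x (by rw [dist_self]; simp)⟩
      · exact ⟨h.symm ⟨0, fun k => by simp⟩, fun hy' => absurd hy' hy⟩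
    choose ctr hctr using hctr
    set ρ : ℝ := 2 * Real.sqrt d / ((2 ^ J : ℕ) * Lmin) with hρ
    have hρ0 : 0 < ρ := by positivity
    refine (measure_mono ?_).trans ((measure_exists_le_count_ball hX hBall (N := 2 ^ J) ctr
      (r := 2 * ρ) (by positivity) n (K + 1)).trans (ENNReal.ofReal_le_ofReal ?_))
    · rintro ω ⟨i, hi⟩
      refine ⟨cell h (2 ^ J) (X i ω), cell_mem_box h hN _, ?_⟩
      have h1 : K + 1 ≤ count (fun i : Fin n => X i ω)
          (Metric.closedBall (ctr (cell h (2 ^ J) (X i ω))) (2 * ρ)) := by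
        refine hi.trans (count_mono _ (Metric.closedBall_subset_closedBall' ?_))
        have : dist (X i ω) (ctr (cell h (2 ^ J) (X i ω))) ≤ ρ := by
          refine dist_le_of_cell h hLmin (fun x x' => (hdist x x').1) hN fun k => ?_
          rw [hctr _ (cell_mem_box h hN (X i ω))]
          omega
        linarith
      exact_mod_cast h1
    · rw [hNcast]
      refine mul_le_mul hMn (Real.exp_le_exp.2 ?_) (by positivity) (by positivity)
      have h1 : a₂ * (2 * ρ) ^ d = b₂ / M ^ d := by
        rw [hb₂, hρ, hNcast, mul_div_assoc a₂, ← div_pow]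
        congr 2
        field_simp
        norm_num
      rw [h1]
      have h2 : n * (b₂ / M ^ d) ≤ K / 4 := by
        rw [mul_div_assoc', div_le_div_iff₀ (by positivity) (by norm_num)]
        linarith
      linarith

end Grid

/-! ### Local behaviour of piecewise Lipschitz functions -/

theorem convex_unitCube (d : ℕ) : Convex ℝ (unitCube d) := by
  intro x hx y hy a b ha hb hab i
  obtain ⟨hx0, hx1⟩ := hx i
  obtain ⟨hy0, hy1⟩ := hy i
  simp only [PiLp.add_apply, PiLp.smul_apply, smul_eq_mul]
  constructor
  · positivity
  · nlinarith

/-- Off a set of measure `O(R)` the function varies by at most `L R` on the ball of radius `R`, and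
the function is bounded almost everywhere. -/
structure LocallyClose {𝒳 : Type*} [MetricSpace 𝒳] [MeasurableSpace 𝒳] (μ ν : Measure 𝒳)
    (f₀ : 𝒳 → ℝ) (B C L : ℝ) : Prop where
  bound_nonneg : 0 ≤ B
  const_nonneg : 0 ≤ C
  lip_nonneg : 0 ≤ L
  bdd : ∀ᵐ x ∂μ, |f₀ x| ≤ B
  close : ∀ R : ℝ, 0 < R → ∃ A, MeasurableSet A ∧ ν A ≤ ENNReal.ofReal (C * R) ∧
    ∀ x ∉ A, ∀ x', dist x x' ≤ R → |f₀ x - f₀ x'| ≤ L * R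

section Local

variable {𝒳 : Type*} [MetricSpace 𝒳] [MeasurableSpace 𝒳] {μ : Measure 𝒳} {p : 𝒳 → ℝ} {d : ℕ}

/-- Remove the 2δ-neighbourhood of the jump set and of the boundary. If h x lies outside it, the
segment to any h x' within δ keeps farther than δ from both and stays in the cube by convexity. The
segment is connected, so both ends lie in one component at scale δ. -/
theorem PiecewiseLipschitz.exists_close {h : 𝒳 ≃ₜ unitCube d} {f₀ : 𝒳 → ℝ}
    (hf : PiecewiseLipschitz μ h (f₀ ∘ h.symm)) :
    ∃ C δ₀ L : ℝ, 0 < C ∧ 0 < δ₀ ∧ 0 < L ∧ ∀ δ : ℝ, 0 < δ → δ < δ₀ →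
      ∃ A, MeasurableSet A ∧ μ A ≤ ENNReal.ofReal (C * δ) ∧
        ∀ x ∉ A, ∀ x', dist (h x) (h x') ≤ δ → |f₀ x - f₀ x'| ≤ L * δ := by
  obtain ⟨S, -, -, C, ε₀, L₀, hC, hε₀, hL₀, hS⟩ := hf
  refine ⟨2 * C, ε₀ / 2, L₀, by positivity, by positivity, hL₀, fun δ hδ hδ₀ => ?_⟩
  set T : Set 𝒳 := {x | (h x : EuclideanSpace ℝ (Fin d)) ∈
    enlarge (2 * δ) S ∪ (unitCube d \ innerCube d (2 * δ))} with hT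
  -- The jump set is only null, so `T` need not be measurable; a measurable hull has the same mass.
  refine ⟨toMeasurable μ T, measurableSet_toMeasurable _ _, ?_, fun x hx x' hxx' => ?_⟩
  · rw [measure_toMeasurable]
    refine ((hS (2 * δ) (by positivity) (by linarith)).1).trans (le_of_eq ?_)
    congr 1; ring
  have hxT : x ∉ T := fun hxT => hx (subset_toMeasurable _ _ hxT)
  rw [hT, Set.mem_ofPred_eq, Set.mem_union, not_or] at hxT
  obtain ⟨hxS, hxI⟩ := hxT
  have hxI' : (h x : EuclideanSpace ℝ (Fin d)) ∈ innerCube d (2 * δ) := by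
    by_contra hcon; exact hxI ⟨(h x).2, hcon⟩
  rw [Subtype.dist_eq] at hxx'
  set z := (h x : EuclideanSpace ℝ (Fin d)) with hz
  set z' := (h x' : EuclideanSpace ℝ (Fin d)) with hz'
  have hfar : ∀ U : Set (EuclideanSpace ℝ (Fin d)), z ∉ enlarge (2 * δ) U →
      ∀ w ∈ segment ℝ z z', w ∉ enlarge δ U := by
    rintro U hzU w hw ⟨b, hb, hwb⟩
    refine hzU ⟨b, hb, ?_⟩
    have hwz : dist w z ≤ δ := by
      have := (convex_closedBall z δ).segment_subset (Metric.mem_closedBall_self hδ.le)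
        (by rwa [Metric.mem_closedBall, dist_comm] : z' ∈ Metric.closedBall z δ) hw
      exact this
    calc dist z b ≤ dist z w + dist w b := dist_triangle _ _ _
      _ ≤ 2 * δ := by rw [dist_comm z w]; linarith
  have hsub : segment ℝ z z' ⊆ innerCube d δ \ enlarge δ S := fun w hw =>
    ⟨⟨(convex_unitCube d).segment_subset (h x).2 (h x').2 hw, hfar _ hxI'.2 w hw⟩,
      hfar _ hxS w hw⟩
  have hconn := (convex_segment (𝕜 := ℝ) z z').isPreconnected.subset_connectedComponentIn
    (left_mem_segment ℝ z z') hsub (right_mem_segment ℝ z z')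
  have := (hS δ hδ (by linarith)).2 (h x) (h x') hconn
  simp only [Function.comp_apply, Homeomorph.symm_apply_apply] at this
  refine this.trans ?_
  rw [Subtype.dist_eq]
  gcongr

theorem IsRegressionFunction.exists_locallyClose (hp : BoundedDensity p)
    [IsProbabilityMeasure (covariateLaw μ p)] {h : 𝒳 ≃ₜ unitCube d} (hh : BoundedDistortion h)
    {f₀ : 𝒳 → ℝ} (hf : IsRegressionFunction μ h f₀) :
    ∃ B C L : ℝ, LocallyClose μ (covariateLaw μ p) f₀ B C L := by
  obtain ⟨-, pmin, pmax, hpmin, hpb⟩ := hp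
  obtain ⟨x₀⟩ := nonempty_of_isProbabilityMeasure (covariateLaw μ p)
  have hpmax : 0 < pmax := by linarith [(hpb x₀).1, (hpb x₀).2]
  obtain ⟨Lmin, Lmax, hLmin, hLmax, hdist⟩ := hh
  obtain ⟨B, hB⟩ := hf.essBounded
  obtain ⟨C, δ₀, L, hC, hδ₀, hL, hclose⟩ := hf.piecewiseLipschitz.exists_close
  refine ⟨max B 0, max (pmax * (C * Lmax)) (Lmax / δ₀), L * Lmax, le_max_right _ _,
    le_max_of_le_right (by positivity), by positivity, ?_, fun R hR => ?_⟩
  · filter_upwards [hB] with x hx using hx.trans (le_max_left _ _)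
  rcases lt_or_ge (Lmax * R) δ₀ with hlt | hge
  · obtain ⟨A, hA, hμA, hAc⟩ := hclose (Lmax * R) (by positivity) hlt
    refine ⟨A, hA, ?_, fun x hx x' hxx' => ?_⟩
    · refine (covariateLaw_le (fun x => (hpb x).2.le) hA).trans ?_
      calc _ ≤ ENNReal.ofReal pmax * ENNReal.ofReal (C * (Lmax * R)) := by gcongr
        _ = ENNReal.ofReal (pmax * (C * Lmax) * R) := by
            rw [← ENNReal.ofReal_mul hpmax.le]; congr 1; ring
        _ ≤ _ := by
            refine ENNReal.ofReal_le_ofReal ?_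
            gcongr
            exact le_max_left _ _
    · rw [mul_assoc]
      exact hAc x hx x' ((hdist x x').2.trans (by gcongr))
  -- For large R the whole space may be exceptional: its mass 1 is at most (Lmax/δ₀)·R.
  · refine ⟨Set.univ, MeasurableSet.univ, prob_le_one.trans ?_, fun x hx => absurd trivial hx⟩
    rw [← ENNReal.ofReal_one]
    refine ENNReal.ofReal_le_ofReal ?_
    calc (1 : ℝ) ≤ Lmax / δ₀ * R := by rw [div_mul_eq_mul_div, le_div_iff₀ hδ₀]; linarith
      _ ≤ _ := by gcongr; exact le_max_right _ _

/-! ### The error of nearest neighbour averages -/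

theorem abs_sub_average_le {ι : Type*} {S : Finset ι} {K : ℕ} (hS : S.card = K) (hK : 0 < K)
    {a t : ℝ} {f : ι → ℝ} (hf : ∀ i ∈ S, |a - f i| ≤ t) : |a - (K : ℝ)⁻¹ * ∑ i ∈ S, f i| ≤ t := by
  have hK' : (0 : ℝ) < K := by exact_mod_cast hK
  have h1 : a - (K : ℝ)⁻¹ * ∑ i ∈ S, f i = (K : ℝ)⁻¹ * ∑ i ∈ S, (a - f i) := by
    rw [Finset.sum_sub_distrib, Finset.sum_const, hS, nsmul_eq_mul]
    field_simp
  rw [h1, abs_mul, abs_of_pos (inv_pos.2 hK')]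
  calc _ ≤ (K : ℝ)⁻¹ * ∑ _i ∈ S, t := by
        gcongr
        exact (Finset.abs_sum_le_sum_abs _ _).trans (Finset.sum_le_sum hf)
    _ = t := by rw [Finset.sum_const, hS, nsmul_eq_mul]; field_simp

theorem abs_average_le {ι : Type*} {S : Finset ι} {K : ℕ} (hS : S.card ≤ K)
    {B : ℝ} (hB : 0 ≤ B) {f : ι → ℝ} (hf : ∀ i ∈ S, |f i| ≤ B) :
    |(K : ℝ)⁻¹ * ∑ i ∈ S, f i| ≤ B := by
  rcases Nat.eq_zero_or_pos K with rfl | hK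
  · simpa using hB
  have hK' : (0 : ℝ) < K := by exact_mod_cast hK
  rw [abs_mul, abs_of_pos (inv_pos.2 hK')]
  calc _ ≤ (K : ℝ)⁻¹ * ∑ _i ∈ S, B := by
        gcongr
        exact (Finset.abs_sum_le_sum_abs _ _).trans (Finset.sum_le_sum hf)
    _ = (S.card : ℝ) * B / K := by rw [Finset.sum_const, nsmul_eq_mul]; ring
    _ ≤ (K : ℝ) * B / K := by gcongr
    _ = B := by field_simp

omit [MetricSpace 𝒳] in
-- The choice of neighbours need not be measurable in x, so the integrand is replaced by a
-- measurable majorant before the density is absorbed into the measure.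
theorem aErr_le (hp : BoundedDensity p) {f₀ U : 𝒳 → ℝ} {K n : ℕ} {pts : Fin n → 𝒳}
    {N : 𝒳 → Finset (Fin n)} (hU : Measurable U)
    (hle : ∀ᵐ x ∂μ, (f₀ x - (K : ℝ)⁻¹ * ∑ i ∈ N x, f₀ (pts i)) ^ 2 ≤ U x) :
    aErr μ p f₀ K pts N ≤ ∫⁻ x, ENNReal.ofReal (U x) ∂(covariateLaw μ p) := by
  obtain ⟨hpm, pmin, pmax, hpmin, hpb⟩ := hp
  rw [covariateLaw, lintegral_withDensity_eq_lintegral_mul _ hpm.ennreal_ofReal hU.ennreal_ofReal]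
  refine lintegral_mono_ae ?_
  filter_upwards [hle] with x hx
  have hpx : 0 ≤ p x := by linarith [(hpb x).1]
  rw [Pi.mul_apply, ← ENNReal.ofReal_mul hpx, mul_comm (p x)]
  exact ENNReal.ofReal_le_ofReal (by gcongr)

omit [MetricSpace 𝒳] in
theorem lintegral_bound_le {ν : Measure 𝒳} [IsProbabilityMeasure ν] {A : Set 𝒳}
    (hA : MeasurableSet A) {a b t : ℝ} (ha : 0 ≤ a) (hb : 0 ≤ b) (ht : 0 ≤ t)
    (hνA : ν A ≤ ENNReal.ofReal t) :
    ∫⁻ x, ENNReal.ofReal (a + A.indicator (fun _ => b) x) ∂ν ≤ ENNReal.ofReal (a + b * t) := by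
  have h1 : ∀ x, ENNReal.ofReal (a + A.indicator (fun _ => b) x) =
      ENNReal.ofReal a + A.indicator (fun _ => ENNReal.ofReal b) x := by
    intro x
    by_cases hx : x ∈ A
    · simp [hx, ENNReal.ofReal_add ha hb]
    · simp [hx]
  simp_rw [h1]
  rw [lintegral_add_left measurable_const, lintegral_const, measure_univ, mul_one,
    lintegral_indicator_const hA, ENNReal.ofReal_add ha (by positivity), ENNReal.ofReal_mul hb]
  gcongr

theorem LocallyClose.sq_sub_average_le {ν : Measure 𝒳} {f₀ : 𝒳 → ℝ} {B C L : ℝ}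
    (hf : LocallyClose μ ν f₀ B C L) {A : Set 𝒳} {R : ℝ}
    (hA : ∀ x ∉ A, ∀ x', dist x x' ≤ R → |f₀ x - f₀ x'| ≤ L * R) {n K : ℕ} (hK : 0 < K)
    {pts : Fin n → 𝒳} (hpts : ∀ i, |f₀ (pts i)| ≤ B) {x : 𝒳} (hx : |f₀ x| ≤ B)
    {S : Finset (Fin n)} (hS : S.card = K) (hSR : ∀ i ∈ S, dist (pts i) x ≤ R) :
    (f₀ x - (K : ℝ)⁻¹ * ∑ i ∈ S, f₀ (pts i)) ^ 2 ≤
      (L * R) ^ 2 + A.indicator (fun _ => (2 * B) ^ 2) x := by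
  have hB := hf.bound_nonneg
  have hL := hf.lip_nonneg
  by_cases hxA : x ∈ A
  · rw [Set.indicator_of_mem hxA]
    have h1 := abs_average_le hS.le hB (f := fun i => f₀ (pts i)) fun i _ => hpts i
    have h2 : |f₀ x - (K : ℝ)⁻¹ * ∑ i ∈ S, f₀ (pts i)| ≤ 2 * B := (abs_sub _ _).trans (by linarith)
    have h3 := sq_le_sq' (by linarith [(abs_le.1 h2).1]) (abs_le.1 h2).2
    nlinarith [sq_nonneg (L * R)]
  · rw [Set.indicator_of_notMem hxA, add_zero]
    have h2 := abs_sub_average_le hS hK (a := f₀ x) (f := fun i => f₀ (pts i)) (t := L * R)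
      fun i hi => hA x hxA _ (by rw [dist_comm]; exact hSR i hi)
    exact sq_le_sq' (by linarith [(abs_le.1 h2).1]) (abs_le.1 h2).2

end Local

/-! ### The rate of the approximation error -/

theorem isBigOP_of_forall {Ω : Type*} [MeasurableSpace Ω] {P : Measure Ω} {Z : ℕ → Ω → ℝ≥0∞}
    {a : ℕ → ℝ} (H : ∀ δ : ℝ, 0 < δ → ∃ M : ℝ, 0 < M ∧ ∀ᶠ n in atTop, ∃ F : Set Ω,
      P F ≤ ENNReal.ofReal δ ∧ ∀ ω ∉ F, Z n ω ≤ ENNReal.ofReal (M * a n)) : IsBigOP P Z a := by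
  intro δ hδ
  obtain ⟨M, hM, hF⟩ := H δ hδ
  refine ⟨M, hM, ?_⟩
  filter_upwards [hF] with n ⟨F, h1, h2⟩
  refine (measure_mono fun ω hω => ?_).trans h1
  by_contra hcon
  exact absurd (h2 ω hcon) (not_le.2 hω)

/-- Eventually κK ≥ 2 log n, so the exponential is at most n⁻² and beats the factor n from the union
bounds. -/
theorem tendsto_mul_exp_neg {K : ℕ → ℕ}
    (hK : Tendsto (fun n => (K n : ℝ) / Real.log n) atTop atTop) {c κ : ℝ} (hc : 0 ≤ c)
    (hκ : 0 < κ) : Tendsto (fun n : ℕ => c * n * Real.exp (-(κ * K n))) atTop (𝓝 0) := by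
  have h1 : Tendsto (fun n : ℕ => c * (n : ℝ)⁻¹) atTop (𝓝 0) := by
    simpa using (tendsto_inv_atTop_nhds_zero_nat (𝕜 := ℝ)).const_mul c
  refine squeeze_zero' (Eventually.of_forall fun n => by positivity) ?_ h1
  filter_upwards [hK.eventually_ge_atTop (2 / κ), eventually_ge_atTop 2] with n h2 hn
  have hn' : (2 : ℝ) ≤ n := by exact_mod_cast hn
  have hlog : 0 < Real.log n := Real.log_pos (by linarith)
  rw [le_div_iff₀ hlog, div_mul_eq_mul_div, div_le_iff₀ hκ] at h2
  have h3 : Real.exp (-(κ * K n)) ≤ ((n : ℝ) ^ 2)⁻¹ := by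
    rw [← Real.exp_log (by positivity : 0 < ((n : ℝ) ^ 2)⁻¹), Real.exp_le_exp, Real.log_inv,
      Real.log_pow]
    push_cast
    linarith
  calc _ ≤ c * n * ((n : ℝ) ^ 2)⁻¹ := by gcongr
    _ = _ := by field_simp

theorem IsIIDSample.ae_forall {𝒳 Ω : Type*} [MeasurableSpace 𝒳] [MeasurableSpace Ω] {P : Measure Ω}
    {μ : Measure 𝒳} {p : 𝒳 → ℝ} {X : ℕ → Ω → 𝒳} (hX : IsIIDSample P μ p X) {Q : 𝒳 → Prop}
    (hQ : ∀ᵐ x ∂μ, Q x) : P {ω | ¬ ∀ i, Q (X i ω)} = 0 := by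
  have h1 : ∀ᵐ x ∂(covariateLaw μ p), Q x := (withDensity_absolutelyContinuous μ _).ae_le hQ
  have h2 : ∀ i, ∀ᵐ ω ∂P, Q (X i ω) := fun i => by
    rw [← hX.law i] at h1
    exact ae_of_ae_map (hX.measurable i).aemeasurable h1
  exact ae_iff.1 (ae_all_iff.2 h2)

theorem isBigOP_aErr {𝒳 : Type*} [MetricSpace 𝒳] [MeasurableSpace 𝒳] [BorelSpace 𝒳]
    {μ : Measure 𝒳} {Ω : Type*} [MeasurableSpace Ω] {P : Measure Ω} [IsProbabilityMeasure P]
    {d : ℕ} (hd : 1 ≤ d) {p : 𝒳 → ℝ} (hp : BoundedDensity p) (hμ : VolumeGrowth μ d)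
    {h : 𝒳 ≃ₜ unitCube d} (hh : BoundedDistortion h) {X : ℕ → Ω → 𝒳} (hX : IsIIDSample P μ p X)
    {f₀ : 𝒳 → ℝ} (hf₀ : IsRegressionFunction μ h f₀) {K : ℕ → ℕ}
    (hK : Tendsto (fun n => (K n : ℝ) / Real.log n) atTop atTop)
    {N : (n : ℕ) → Ω → 𝒳 → Finset (Fin n)}
    (hN : ∀ n ω x, IsNearest (K n) Finset.univ (fun i : Fin n => X i ω) x (N n ω x)) :
    IsBigOP P (fun n ω => aErr μ p f₀ (K n) (fun i : Fin n => X i ω) (N n ω))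
      (fun n => (K n : ℝ) ^ (1 / (d : ℝ)) / (n : ℝ) ^ (1 / (d : ℝ))) := by
  have := hX.isProbabilityMeasure
  obtain ⟨B, C, L, hf⟩ := hf₀.exists_locallyClose hp hh
  obtain ⟨r₀, a₁, a₂, hB⟩ := exists_ballMass hp hμ
  obtain ⟨Lmin, Lmax, hLmin, hLmax, hdist⟩ := hh
  obtain ⟨CR, t₀, C₀, hCR, ht₀, hC₀, hcount⟩ := exists_radius_count hd hX hB hLmin hLmax hdist
  have hB0 := hf.bound_nonneg
  have hC0 := hf.const_nonneg
  have hL0 := hf.lip_nonneg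
  have hbad := hX.ae_forall hf.bdd
  refine isBigOP_of_forall fun δ hδ => ?_
  -- `M₁` serves K ≤ t₀n, where s ≤ t₀^(1/d) makes the quadratic term linear in s; `M₂` serves K >
  -- t₀n.
  set M₁ : ℝ := (L ^ 2 * (CR * t₀ ^ (1 / (d : ℝ))) + (2 * B) ^ 2 * C) * CR with hM₁
  set M₂ : ℝ := (2 * B) ^ 2 / t₀ ^ (1 / (d : ℝ)) with hM₂
  refine ⟨1 + M₁ + M₂, by positivity, ?_⟩
  set F : ℕ → Set Ω := fun n => {ω | ¬ ∀ i, |f₀ (X i ω)| ≤ B} ∪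
    {ω | (K n : ℝ) ≤ t₀ * n ∧ ∃ x, count (fun i : Fin n => X i ω)
        (Metric.closedBall x (CR * ((K n : ℝ) / n) ^ (1 / (d : ℝ)))) ≤ K n} with hF
  have hPF : ∀ᶠ n in atTop, P (F n) ≤ ENNReal.ofReal δ := by
    have hlim := tendsto_mul_exp_neg hK hC₀.le one_pos
    filter_upwards [hlim.eventually (gt_mem_nhds hδ), hK.eventually_gt_atTop 0] with n hn hKn
    have hK1 : 1 ≤ K n := by
      by_contra hcon
      have : K n = 0 := by omega
      simp [this] at hKn
    refine (measure_union_le _ _).trans ?_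
    rw [hbad, zero_add]
    by_cases hsmall : (K n : ℝ) ≤ t₀ * n
    · simp only [hsmall, true_and]
      refine (hcount n (K n) hK1 hsmall).trans (ENNReal.ofReal_le_ofReal ?_)
      rw [one_mul] at hn
      exact hn.le
    · simp [hsmall]
  · filter_upwards [hPF, hK.eventually_gt_atTop 0, eventually_ge_atTop 1] with n hPn hKn hn
    refine ⟨F n, hPn, fun ω hω => ?_⟩
    have hK1 : 1 ≤ K n := by
      by_contra hcon
      have : K n = 0 := by omega
      simp [this] at hKn
    have hK' : (0 : ℝ) < K n := by exact_mod_cast hK1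
    have hn' : (0 : ℝ) < n := by exact_mod_cast hn
    rw [hF, Set.mem_union, not_or, Set.mem_ofPred_eq, not_not, Set.mem_ofPred_eq, not_and] at hω
    obtain ⟨hω1, hω2⟩ := hω
    rw [← Real.div_rpow (by positivity) (by positivity)]
    set s : ℝ := ((K n : ℝ) / n) ^ (1 / (d : ℝ)) with hs
    have hs0 : 0 < s := by positivity
    have hcardN : ∀ x, (N n ω x).card = min (K n) n := fun x => by
      rw [(hN n ω x).2.1, Finset.card_univ, Fintype.card_fin]
    by_cases hsmall : (K n : ℝ) ≤ t₀ * n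
    · have hω3 := hω2 hsmall
      push Not at hω3
      obtain ⟨A, hA, hνA, hAclose⟩ := hf.close (CR * s) (by positivity)
      -- A ball with more than K of the n sample points exists, so K < n and the neighbour sets have
      -- exactly K elements.
      have hKn' : K n ≤ n := by
        obtain ⟨x₀⟩ := nonempty_of_isProbabilityMeasure (covariateLaw μ p)
        refine (hω3 x₀).le.trans ?_
        rw [count_closedBall]
        exact (Finset.card_le_univ _).trans (by simp)
      refine (aErr_le hp (U := fun x => (L * (CR * s)) ^ 2 + A.indicator (fun _ => (2 * B) ^ 2) x)
        (measurable_const.add (measurable_const.indicator hA)) ?_).trans ?_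
      · filter_upwards [hf.bdd] with x hx
        refine hf.sq_sub_average_le hAclose hK1 (fun i => hω1 i) hx
          ((hcardN x).trans (min_eq_left hKn')) fun i hi => ?_
        refine (hN n ω x).dist_le ?_ hi
        rw [← count_closedBall]
        exact (hω3 x).le
      · refine (lintegral_bound_le hA (by positivity) (by positivity) (by positivity) hνA).trans
          (ENNReal.ofReal_le_ofReal ?_)
        have hst : s ≤ t₀ ^ (1 / (d : ℝ)) := by
          refine Real.rpow_le_rpow (by positivity) ?_ (by positivity)
          rwa [div_le_iff₀ hn']
        have hM₂0 : 0 ≤ M₂ := by positivity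
        calc (L * (CR * s)) ^ 2 + (2 * B) ^ 2 * (C * (CR * s))
            = (L ^ 2 * (CR * s) + (2 * B) ^ 2 * C) * CR * s := by ring
          _ ≤ M₁ * s := by rw [hM₁]; gcongr
          _ ≤ _ := by nlinarith
    -- Here the rate is bounded below, so the trivial bound (2B)² is enough; this also covers K > n.
    · refine (aErr_le hp (U := fun _ => (2 * B) ^ 2) measurable_const ?_).trans ?_
      · filter_upwards [hf.bdd] with x hx
        have h1 := abs_average_le ((hcardN x).trans_le (min_le_left _ _)) hB0
          (f := fun i : Fin n => f₀ (X i ω)) fun i _ => hω1 i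
        have h2 : |f₀ x - (K n : ℝ)⁻¹ * ∑ i ∈ N n ω x, f₀ (X i ω)| ≤ 2 * B :=
          (abs_sub _ _).trans (by linarith)
        exact sq_le_sq' (by linarith [(abs_le.1 h2).1]) (abs_le.1 h2).2
      · rw [lintegral_const, measure_univ, mul_one]
        refine ENNReal.ofReal_le_ofReal ?_
        have hst : t₀ ^ (1 / (d : ℝ)) ≤ s := by
          refine Real.rpow_le_rpow (by positivity) ?_ (by positivity)
          rw [le_div_iff₀ hn']
          exact (not_le.1 hsmall).le
        have hM₁0 : 0 ≤ M₁ := by positivity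
        calc (2 * B) ^ 2 = M₂ * t₀ ^ (1 / (d : ℝ)) := by rw [hM₂]; field_simp
          _ ≤ M₂ * s := by gcongr
          _ ≤ _ := by nlinarith

/-! ### High probability bounds for the noise and for exceptional points -/

section Events

variable {𝒳 Ω : Type*} [MeasurableSpace 𝒳] [MeasurableSpace Ω] {P : Measure Ω}
  [IsProbabilityMeasure P] {μ : Measure 𝒳} {p : 𝒳 → ℝ} {X : ℕ → Ω → 𝒳} {C σ : ℝ} {ε : ℕ → Ω → ℝ}

theorem measurableSet_filter_eq {n : ℕ} {T : Fin n → Set (ℕ → 𝒳)} [∀ i x, Decidable (x ∈ T i)]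
    (hT : ∀ i, MeasurableSet (T i)) (B : Finset (Fin n)) :
    MeasurableSet {x | Finset.univ.filter (fun i => x ∈ T i) = B} := by
  have : {x | Finset.univ.filter (fun i => x ∈ T i) = B} =
      ⋂ i, {x | x ∈ T i ↔ i ∈ B} := by
    ext x
    simp [Finset.ext_iff]
  rw [this]
  refine MeasurableSet.iInter fun i => ?_
  by_cases hi : i ∈ B
  · simpa only [hi, iff_true, Set.ofPred_mem_eq] using hT i
  · simp only [hi, iff_false]
    exact (hT i).compl

/-- The block sums of the noise, over blocks given by the covariates, and the single errors. -/
theorem IsSubGaussianNoise.measure_blocks_le (hε : IsSubGaussianNoise P X C σ ε) {v : NNReal}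
    (hv : 0 < v) (hsub : ∀ i, HasSubgaussianMGF (ε i) v P) (hX : ∀ i, Measurable (X i)) {d : ℕ}
    {c : 𝒳 → Fin d → ℕ} (hc : Measurable c) (n : ℕ) (I : Finset (ℕ × (Fin d → ℕ))) {u : ℝ}
    (hu : 0 ≤ u) :
    P {ω | (∃ q ∈ I, Real.sqrt (2 * v * u *
          (Finset.univ.filter fun i : Fin n => (fun k => c (X i ω) k / 2 ^ q.1) = q.2).card) <
        |∑ i ∈ Finset.univ.filter fun i : Fin n => (fun k => c (X i ω) k / 2 ^ q.1) = q.2, ε i ω|) ∨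
      ∃ i : Fin n, Real.sqrt (2 * v * u) < |ε i ω|} ≤
        ENNReal.ofReal ((I.card + n) * (2 * Real.exp (-u))) := by
  classical
  have hsplit : {ω | (∃ q ∈ I, Real.sqrt (2 * v * u *
          (Finset.univ.filter fun i : Fin n => (fun k => c (X i ω) k / 2 ^ q.1) = q.2).card) <
        |∑ i ∈ Finset.univ.filter fun i : Fin n => (fun k => c (X i ω) k / 2 ^ q.1) = q.2, ε i ω|) ∨
      ∃ i : Fin n, Real.sqrt (2 * v * u) < |ε i ω|} =
      (⋃ q ∈ I, {ω | Real.sqrt (2 * v * u *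
          (Finset.univ.filter fun i : Fin n => (fun k => c (X i ω) k / 2 ^ q.1) = q.2).card) <
        |∑ i ∈ Finset.univ.filter fun i : Fin n => (fun k => c (X i ω) k / 2 ^ q.1) = q.2, ε i ω|}) ∪
      ⋃ i ∈ (Finset.univ : Finset (Fin n)), {ω | Real.sqrt (2 * v * u) < |ε i ω|} := by
    ext ω; simp
  rw [hsplit]
  refine (measure_union_le _ _).trans ?_
  rw [add_mul, ENNReal.ofReal_add (by positivity) (by positivity)]
  refine add_le_add ?_ ?_
  · refine (measure_biUnion_finset_le _ _).trans ?_
    calc _ ≤ ∑ _q ∈ I, ENNReal.ofReal (2 * Real.exp (-u)) := by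
          refine Finset.sum_le_sum fun q _ => ?_
          refine hε.measure_sum_le hv hsub hX (n := n)
            (fun x => Finset.univ.filter fun i : Fin n => (fun k => c (x i) k / 2 ^ q.1) = q.2)
            (fun B => ?_) hu
          refine measurableSet_filter_eq
            (T := fun i : Fin n => {x : ℕ → 𝒳 | (fun k => c (x i) k / 2 ^ q.1) = q.2})
            (fun i => ?_) B
          have h1 : Measurable fun y : Fin d → ℕ => fun k => y k / 2 ^ q.1 :=
            measurable_of_countable _
          exact (h1.comp (hc.comp (measurable_pi_apply (i : ℕ)))) (measurableSet_singleton q.2)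
      _ = _ := by
          rw [Finset.sum_const, nsmul_eq_mul, ENNReal.ofReal_mul (Nat.cast_nonneg _),
            ENNReal.ofReal_natCast]
  · refine (measure_biUnion_finset_le _ _).trans ?_
    calc _ ≤ ∑ _i : Fin n, ENNReal.ofReal (2 * Real.exp (-u)) := by
          refine Finset.sum_le_sum fun i _ => ?_
          have := hε.measure_sum_le hv hsub hX (n := n) (fun _ => {i}) (fun B => by simp) hu
          simpa using this
      _ = _ := by
          rw [Finset.sum_const, nsmul_eq_mul, ENNReal.ofReal_mul (Nat.cast_nonneg _),
            ENNReal.ofReal_natCast, Finset.card_univ, Fintype.card_fin]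

omit [IsProbabilityMeasure P] in
-- Markov's inequality for a count with mean n times the mass. A fixed failure probability is all
-- that is needed, so no concentration is required.
theorem measure_lt_count_le (hX : IsIIDSample P μ p X) {A : Set 𝒳} (hA : MeasurableSet A) (n : ℕ)
    {a b : ℝ} (hb : 0 < b) (hνA : covariateLaw μ p A ≤ ENNReal.ofReal a) :
    P {ω | n * b < (count (fun i : Fin n => X i ω) A : ℝ)} ≤ ENNReal.ofReal (a / b) := by
  classical
  rcases Nat.eq_zero_or_pos n with rfl | hn
  · simp [count]
  have hn' : (0 : ℝ) < n := by exact_mod_cast hn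
  have hint : ∫⁻ ω, ENNReal.ofReal (count (fun i : Fin n => X i ω) A) ∂P =
      n * covariateLaw μ p A := by
    have h1 : ∀ ω, ENNReal.ofReal (count (fun i : Fin n => X i ω) A) =
        ∑ i : Fin n, (X i ⁻¹' A).indicator (fun _ => (1 : ℝ≥0∞)) ω := by
      intro ω
      simp [count, Set.indicator_apply]
    simp_rw [h1]
    rw [lintegral_finsetSum _ fun (i : Fin n) _ =>
      (measurable_const (a := (1 : ℝ≥0∞))).indicator (hX.measurable (i : ℕ) hA)]
    have h2 : ∀ i : Fin n, ∫⁻ ω, (X i ⁻¹' A).indicator (fun _ => (1 : ℝ≥0∞)) ω ∂P =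
        covariateLaw μ p A := fun i => by
      rw [lintegral_indicator_const (hX.measurable i hA), one_mul,
        ← Measure.map_apply (hX.measurable i) hA, hX.law i]
    simp [h2]
  have h3 := mul_meas_ge_le_lintegral (μ := P) (measurable_count hX hA n).ennreal_ofReal
    (ENNReal.ofReal (n * b))
  rw [hint] at h3
  have h4 : ENNReal.ofReal (n * b) * P {ω | n * b < (count (fun i : Fin n => X i ω) A : ℝ)} ≤
      ENNReal.ofReal (n * a) := by
    refine le_trans ?_ (h3.trans ?_)
    · exact mul_le_mul_right (measure_mono fun ω hω => ENNReal.ofReal_le_ofReal (le_of_lt hω)) _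
    · rw [ENNReal.ofReal_mul hn'.le, ENNReal.ofReal_natCast]
      gcongr
  have h5 : ENNReal.ofReal (a / b) = ENNReal.ofReal (n * a) / ENNReal.ofReal (n * b) := by
    rw [← ENNReal.ofReal_div_of_pos (by positivity)]
    congr 1; field_simp
  rw [h5, ENNReal.le_div_iff_mul_le (Or.inl (ENNReal.ofReal_pos.2 (by positivity)).ne') (Or.inl ENNReal.ofReal_ne_top),
    mul_comm]
  exact h4

end Events

/-! ### Deterministic bounds on the sample -/

section Deterministic

variable {𝒳 : Type*} [MetricSpace 𝒳] [MeasurableSpace 𝒳] {d n K : ℕ} {pts : Fin n → 𝒳}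
  {nb : Fin n → Finset (Fin n)}

omit [MeasurableSpace 𝒳] in
-- A block of level l is a union of at most (2^l)^d cells, each with at most K points.
theorem card_block_le {h : 𝒳 ≃ₜ unitCube d} {J : ℕ}
    (hcell : ∀ i, (Finset.univ.filter fun j =>
      cell h (2 ^ J) (pts j) = cell h (2 ^ J) (pts i)).card ≤ K) (l : ℕ) (x : Fin d → ℕ) :
    (Finset.univ.filter fun i => (fun k => cell h (2 ^ J) (pts i) k / 2 ^ l) = x).card ≤
      K * (2 ^ l) ^ d := by
  classical
  have h1 := Finset.card_le_mul_card_image_of_maps_to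
    (s := Finset.univ.filter fun i => (fun k => cell h (2 ^ J) (pts i) k / 2 ^ l) = x)
    (t := (box d (2 ^ l)).image fun b => 2 ^ l • x + b) (f := fun i => cell h (2 ^ J) (pts i))
    (fun i hi => ?_) K (fun y _ => ?_)
  · refine h1.trans (Nat.mul_le_mul_left _ ?_)
    exact Finset.card_image_le.trans (card_box d _).le
  · rw [Finset.mem_filter] at hi
    refine Finset.mem_image.2 ⟨fun k => cell h (2 ^ J) (pts i) k % 2 ^ l,
      mem_box.2 fun k => Nat.mod_lt _ (by positivity), ?_⟩
    ext k
    rw [← hi.2]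
    simp only [Pi.add_apply, Pi.smul_apply, smul_eq_mul]
    exact Nat.div_add_mod _ _
  · rcases Finset.eq_empty_or_nonempty ((Finset.univ.filter fun i =>
      (fun k => cell h (2 ^ J) (pts i) k / 2 ^ l) = x).filter
        fun i => cell h (2 ^ J) (pts i) = y) with he | ⟨i, hi⟩
    · rw [he]; simp
    · rw [Finset.mem_filter] at hi
      refine (Finset.card_le_card fun j hj => ?_).trans (hcell i)
      rw [Finset.mem_filter] at hj ⊢
      exact ⟨Finset.mem_univ _, hj.2.trans hi.2.symm⟩

omit [MeasurableSpace 𝒳] in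
-- The deterministic part of the noise bound: on the good events the hypotheses of
-- `abs_sum_mul_le_penalty` hold with m = κK and β = sqrt(VK).
theorem noise_inner_le (hd : 2 ≤ d) {h : 𝒳 ≃ₜ unitCube d} {Lmin : ℝ} (hLmin : 0 < Lmin)
    (hdist : ∀ x x' : 𝒳, Lmin * dist x x' ≤ dist (h x) (h x')) {J : ℕ} {κ c₃ V : ℝ} (hκ : 0 < κ)
    (hc₃ : 0 < c₃) (hK : 1 ≤ K) (hn : 1 ≤ n) (hV : 0 ≤ V)
    (hJ : c₃ * n ≤ ((2 : ℝ) ^ J) ^ d * (κ * K))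
    (hlow : ∀ y ∈ box d (2 ^ J), κ * K ≤ count pts {x | cell h (2 ^ J) x = y})
    (hup : ∀ i, count pts (Metric.closedBall (pts i)
      (2 * Real.sqrt d / ((2 ^ J : ℕ) * Lmin))) ≤ K)
    (hnb : ∀ i, IsNearest K (Finset.univ.erase i) pts (pts i) (nb i)) {e : Fin n → ℝ}
    (hblock : ∀ l ≤ J, ∀ x ∈ box d (2 ^ J),
      |∑ i with (fun k => cell h (2 ^ J) (pts i) k / 2 ^ l) = x, e i| ≤ Real.sqrt (V *
        (Finset.univ.filter fun i => (fun k => cell h (2 ^ J) (pts i) k / 2 ^ l) = x).card))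
    (he : ∀ i, |e i| ≤ Real.sqrt V) (Δ : Fin n → ℝ) :
    |∑ i, e i * Δ i| ≤ (Real.sqrt V * (κ * K)⁻¹ +
        J * Real.sqrt (V * K) * 2 ^ d * (d * ((κ * K)⁻¹ * (κ * K)⁻¹))) *
          (2 * penalty (knnGraph nb) Δ) +
      Real.sqrt V / c₃ * Real.sqrt (∑ i, Δ i ^ 2) := by
  classical
  have hK' : (0 : ℝ) < K := by exact_mod_cast hK
  have hn' : (0 : ℝ) < n := by exact_mod_cast hn
  have hN : 0 < 2 ^ J := by positivity
  set c : Fin n → Fin d → ℕ := fun i => cell h (2 ^ J) (pts i) with hc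
  have hcb : ∀ i, c i ∈ box d (2 ^ J) := fun i => cell_mem_box h hN _
  -- Points in adjacent cells lie in a ball with at most K sample points, so they are among each
  -- other's K nearest neighbours.
  have hclose : ∀ i j, i ≠ j → (∀ k, c j k ≤ c i k + 1 ∧ c i k ≤ c j k + 1) →
      (knnGraph nb).Adj i j := by
    intro i j hij hk
    rw [knnGraph, SimpleGraph.fromRel_adj]
    refine ⟨hij, Or.inr ((hnb i).mem (ρ := 2 * Real.sqrt d / ((2 ^ J : ℕ) * Lmin)) ?_
      (Finset.mem_erase.2 ⟨hij.symm, Finset.mem_univ _⟩)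
      (dist_le_of_cell h hLmin hdist hN hk))⟩
    refine le_trans ?_ (hup i)
    rw [count_closedBall]
    exact Finset.card_le_card (Finset.filter_subset_filter _ (Finset.erase_subset _ _))
  have hcell : ∀ i, (Finset.univ.filter fun j => c j = c i).card ≤ K := by
    intro i
    refine le_trans ?_ (hup i)
    rw [count_closedBall]
    refine Finset.card_le_card (Finset.monotone_filter_right _ fun j _ hj => ?_)
    have hj' : c j = c i := hj
    refine dist_le_of_cell h hLmin hdist hN fun k => ?_
    have : c j k = c i k := by rw [hj']
    exact ⟨this.le.trans (Nat.le_succ _), this.ge.trans (Nat.le_succ _)⟩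
  set B : ℕ → ℝ := fun l => Real.sqrt (V * (K * (2 ^ l) ^ d)) with hBdef
  have hBl : ∀ l ≤ J, ∀ x, |∑ i with (fun k => c i k / 2 ^ l) = x, e i| ≤ B l := by
    intro l hl x
    by_cases hx : x ∈ box d (2 ^ J)
    · refine (hblock l hl x hx).trans (Real.sqrt_le_sqrt ?_)
      refine mul_le_mul_of_nonneg_left ?_ hV
      exact_mod_cast card_block_le hcell l x
    · have : (Finset.univ.filter fun i => (fun k => c i k / 2 ^ l) = x) = ∅ := by
        refine Finset.filter_eq_empty_iff.2 fun i _ hi => hx ?_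
        rw [← hi, mem_box]
        exact fun k => (Nat.div_le_self _ _).trans_lt (mem_box.1 (hcb i) k)
      rw [this, Finset.sum_empty, abs_zero]
      exact Real.sqrt_nonneg _
  -- At side length t = 2^l the noise contributes sqrt(VK)·t^(d/2) and the chaining weight is t/t^d.
  -- The product is at most sqrt(VK) because t ≤ t^(d/2), and this is where d ≥ 2 is needed.
  have hβ : ∀ l ≤ J, B l * (2 / 2 ^ d) ^ l ≤ Real.sqrt (V * K) := by
    intro l _
    set t : ℝ := 2 ^ l with ht
    have ht1 : 1 ≤ t := one_le_pow₀ one_le_two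
    have htd : (0 : ℝ) < t ^ d := by positivity
    have h1 : (2 / 2 ^ d : ℝ) ^ l = t / t ^ d := by
      rw [div_pow, ht, ← pow_mul, ← pow_mul, mul_comm d l]
    have h2 : B l = Real.sqrt (V * K) * Real.sqrt (t ^ d) := by
      rw [hBdef, ← Real.sqrt_mul (by positivity)]
      simp only [ht, mul_assoc]
    have h3 : t ≤ Real.sqrt (t ^ d) := Real.le_sqrt_of_sq_le (pow_le_pow_right₀ ht1 hd)
    have h4 := Real.mul_self_sqrt htd.le
    rw [h1, h2, mul_assoc]
    refine mul_le_of_le_one_right (Real.sqrt_nonneg _) ?_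
    rw [mul_div_assoc', div_le_one htd]
    calc _ ≤ Real.sqrt (t ^ d) * Real.sqrt (t ^ d) := by gcongr
      _ = _ := h4
  have hlow' : ∀ y ∈ box d (2 ^ J), κ * K ≤ (Finset.univ.filter (c · = y)).card := by
    intro y hy
    refine (hlow y hy).trans (le_of_eq ?_)
    unfold count
    congr 2
    ext i
    simp only [Finset.mem_filter]
    rfl
  have main := abs_sum_mul_le_penalty (knnGraph nb) c hcb
    (fun i j hij hcij => hclose i j hij fun k => by rw [hcij]; omega)
    (fun i j k hk => hclose i j
      (fun hij => by
        subst hij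
        have := congrFun hk k
        simp at this)
      (fun k' => by
        rw [hk]
        by_cases hkk : k' = k
        · subst hkk; simp only [Pi.add_apply, Pi.single_eq_same]; omega
        · simp [hkk]))
    (by positivity : 0 < κ * K) hlow' e he hBl hβ Δ
  refine main.trans (add_le_add le_rfl ?_)
  -- At level J there is a single block, the whole sample.
  have hroot : |∑ i, e i| ≤ Real.sqrt V * Real.sqrt n := by
    have := hblock J le_rfl 0 (mem_box.2 fun k => by simp)
    have hall : (Finset.univ.filter fun i => (fun k => c i k / 2 ^ J) = 0) = Finset.univ := by
      refine Finset.filter_true_of_mem fun i _ => ?_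
      ext k
      exact Nat.div_eq_of_lt (mem_box.1 (hcb i) k)
    rw [hall, Finset.card_univ, Fintype.card_fin, Real.sqrt_mul hV] at this
    exact this
  have hcs : ∑ i, |Δ i| ≤ Real.sqrt n * Real.sqrt (∑ i, Δ i ^ 2) := by
    rw [← Real.sqrt_mul hn'.le]
    refine Real.le_sqrt_of_sq_le ?_
    have := sq_sum_le_card_mul_sum_sq (s := Finset.univ) (f := fun i => |Δ i|)
    simpa using this
  have hinv : (((2 : ℝ) ^ J) ^ d)⁻¹ * (κ * K)⁻¹ ≤ (c₃ * n)⁻¹ := by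
    rw [← mul_inv]
    exact inv_anti₀ (by positivity) hJ
  calc |∑ i, e i| * ((((2 : ℝ) ^ J) ^ d)⁻¹ * ((κ * K)⁻¹ * ∑ i, |Δ i|))
      = |∑ i, e i| * ((((2 : ℝ) ^ J) ^ d)⁻¹ * (κ * K)⁻¹) * ∑ i, |Δ i| := by ring
    _ ≤ (Real.sqrt V * Real.sqrt n) * (c₃ * n)⁻¹ *
        (Real.sqrt n * Real.sqrt (∑ i, Δ i ^ 2)) := by gcongr
    _ = Real.sqrt V * (c₃ * n)⁻¹ * (Real.sqrt n * Real.sqrt n) * Real.sqrt (∑ i, Δ i ^ 2) := by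
        ring
    _ = _ := by
        rw [Real.mul_self_sqrt hn'.le]
        field_simp

omit [MeasurableSpace 𝒳] in
-- A neighbour list based off `A` has at most K differences of size L·R; each of the at most n·b
-- lists based in `A` has at most K differences of size 2B.
theorem penalty_regression_le {f₀ : 𝒳 → ℝ} {A : Set 𝒳} {B L R b : ℝ} (hB : 0 ≤ B) (hL : 0 ≤ L)
    (hR : 0 ≤ R) (hA : ∀ x ∉ A, ∀ x', dist x x' ≤ R → |f₀ x - f₀ x'| ≤ L * R)
    (hpts : ∀ i, |f₀ (pts i)| ≤ B) (hcard : ∀ i, (nb i).card ≤ K)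
    (hnb : ∀ i, ∀ j ∈ nb i, dist (pts j) (pts i) ≤ R) (hcount : (count pts A : ℝ) ≤ n * b) :
    penalty (knnGraph nb) (fun i => f₀ (pts i)) ≤ n * K * (L * R + 2 * B * b) := by
  classical
  refine (penalty_knnGraph_le nb _).trans ?_
  have h1 : ∀ i, ∑ j ∈ nb i, |f₀ (pts i) - f₀ (pts j)| ≤
      K * (L * R) + if pts i ∈ A then K * (2 * B) else 0 := by
    intro i
    have hcard' : ((nb i).card : ℝ) ≤ K := by exact_mod_cast hcard i
    split_ifs with hi
    · calc _ ≤ ∑ _j ∈ nb i, 2 * B := Finset.sum_le_sum fun j _ =>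
            (abs_sub _ _).trans (by linarith [hpts i, hpts j])
        _ = (nb i).card * (2 * B) := by rw [Finset.sum_const, nsmul_eq_mul]
        _ ≤ K * (2 * B) := by gcongr
        _ ≤ _ := le_add_of_nonneg_left (by positivity)
    · calc _ ≤ ∑ _j ∈ nb i, L * R := Finset.sum_le_sum fun j hj =>
            hA _ hi _ (by rw [dist_comm]; exact hnb i j hj)
        _ = (nb i).card * (L * R) := by rw [Finset.sum_const, nsmul_eq_mul]
        _ ≤ K * (L * R) := by gcongr
        _ = _ := (add_zero _).symm
  refine (Finset.sum_le_sum fun i _ => h1 i).trans ?_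
  rw [Finset.sum_add_distrib, Finset.sum_const, Finset.card_univ, Fintype.card_fin, nsmul_eq_mul,
    ← Finset.sum_filter, Finset.sum_const, nsmul_eq_mul]
  have h2 : ((Finset.univ.filter fun i => pts i ∈ A).card : ℝ) ≤ n * b := by
    refine le_trans (le_of_eq ?_) hcount
    unfold count
    congr 2
  calc _ ≤ (n : ℝ) * (K * (L * R)) + n * b * (K * (2 * B)) := by gcongr
    _ = _ := by ring

theorem predict_eq {n K : ℕ} (θ : Fin n → ℝ) {S : Finset (Fin n)} (hS : S.card = K) :
    predict θ S = (K : ℝ)⁻¹ * ∑ i ∈ S, θ i := by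
  unfold predict
  simp [hS]

/-- Sample point i enters the prediction at x only if x lies in the ball of radius R about it, a set
of mass at most m. Integrating the average of Δ i ² over the neighbours therefore costs m/K per
sample point. As θ is arbitrary, its dependence on the sample does no harm. -/
theorem mise_le {μ : Measure 𝒳} {p : 𝒳 → ℝ} [BorelSpace 𝒳] [IsProbabilityMeasure (covariateLaw μ p)]
    {f₀ : 𝒳 → ℝ} {B C L : ℝ} (hf : LocallyClose μ (covariateLaw μ p) f₀ B C L) {A : Set 𝒳}
    {R m : ℝ} (hR : 0 < R) (hAm : MeasurableSet A)
    (hνA : covariateLaw μ p A ≤ ENNReal.ofReal (C * R))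
    (hA : ∀ x ∉ A, ∀ x', dist x x' ≤ R → |f₀ x - f₀ x'| ≤ L * R) (hK : 0 < K)
    (hpts : ∀ i, |f₀ (pts i)| ≤ B) (hm : 0 ≤ m)
    (hball : ∀ x, covariateLaw μ p (Metric.closedBall x R) ≤ ENNReal.ofReal m)
    {N : 𝒳 → Finset (Fin n)} (hN : ∀ x, (N x).card = K) (hNR : ∀ x, ∀ i ∈ N x, dist (pts i) x ≤ R)
    (θ : Fin n → ℝ) :
    mise μ p f₀ (fun x => predict θ (N x)) ≤
      ENNReal.ofReal (2 * ((L * R) ^ 2 + (2 * B) ^ 2 * (C * R)) +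
        2 / K * m * ∑ i, (θ i - f₀ (pts i)) ^ 2) := by
  classical
  have hK' : (0 : ℝ) < K := by exact_mod_cast hK
  have hB := hf.bound_nonneg
  have hC := hf.const_nonneg
  set ν := covariateLaw μ p with hν
  set Δ : Fin n → ℝ := fun i => θ i - f₀ (pts i) with hΔ
  set U : 𝒳 → ℝ := fun x => (L * R) ^ 2 + A.indicator (fun _ => (2 * B) ^ 2) x with hU
  have hUm : Measurable U := measurable_const.add (measurable_const.indicator hAm)
  have hpt : ∀ᵐ x ∂ν, ENNReal.ofReal (|f₀ x - predict θ (N x)| ^ 2) ≤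
      2 * ENNReal.ofReal (U x) + ∑ i, (Metric.closedBall (pts i) R).indicator
        (fun _ => ENNReal.ofReal (2 / K * Δ i ^ 2)) x := by
    filter_upwards [(withDensity_absolutelyContinuous μ _).ae_le hf.bdd] with x hx
    have h1 := hf.sq_sub_average_le hA hK hpts hx (hN x) (hNR x)
    have h2 : f₀ x - predict θ (N x) = (f₀ x - (K : ℝ)⁻¹ * ∑ i ∈ N x, f₀ (pts i)) -
        (K : ℝ)⁻¹ * ∑ i ∈ N x, Δ i := by
      rw [predict_eq θ (hN x), hΔ, Finset.sum_sub_distrib]; ring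
    have h3 : ((K : ℝ)⁻¹ * ∑ i ∈ N x, Δ i) ^ 2 ≤ (K : ℝ)⁻¹ * ∑ i ∈ N x, Δ i ^ 2 := by
      have := sq_sum_le_card_mul_sum_sq (s := N x) (f := Δ)
      rw [hN x] at this
      calc _ = (K : ℝ)⁻¹ ^ 2 * (∑ i ∈ N x, Δ i) ^ 2 := by ring
        _ ≤ (K : ℝ)⁻¹ ^ 2 * (K * ∑ i ∈ N x, Δ i ^ 2) := by gcongr
        _ = _ := by field_simp
    have h4 : |f₀ x - predict θ (N x)| ^ 2 ≤ 2 * U x + ∑ i ∈ N x, 2 / K * Δ i ^ 2 := by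
      rw [sq_abs, h2, ← Finset.mul_sum]
      have h5 : (2 : ℝ) / K * ∑ i ∈ N x, Δ i ^ 2 = 2 * ((K : ℝ)⁻¹ * ∑ i ∈ N x, Δ i ^ 2) := by ring
      rw [h5]
      nlinarith [sq_nonneg ((f₀ x - (K : ℝ)⁻¹ * ∑ i ∈ N x, f₀ (pts i)) +
        (K : ℝ)⁻¹ * ∑ i ∈ N x, Δ i)]
    have hU0 : 0 ≤ U x := (sq_nonneg _).trans h1
    refine (ENNReal.ofReal_le_ofReal h4).trans ?_
    rw [ENNReal.ofReal_add (by positivity) (Finset.sum_nonneg fun i _ => by positivity),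
      ENNReal.ofReal_mul zero_le_two, ENNReal.ofReal_ofNat,
      ENNReal.ofReal_sum_of_nonneg fun i _ => by positivity]
    gcongr
    calc _ ≤ ∑ i ∈ N x, (Metric.closedBall (pts i) R).indicator
          (fun _ => ENNReal.ofReal (2 / K * Δ i ^ 2)) x := by
          refine Finset.sum_le_sum fun i hi => ?_
          rw [Set.indicator_of_mem]
          rw [Metric.mem_closedBall, dist_comm]
          exact hNR x i hi
      _ ≤ _ := Finset.sum_le_univ_sum_of_nonneg fun i => zero_le
  unfold mise
  refine (lintegral_mono_ae hpt).trans ?_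
  rw [lintegral_add_left (hUm.ennreal_ofReal.const_mul 2),
    lintegral_const_mul _ hUm.ennreal_ofReal, lintegral_finsetSum _ fun i _ =>
      measurable_const.indicator Metric.isClosed_closedBall.measurableSet,
    ENNReal.ofReal_add (by positivity) (by positivity), ENNReal.ofReal_mul zero_le_two,
    ENNReal.ofReal_ofNat]
  gcongr
  · exact lintegral_bound_le hAm (by positivity) (by positivity) (by positivity) hνA
  · rw [Finset.mul_sum, ENNReal.ofReal_sum_of_nonneg fun i _ => by positivity]
    refine Finset.sum_le_sum fun i _ => ?_
    rw [lintegral_indicator_const Metric.isClosed_closedBall.measurableSet]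
    calc _ ≤ ENNReal.ofReal (2 / K * Δ i ^ 2) * ENNReal.ofReal m := by gcongr; exact hball _
      _ = _ := by
          rw [← ENNReal.ofReal_mul (by positivity)]
          congr 1; ring

end Deterministic

/-! ### Polylogarithmic growth of the number of neighbours -/

theorem tendsto_log_natCast : Tendsto (fun n : ℕ => Real.log n) atTop atTop :=
  Real.tendsto_log_atTop.comp tendsto_natCast_atTop_atTop

section Growth

variable {K : ℕ → ℕ} {r : ℝ}

theorem exists_eventually_le_log (hK : (fun n : ℕ => (K n : ℝ)) =Θ[atTop]
    (fun n : ℕ => Real.log n ^ (1 + 2 * r))) :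
    ∃ c : ℝ, 0 < c ∧ ∀ᶠ n : ℕ in atTop, (K n : ℝ) ≤ c * Real.log n ^ (1 + 2 * r) := by
  obtain ⟨c, hc, h⟩ := hK.1.exists_pos
  refine ⟨c, hc, ?_⟩
  filter_upwards [h.bound, tendsto_log_natCast.eventually_ge_atTop 1] with n hn hlog
  rwa [Real.norm_of_nonneg (by positivity), Real.norm_of_nonneg (by positivity)] at hn

theorem tendsto_div_log (hr : 0 < r) (hK : (fun n : ℕ => (K n : ℝ)) =Θ[atTop]
    (fun n : ℕ => Real.log n ^ (1 + 2 * r))) :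
    Tendsto (fun n => (K n : ℝ) / Real.log n) atTop atTop := by
  obtain ⟨c, hc, h⟩ := hK.2.exists_pos
  have h1 : Tendsto (fun n : ℕ => c⁻¹ * Real.log n ^ (2 * r)) atTop atTop :=
    ((tendsto_rpow_atTop (by positivity)).comp tendsto_log_natCast).const_mul_atTop
      (inv_pos.2 hc)
  refine tendsto_atTop_mono' _ ?_ h1
  filter_upwards [h.bound, tendsto_log_natCast.eventually_ge_atTop 1] with n hn hlog
  have hpos : 0 < Real.log n := by linarith
  rw [Real.norm_of_nonneg (by positivity), Real.norm_of_nonneg (by positivity),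
    Real.rpow_add hpos, Real.rpow_one] at hn
  rw [le_div_iff₀ hpos, mul_assoc, inv_mul_le_iff₀ hc]
  linarith

theorem eventually_le_mul_natCast (hK : (fun n : ℕ => (K n : ℝ)) =Θ[atTop]
    (fun n : ℕ => Real.log n ^ (1 + 2 * r))) {t : ℝ} (ht : 0 < t) :
    ∀ᶠ n : ℕ in atTop, (K n : ℝ) ≤ t * n := by
  have h1 : (fun n : ℕ => Real.log n ^ (1 + 2 * r)) =o[atTop] fun n : ℕ => (n : ℝ) ^ (1 : ℝ) :=
    (isLittleO_log_rpow_rpow_atTop (1 + 2 * r) one_pos).comp_tendsto tendsto_natCast_atTop_atTop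
  filter_upwards [(hK.1.trans_isLittleO h1).def ht] with n hn
  simpa using hn

/-- The spare factor log^r n swallows any constant, so the tuning parameter can be free of unknown
constants. -/
theorem eventually_mul_log_rpow_le (hr : 0 < r) (D : ℝ) :
    ∀ᶠ n : ℕ in atTop, D * (Real.log n * Real.sqrt (Real.log n)) ≤ Real.log n ^ (1.5 + r) := by
  have h1 : Tendsto (fun n : ℕ => Real.log n ^ r) atTop atTop :=
    (tendsto_rpow_atTop hr).comp tendsto_log_natCast
  filter_upwards [h1.eventually_ge_atTop D, tendsto_log_natCast.eventually_ge_atTop 1]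
    with n hn hlog
  have hpos : 0 < Real.log n := by linarith
  have e : Real.log n ^ (1.5 + r) = Real.log n * Real.sqrt (Real.log n) * Real.log n ^ r := by
    rw [Real.sqrt_eq_rpow, ← Real.rpow_one_add' hpos.le (by norm_num), ← Real.rpow_add hpos]
    norm_num
  rw [e, mul_comm]
  gcongr

end Growth

/-! ### Arithmetic of the constants and the rate -/

/-- The negative powers of K are simply discarded. One factor log n comes from the number J of
scales, and sqrt(log n) from the noise level. -/
theorem noise_coefficient_le {d J K : ℕ} {κ v ell : ℝ} (hκ : 0 < κ) (hv : 0 ≤ v) (hell : 1 ≤ ell)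
    (hK : 1 ≤ K) (hJ : J ≤ 2 * ell) :
    (Real.sqrt (v * ell) * (κ * K)⁻¹ +
        J * Real.sqrt (v * ell * K) * 2 ^ d * (d * ((κ * K)⁻¹ * (κ * K)⁻¹))) * 2 ≤
      2 * Real.sqrt v * (κ⁻¹ + 2 * 2 ^ d * d * (κ⁻¹ * κ⁻¹)) * (ell * Real.sqrt ell) := by
  have hK' : (1 : ℝ) ≤ K := by exact_mod_cast hK
  have hKs : Real.sqrt K ≤ K := by
    rw [Real.sqrt_le_left (by positivity)]
    nlinarith
  have h1 : (κ * K)⁻¹ ≤ κ⁻¹ := inv_anti₀ hκ (by nlinarith)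
  have h2 : Real.sqrt K * (κ * K)⁻¹ ≤ κ⁻¹ := by
    rw [mul_inv, ← mul_assoc, mul_comm _ κ⁻¹, mul_assoc]
    refine mul_le_of_le_one_right (by positivity) ?_
    rw [← div_eq_mul_inv, div_le_one (by positivity)]
    exact hKs
  have h3 : Real.sqrt ell ≤ ell * Real.sqrt ell :=
    le_mul_of_one_le_left (Real.sqrt_nonneg _) hell
  rw [Real.sqrt_mul (by positivity : 0 ≤ v * ell), Real.sqrt_mul hv]
  calc _ = 2 * Real.sqrt v * (Real.sqrt ell * (κ * K)⁻¹ + J * Real.sqrt ell * 2 ^ d * d *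
        ((Real.sqrt K * (κ * K)⁻¹) * (κ * K)⁻¹)) := by ring
    _ ≤ 2 * Real.sqrt v * ((ell * Real.sqrt ell) * κ⁻¹ +
        (2 * ell) * Real.sqrt ell * 2 ^ d * d * (κ⁻¹ * κ⁻¹)) := by gcongr
    _ = _ := by ring

/-- The second bound is the decisive one: its exponent is (1.5 + r) + (1 + 2r) + (1 + 2r)/d, from λ,
K and (K/n)^(1/d). The other two are of smaller order. -/
theorem rate_bounds {d : ℕ} (hd : 1 ≤ d) {r ell n K c : ℝ} (hr : 0 < r) (hell : 1 ≤ ell)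
    (hn : 1 ≤ n) (hK : 0 < K) (hc : 0 < c) (hKc : K ≤ c * ell ^ (1 + 2 * r)) :
    (K / n) ^ (1 / (d : ℝ)) ≤
        c ^ (1 / (d : ℝ)) * (ell ^ (2.5 + 3 * r + (1 + 2 * r) / d) / n ^ (1 / (d : ℝ))) ∧
      ell ^ (1.5 + r) * K * (K / n) ^ (1 / (d : ℝ)) ≤
        c * c ^ (1 / (d : ℝ)) * (ell ^ (2.5 + 3 * r + (1 + 2 * r) / d) / n ^ (1 / (d : ℝ))) ∧
      ell / n ≤ ell ^ (2.5 + 3 * r + (1 + 2 * r) / d) / n ^ (1 / (d : ℝ)) := by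
  have hell0 : 0 < ell := by linarith
  have hn0 : 0 < n := by linarith
  have hd' : (1 : ℝ) ≤ d := by exact_mod_cast hd
  set s : ℝ := ell ^ ((1 + 2 * r) / d) / n ^ (1 / (d : ℝ)) with hs
  have hs0 : 0 < s := by positivity
  have ha : ell ^ (2.5 + 3 * r + (1 + 2 * r) / d) / n ^ (1 / (d : ℝ)) =
      ell ^ (2.5 + 3 * r) * s := by
    rw [Real.rpow_add hell0, hs]; ring
  have h1 : (K / n) ^ (1 / (d : ℝ)) ≤ c ^ (1 / (d : ℝ)) * s := by
    rw [Real.div_rpow hK.le hn0.le, hs, mul_div_assoc']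
    gcongr
    calc K ^ (1 / (d : ℝ)) ≤ (c * ell ^ (1 + 2 * r)) ^ (1 / (d : ℝ)) := by gcongr
      _ = _ := by
          rw [Real.mul_rpow hc.le (by positivity), ← Real.rpow_mul hell0.le]
          ring_nf
  have h2 : 1 ≤ ell ^ (2.5 + 3 * r) := Real.one_le_rpow hell (by positivity)
  rw [ha]
  refine ⟨h1.trans ?_, ?_, ?_⟩
  · gcongr
    exact le_mul_of_one_le_left hs0.le h2
  · calc _ ≤ ell ^ (1.5 + r) * (c * ell ^ (1 + 2 * r)) * (c ^ (1 / (d : ℝ)) * s) := by gcongr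
      _ = c * c ^ (1 / (d : ℝ)) * ((ell ^ (1.5 + r) * ell ^ (1 + 2 * r)) * s) := by ring
      _ = _ := by
          rw [← Real.rpow_add hell0]
          ring_nf
  · rw [← ha]
    gcongr
    · nth_rewrite 1 [← Real.rpow_one ell]
      refine Real.rpow_le_rpow_of_exponent_le hell ?_
      have : 0 ≤ (1 + 2 * r) / d := by positivity
      linarith
    · nth_rewrite 2 [← Real.rpow_one n]
      refine Real.rpow_le_rpow_of_exponent_le hn ?_
      rw [div_le_one (by linarith)]
      exact hd'

theorem le_two_mul_log {d J n : ℕ} (hd : 1 ≤ d) (hJ : ((2 : ℝ) ^ J) ^ d ≤ n) :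
    (J : ℝ) ≤ 2 * Real.log n ∧ J + 1 ≤ n := by
  have h1 : (2 : ℝ) ^ J ≤ n := (le_self_pow₀ (one_le_pow₀ one_le_two) (by omega)).trans hJ
  constructor
  · have h2 := Real.log_le_log (by positivity) h1
    rw [Real.log_pow] at h2
    have h3 := Real.log_two_gt_d9
    have h4 : (0 : ℝ) ≤ J := by positivity
    nlinarith
  · have h2 : 2 ^ J ≤ n := by exact_mod_cast h1
    exact (Nat.lt_two_pow_self (n := J)).trans_le h2

/-- The final combination of the approximation and the estimation error. -/
theorem total_error_le {d : ℕ} {B C L CR a q c₃ V b lam n K s : ℝ}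
    (hCR : 0 < CR) (ha : 0 ≤ a) (hq : q = a * CR ^ d) (hn : 0 < n) (hK : 0 < K) (hs0 : 0 ≤ s)
    (hs1 : s ≤ 1) (hsd : s ^ d = K / n) {S : ℝ}
    (hS : S ≤ 8 * lam * (n * K * (L * (CR * s) + 2 * B * (b * (CR * s)))) +
      4 * (Real.sqrt V / c₃) ^ 2) (hV : 0 ≤ V) :
    2 * ((L * (CR * s)) ^ 2 + (2 * B) ^ 2 * (C * (CR * s))) + 2 / K * (a * (CR * s) ^ d) * S ≤
      2 * (L ^ 2 * CR + (2 * B) ^ 2 * C) * CR * s +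
        16 * q * (L + 2 * B * b) * CR * (lam * K * s) + 8 * q / c₃ ^ 2 * (V / n) := by
  -- The mass of a ball of radius R is proportional to K/n, which cancels the 1/K of the average.
  have h1 : 2 / K * (a * (CR * s) ^ d) = 2 * q / n := by
    rw [mul_pow, hsd, hq]; field_simp
  have hq0 : 0 ≤ q := by rw [hq]; positivity
  rw [h1]
  refine (add_le_add_right (mul_le_mul_of_nonneg_left hS (by positivity)) _).trans ?_
  have h2 : 2 * ((L * (CR * s)) ^ 2 + (2 * B) ^ 2 * (C * (CR * s))) ≤
      2 * (L ^ 2 * CR + (2 * B) ^ 2 * C) * CR * s := by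
    calc _ = 2 * (L ^ 2 * (CR * s) + (2 * B) ^ 2 * C) * CR * s := by ring
      _ ≤ 2 * (L ^ 2 * (CR * 1) + (2 * B) ^ 2 * C) * CR * s := by gcongr
      _ = _ := by rw [mul_one]
  have h3 : 2 * q / n * (8 * lam * (n * K * (L * (CR * s) + 2 * B * (b * (CR * s)))) +
      4 * (Real.sqrt V / c₃) ^ 2) =
      16 * q * (L + 2 * B * b) * CR * (lam * K * s) + 8 * q / c₃ ^ 2 * (V / n) := by
    rw [div_pow, Real.sq_sqrt hV]
    field_simp
    ring
  rw [h3]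
  linarith

theorem measure_union_six_le {Ω : Type*} [MeasurableSpace Ω] {P : Measure Ω}
    {F₁ F₂ F₃ F₄ F₅ F₆ : Set Ω} {δ : ℝ} (hδ : 0 ≤ δ) (e1 : P F₁ = 0)
    (e2 : P F₂ ≤ ENNReal.ofReal (δ / 8)) (e3 : P F₃ ≤ ENNReal.ofReal (δ / 8))
    (e4 : P F₄ ≤ ENNReal.ofReal (δ / 8)) (e5 : P F₅ ≤ ENNReal.ofReal (δ / 2))
    (e6 : P F₆ ≤ ENNReal.ofReal (δ / 8)) :
    P (F₁ ∪ F₂ ∪ F₃ ∪ F₄ ∪ F₅ ∪ F₆) ≤ ENNReal.ofReal δ := by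
  calc _ ≤ P F₁ + P F₂ + P F₃ + P F₄ + P F₅ + P F₆ := by
        refine (measure_union_le _ _).trans (add_le_add_left ?_ _)
        refine (measure_union_le _ _).trans (add_le_add_left ?_ _)
        refine (measure_union_le _ _).trans (add_le_add_left ?_ _)
        refine (measure_union_le _ _).trans (add_le_add_left ?_ _)
        exact measure_union_le _ _
    _ ≤ 0 + ENNReal.ofReal (δ / 8) + ENNReal.ofReal (δ / 8) + ENNReal.ofReal (δ / 8) +
        ENNReal.ofReal (δ / 2) + ENNReal.ofReal (δ / 8) :=
        add_le_add (add_le_add (add_le_add (add_le_add (add_le_add e1.le e2) e3) e4) e5) e6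
    _ = _ := by
        rw [zero_add, ← ENNReal.ofReal_add (by positivity) (by positivity),
          ← ENNReal.ofReal_add (by positivity) (by positivity),
          ← ENNReal.ofReal_add (by positivity) (by positivity),
          ← ENNReal.ofReal_add (by positivity) (by positivity)]
        congr 1; ring

-- Six bad events of total probability at most δ are excluded; on the rest the deterministic bounds
-- combine. The constant M depends on δ only through b.
set_option maxHeartbeats 1000000 in
theorem isBigOP_mise {𝒳 : Type*} [MetricSpace 𝒳] [MeasurableSpace 𝒳] [BorelSpace 𝒳]
    {μ : Measure 𝒳} {Ω : Type*} [MeasurableSpace Ω] {P : Measure Ω} [IsProbabilityMeasure P]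
    {d : ℕ} (hd : 2 ≤ d) {p : 𝒳 → ℝ} (hp : BoundedDensity p) (hμ : VolumeGrowth μ d)
    {h : 𝒳 ≃ₜ unitCube d} (hh : BoundedDistortion h) {X : ℕ → Ω → 𝒳} (hX : IsIIDSample P μ p X)
    {C σ : ℝ} {ε : ℕ → Ω → ℝ} (hε : IsSubGaussianNoise P X C σ ε) {r : ℝ} (hr : 0 < r) {K : ℕ → ℕ}
    (hK : (fun n : ℕ => (K n : ℝ)) =Θ[atTop] (fun n : ℕ => Real.log n ^ (1 + 2 * r)))
    {f₀ : 𝒳 → ℝ} (hf₀ : IsRegressionFunction μ h f₀)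
    {N : (n : ℕ) → Ω → 𝒳 → Finset (Fin n)}
    (hN : ∀ n ω x, IsNearest (K n) Finset.univ (fun i : Fin n => X i ω) x (N n ω x))
    {nb : (n : ℕ) → Ω → Fin n → Finset (Fin n)}
    (hnb : ∀ n ω i, IsNearest (K n) (Finset.univ.erase i) (fun j : Fin n => X j ω) (X i ω)
      (nb n ω i))
    {θhat : (n : ℕ) → Ω → Fin n → ℝ}
    (hθ : ∀ n ω, IsFusedLasso (knnGraph (nb n ω)) (max 1 (Real.log n ^ (1.5 + r)))
      (fun i : Fin n => f₀ (X i ω) + ε i ω) (θhat n ω)) :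
    IsBigOP P (fun n ω => mise μ p f₀ (fun x => predict (θhat n ω) (N n ω x)))
      (fun n => Real.log n ^ (2.5 + 3 * r + (1 + 2 * r) / d) / (n : ℝ) ^ (1 / (d : ℝ))) := by
  classical
  have hd1 : 1 ≤ d := by omega
  have := hX.isProbabilityMeasure
  obtain ⟨B, C, L, hf⟩ := hf₀.exists_locallyClose hp hh
  obtain ⟨r₀, a₁, a₂, hB⟩ := exists_ballMass hp hμ
  obtain ⟨Lmin, Lmax, hLmin, hLmax, hdist⟩ := hh
  obtain ⟨CR, t₀, C₀, hCR, ht₀, hC₀, hcount⟩ := exists_radius_count hd1 hX hB hLmin hLmax hdist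
  obtain ⟨κ, t₁, K₀, c₃, hκ, ht₁, hc₃, hgrid⟩ := exists_dyadic_grid hd1 hX hB hLmin hLmax hdist
  obtain ⟨v, hv, hsub⟩ := hε.exists_hasSubgaussianMGF
  obtain ⟨c, hc, hKc⟩ := exists_eventually_le_log hK
  have hKlog := tendsto_div_log hr hK
  have hB0 := hf.bound_nonneg
  have hC0 := hf.const_nonneg
  have hL0 := hf.lip_nonneg
  have ha₂ := hB.2.2.1
  have hbad := hX.ae_forall hf.bdd
  have hv' : (0 : ℝ) < v := by exact_mod_cast hv
  refine isBigOP_of_forall fun δ hδ => ?_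
  -- Makes the Markov bound C/b at most δ/2; C + 1 keeps b positive when C = 0.
  set b : ℝ := 2 * (C + 1) / δ with hb
  have hb0 : 0 < b := by positivity
  set q : ℝ := a₂ * CR ^ d with hq
  set M : ℝ := 2 * (L ^ 2 * CR + (2 * B) ^ 2 * C) * CR * c ^ (1 / (d : ℝ)) +
    16 * q * (L + 2 * B * b) * CR * (c * c ^ (1 / (d : ℝ))) + 8 * q / c₃ ^ 2 * (6 * v) with hM
  have hq0 : 0 < q := by positivity
  refine ⟨M, by positivity, ?_⟩
  have hsmall : ∀ {f : ℕ → ℝ}, Tendsto f atTop (𝓝 0) → ∀ᶠ n in atTop, f n < δ / 8 :=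
    fun hf => hf.eventually (gt_mem_nhds (by positivity))
  have hlim4 : Tendsto (fun n : ℕ => 4 * (n : ℝ)⁻¹) atTop (𝓝 0) := by
    simpa using (tendsto_inv_atTop_nhds_zero_nat (𝕜 := ℝ)).const_mul 4
  filter_upwards [hsmall (tendsto_mul_exp_neg hKlog hC₀.le one_pos),
    hsmall (tendsto_mul_exp_neg hKlog zero_le_one hκ),
    hsmall (tendsto_mul_exp_neg hKlog zero_le_one (by norm_num : (0 : ℝ) < 1 / 2)),
    hsmall hlim4, hKlog.eventually_ge_atTop (max 1 K₀), hKc,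
    eventually_le_mul_natCast hK ht₀, eventually_le_mul_natCast hK ht₁,
    eventually_le_mul_natCast hK one_pos, tendsto_log_natCast.eventually_ge_atTop 1,
    eventually_ge_atTop 1, eventually_mul_log_rpow_le hr
      (2 * Real.sqrt (6 * v) * (κ⁻¹ + 2 * 2 ^ d * d * (κ⁻¹ * κ⁻¹)))]
    with n hn1 hn2 hn3 hn4 hKn hKcn hKt₀ hKt₁ hKn1 hlog hn hlam
  have hn' : (1 : ℝ) ≤ n := by exact_mod_cast hn
  have hn0 : (0 : ℝ) < n := by linarith
  set ell := Real.log n with hell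
  have hell0 : 0 < ell := by linarith
  have hKmax : max 1 K₀ ≤ (K n : ℝ) := by
    rw [le_div_iff₀ hell0] at hKn
    have : 1 ≤ max 1 K₀ := le_max_left _ _
    nlinarith
  have hK1' : (1 : ℝ) ≤ K n := (le_max_left _ _).trans hKmax
  have hK1 : 1 ≤ K n := by exact_mod_cast hK1'
  have hK0 : (0 : ℝ) < K n := by linarith
  obtain ⟨J, hJn, hJc, hPlow, hPup⟩ := hgrid n (K n) hK1 ((le_max_right _ _).trans hKmax) hKt₁
  obtain ⟨hJlog, hJn1⟩ := le_two_mul_log hd1 hJn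
  have hPcount := hcount n (K n) hK1 hKt₀
  set s : ℝ := ((K n : ℝ) / n) ^ (1 / (d : ℝ)) with hs
  have hs0 : 0 < s := by positivity
  have hs1 : s ≤ 1 := Real.rpow_le_one (by positivity)
    (by rw [div_le_one hn0]; linarith) (by positivity)
  have hsd : s ^ d = K n / n := by
    rw [hs, one_div, Real.rpow_inv_natCast_pow (by positivity) (by omega)]
  have hR : 0 < CR * s := by positivity
  obtain ⟨A, hA, hνA, hAclose⟩ := hf.close (CR * s) hR
  have hPA := measure_lt_count_le hX hA n (b := b * (CR * s)) (by positivity) hνA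
  -- All levels and block positions: at most n² pairs. With u = 3 log n each event has probability
  -- at most 2n⁻³, in total at most 4/n.
  set I : Finset (ℕ × (Fin d → ℕ)) := Finset.range (J + 1) ×ˢ box d (2 ^ J) with hI
  have hPnoise := hε.measure_blocks_le hv hsub hX.measurable (measurable_cell h (2 ^ J)) n I
    (u := 3 * ell) (by positivity)
  -- None of the six events involves the estimator, so its measurability plays no role.
  set F₁ : Set Ω := {ω | ¬ ∀ i, |f₀ (X i ω)| ≤ B} with hF₁
  set F₂ : Set Ω := {ω | ∃ x, count (fun i : Fin n => X i ω)
    (Metric.closedBall x (CR * s)) ≤ K n} with hF₂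
  set F₃ : Set Ω := {ω | ∃ y ∈ box d (2 ^ J),
    (count (fun i : Fin n => X i ω) {x | cell h (2 ^ J) x = y} : ℝ) ≤ κ * K n} with hF₃
  set F₄ : Set Ω := {ω | ∃ i : Fin n, K n + 1 ≤ count (fun i : Fin n => X i ω)
    (Metric.closedBall (X i ω) (2 * Real.sqrt d / ((2 ^ J : ℕ) * Lmin)))} with hF₄
  set F₅ : Set Ω := {ω | n * (b * (CR * s)) < (count (fun i : Fin n => X i ω) A : ℝ)} with hF₅
  set F₆ : Set Ω := {ω | (∃ q ∈ I, Real.sqrt (2 * v * (3 * ell) *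
      (Finset.univ.filter fun i : Fin n =>
        (fun k => cell h (2 ^ J) (X i ω) k / 2 ^ q.1) = q.2).card) <
      |∑ i ∈ Finset.univ.filter fun i : Fin n =>
        (fun k => cell h (2 ^ J) (X i ω) k / 2 ^ q.1) = q.2, ε i ω|) ∨
    ∃ i : Fin n, Real.sqrt (2 * v * (3 * ell)) < |ε i ω|} with hF₆
  refine ⟨F₁ ∪ F₂ ∪ F₃ ∪ F₄ ∪ F₅ ∪ F₆, ?_, fun ω hω => ?_⟩
  · have e2 : P F₂ ≤ ENNReal.ofReal (δ / 8) := hPcount.trans (ENNReal.ofReal_le_ofReal (by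
      rw [one_mul] at hn1; exact hn1.le))
    have e3 : P F₃ ≤ ENNReal.ofReal (δ / 8) := hPlow.trans (ENNReal.ofReal_le_ofReal (by
      rw [one_mul] at hn2; exact hn2.le))
    have e4 : P F₄ ≤ ENNReal.ofReal (δ / 8) := hPup.trans (ENNReal.ofReal_le_ofReal (by
      rw [one_mul, one_div_mul_eq_div] at hn3; exact hn3.le))
    have e5 : P F₅ ≤ ENNReal.ofReal (δ / 2) := hPA.trans (ENNReal.ofReal_le_ofReal (by
      rw [mul_div_mul_right _ _ hR.ne', hb, div_le_iff₀ (by positivity)]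
      have : δ / 2 * (2 * (C + 1) / δ) = C + 1 := by field_simp
      rw [this]; linarith))
    have e6 : P F₆ ≤ ENNReal.ofReal (δ / 8) := by
      refine hPnoise.trans (ENNReal.ofReal_le_ofReal (le_trans ?_ hn4.le))
      have hcardI : (I.card : ℝ) ≤ n * n := by
        rw [hI, Finset.card_product, Finset.card_range, card_box]
        push_cast
        have : ((J : ℝ) + 1) ≤ n := by exact_mod_cast hJn1
        gcongr
      have hexp : Real.exp (-(3 * ell)) = ((n : ℝ) ^ 3)⁻¹ := by
        rw [Real.exp_neg, hell, ← Nat.cast_ofNat (n := 3), Real.exp_nat_mul, Real.exp_log hn0]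
      rw [hexp]
      calc _ ≤ ((n : ℝ) * n + n * n) * (2 * ((n : ℝ) ^ 3)⁻¹) := by
            gcongr
            nlinarith
        _ = _ := by field_simp; norm_num
    exact measure_union_six_le hδ.le hbad e2 e3 e4 e5 e6
  simp only [Set.mem_union, not_or] at hω
  obtain ⟨⟨⟨⟨⟨hω1, hω2⟩, hω3⟩, hω4⟩, hω5⟩, hω6⟩ := hω
  rw [hF₁, Set.mem_ofPred_eq, not_not] at hω1
  rw [hF₂, Set.mem_ofPred_eq] at hω2
  rw [hF₃, Set.mem_ofPred_eq] at hω3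
  rw [hF₄, Set.mem_ofPred_eq] at hω4
  rw [hF₅, Set.mem_ofPred_eq, not_lt] at hω5
  rw [hF₆, Set.mem_ofPred_eq, not_or] at hω6
  push Not at hω2 hω3 hω4 hω6
  obtain ⟨hω6, hω7⟩ := hω6
  set V : ℝ := 2 * v * (3 * ell) with hV
  have hV0 : 0 ≤ V := by positivity
  set pts : Fin n → 𝒳 := fun i => X i ω with hpts
  have hKn : K n ≤ n := by exact_mod_cast (by linarith : (K n : ℝ) ≤ n)
  have hnbR : ∀ i, ∀ j ∈ nb n ω i, dist (pts j) (pts i) ≤ CR * s := by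
    intro i j hj
    refine (hnb n ω i).dist_le ?_ hj
    have h1 := hω2 (pts i)
    rw [count_closedBall] at h1
    -- The ball holds more than K points including X i itself, so at least K remain without it.
    rw [Finset.filter_erase]
    have h2 := Finset.pred_card_le_card_erase (a := i)
      (s := Finset.univ.filter fun j => dist (pts j) (pts i) ≤ CR * s)
    exact le_trans (by omega) h2
  have hpen := penalty_regression_le (pts := pts) hB0 hL0 hR.le hAclose (fun i => hω1 i)
    (fun i => (hnb n ω i).2.1.trans_le (min_le_left _ _)) hnbR hω5
  have hinner := noise_inner_le hd hLmin (fun x x' => (hdist x x').1) hκ hc₃ hK1 hn hV0 hJc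
    (fun y hy => (hω3 y hy).le) (fun i => Nat.lt_succ_iff.1 (hω4 i)) (hnb n ω)
    (e := fun i => ε i ω)
    (fun l hl x hx => hω6 (l, x) (Finset.mem_product.2
      ⟨Finset.mem_range.2 (Nat.lt_succ_of_le hl), hx⟩)) hω7
    (fun i => θhat n ω i - f₀ (pts i))
  have hone : 1 ≤ ell ^ (1.5 + r) := Real.one_le_rpow hlog (by positivity)
  have hθn := hθ n ω
  rw [max_eq_right hone] at hθn
  have hcoef := (noise_coefficient_le (d := d) (v := 6 * v) hκ (by positivity) hlog hK1
    hJlog).trans hlam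
  have hV' : 6 * v * ell = V := by rw [hV]; ring
  rw [hV'] at hcoef
  have hfit := hθn.sum_sq_le (f := fun i => f₀ (pts i)) (e := fun i => ε i ω)
    (τ := Real.sqrt V / c₃) (by positivity) (hinner.trans (by
      rw [← mul_assoc]
      exact add_le_add_left (mul_le_mul_of_nonneg_right hcoef (penalty_nonneg _ _)) _))
  have hmise := mise_le hf (pts := pts) hR hA hνA hAclose hK1 (fun i => hω1 i)
    (by positivity : 0 ≤ a₂ * (CR * s) ^ d) (fun x => (hB.2.2.2 x _ hR).2)
    (N := N n ω) (fun x => by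
      rw [(hN n ω x).2.1, Finset.card_univ, Fintype.card_fin, min_eq_left hKn])
    (fun x i hi => (hN n ω x).dist_le (by rw [← count_closedBall]; exact (hω2 x).le) hi)
    (θhat n ω)
  refine hmise.trans (ENNReal.ofReal_le_ofReal ?_)
  have hS := hfit.trans (add_le_add_left (mul_le_mul_of_nonneg_left hpen
    (by positivity : 0 ≤ 8 * ell ^ (1.5 + r))) _)
  refine (total_error_le hCR ha₂.le hq hn0 hK0 hs0.le hs1 hsd hS hV0).trans ?_
  obtain ⟨g1, g2, g3⟩ := rate_bounds hd1 hr hlog hn' hK0 hc hKcn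
  set rate : ℝ := ell ^ (2.5 + 3 * r + (1 + 2 * r) / d) / (n : ℝ) ^ (1 / (d : ℝ)) with hrate
  have g3' : V / n ≤ 6 * v * rate := by
    rw [← hV', mul_div_assoc]
    gcongr
  calc _ ≤ 2 * (L ^ 2 * CR + (2 * B) ^ 2 * C) * CR * (c ^ (1 / (d : ℝ)) * rate) +
        16 * q * (L + 2 * B * b) * CR * (c * c ^ (1 / (d : ℝ)) * rate) +
          8 * q / c₃ ^ 2 * (6 * v * rate) := by gcongr
    _ = M * rate := by rw [hM]; ring

end

end KNNFL

open KNNFL in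
theorem theorem5p2
    {𝒳 : Type*} [MetricSpace 𝒳] [MeasurableSpace 𝒳] [BorelSpace 𝒳] (μ : Measure 𝒳)
    {Ω : Type*} [MeasurableSpace Ω] (P : Measure Ω) [IsProbabilityMeasure P]
    (d : ℕ) (hd : 1 ≤ d)
    (p : 𝒳 → ℝ) (hp : BoundedDensity p)
    (hμ : VolumeGrowth μ d)
    (h : 𝒳 ≃ₜ unitCube d) (hh : BoundedDistortion h)
    (X : ℕ → Ω → 𝒳) (hX : IsIIDSample P μ p X) :
    -- the approximation error
    (∀ f₀ : 𝒳 → ℝ, IsRegressionFunction μ h f₀ →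
      ∀ K : ℕ → ℕ, Tendsto (fun n => (K n : ℝ) / Real.log n) atTop atTop →
      ∀ N : (n : ℕ) → Ω → 𝒳 → Finset (Fin n),
        (∀ n ω x, IsNearest (K n) Finset.univ (fun i : Fin n => X i ω) x (N n ω x)) →
        IsBigOP P
          (fun n ω => aErr μ p f₀ (K n) (fun i : Fin n => X i ω) (N n ω))
          (fun n => (K n : ℝ) ^ (1 / (d : ℝ)) / (n : ℝ) ^ (1 / (d : ℝ)))) ∧
    -- the prediction error of the fused lasso on the nearest neighbour graph
    (2 ≤ d →
      ∀ (C σ : ℝ) (ε : ℕ → Ω → ℝ), IsSubGaussianNoise P X C σ ε →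
      ∀ r : ℝ, 0 < r →
      ∀ K : ℕ → ℕ,
        (fun n : ℕ => (K n : ℝ)) =Θ[atTop] (fun n : ℕ => Real.log n ^ (1 + 2 * r)) →
      ∃ lam : ℕ → ℝ, (∀ n, 0 < lam n) ∧
        ∀ f₀ : 𝒳 → ℝ, IsRegressionFunction μ h f₀ →
        ∀ N : (n : ℕ) → Ω → 𝒳 → Finset (Fin n),
          (∀ n ω x, IsNearest (K n) Finset.univ (fun i : Fin n => X i ω) x (N n ω x)) →
        ∀ nb : (n : ℕ) → Ω → Fin n → Finset (Fin n),
          (∀ n ω i, IsNearest (K n) (Finset.univ.erase i) (fun j : Fin n => X j ω) (X i ω)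
            (nb n ω i)) →
        ∀ θhat : (n : ℕ) → Ω → Fin n → ℝ,
          (∀ n ω, IsFusedLasso (knnGraph (nb n ω)) (lam n)
            (fun i : Fin n => f₀ (X i ω) + ε i ω) (θhat n ω)) →
          IsBigOP P
            (fun n ω => mise μ p f₀ (fun x => predict (θhat n ω) (N n ω x)))
            (fun n => Real.log n ^ (2.5 + 3 * r + (1 + 2 * r) / d) /
              (n : ℝ) ^ (1 / (d : ℝ)))) := by
  refine ⟨fun f₀ hf₀ K hK N hN => isBigOP_aErr hd hp hμ hh hX hf₀ hK hN, ?_⟩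
  intro hd2 C σ ε hε r hr K hK
  -- The maximum with 1 only secures positivity where log n vanishes; for large n the power of the
  -- logarithm is the larger.
  refine ⟨fun n => max 1 (Real.log n ^ (1.5 + r)), fun n => lt_max_of_lt_left one_pos, ?_⟩
  intro f₀ hf₀ N hN nb hnb θhat hθ
  exact isBigOP_mise hd2 hp hμ hh hX hε hr hK hf₀ hN hnb hθ
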